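/- Let $(Y,h)$ be a compact smooth Riemannian manifold, with or without boundary, of dimension $n-1\ge 0$, and let $C(Y)=(0,\infty)_r\times Y$ be the cone over $Y$ with the metric $g=dr^2+r^2h$ and volume $r^{n-1}\,dr\,d\mathrm{vol}_h$. Let $\Delta$ be the Friedrichs extension of the (negative) Laplacian $\partial_r^2+\frac{n-1}{r}\partial_r+\frac1{r^2}\Delta_h$ on $L^2(C(Y))$, with the Dirichlet or the Neumann condition at $(0,\infty)\times\partial Y$ if $\partial Y\neq\emptyset$; that is, the operator of the closure of the Dirichlet form of $g$ on $C_c^\infty((0,\infty)\times(Y\setminus\partial Y))$, respectively on $C_c^\infty((0,\infty)\times Y)$. Let $\Lambda$ be the logarithmic cover of $\mathbb{C}\setminus\{0\}$, with points $\lambda$ given by $|\lambda|>0$ and $\arg\lambda\in\mathbb{R}$, in which the physical half-plane is $\{0<\arg\lambda<\pi\}$. Then for $\operatorname{Im}\lambda>0$ the resolvent $R(\lambda)=(\Delta+\lambda^2)^{-1}$ exists as a bounded operator on $L^2(C(Y))$; for every $\chi\in C_c^\infty(C(Y))$ the cutoff resolvent $\chi R(\lambda)\chi$ continues meromorphically,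 as a function with values in the bounded operators on $L^2(C(Y))$, from the physical half-plane to $\Lambda$; and $C(Y)$ has no resonances: for no $\chi$ does this continuation have a pole at a point $\lambda\in\Lambda$ outside the physical half-plane. -/

import Mathlib

open scoped Manifold ContDiff Topology

noncomputable section

namespace RiemannianCone

open MeasureTheory Set Filter

/-- The coordinate space `ℝᵈ`, with its Euclidean structure and Lebesgue measure. -/
abbrev Coord (d : ℕ) : Type := EuclideanSpace ℝ (Fin d)

/-- The `i`-th standard basis vector of `ℝᵈ`. -/
def basisVec {d : ℕ} (i : Fin d) : Coord d := EuclideanSpace.single i (1 : ℝ)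

section Link

variable {d : ℕ} {H : Type*} [TopologicalSpace H] (I : ModelWithCorners ℝ (Coord d) H)
  {Y : Type*} [TopologicalSpace Y] [ChartedSpace H Y] [IsManifold I ∞ Y]

variable (Y) in
/-- Smooth Riemannian metrics `h` on `Y`. -/
abbrev Metric : Type _ :=
  Bundle.ContMDiffRiemannianMetric I ∞ (Coord d) (fun y : Y => TangentSpace I y)

variable {I}

/-- The Gram matrix `(h_y(eᵢ, eⱼ))` of the metric in the standard basis of `T_y Y = ℝᵈ`
(the coordinates of the preferred chart at `y`). -/
def gram (h : Metric I Y) (y : Y) : Matrix (Fin d) (Fin d) ℝ :=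
  Matrix.of fun i j =>
    h.inner y (basisVec i : TangentSpace I y) (basisVec j : TangentSpace I y)

/-- The hermitian pairing `∑ h^{ij} α(eᵢ) conj(β(eⱼ))` induced by `h` on complex-valued
covectors at `y`. -/
def covectorInner (h : Metric I Y) (y : Y)
    (α β : TangentSpace I y → ℂ) : ℂ :=
  ∑ i, ∑ j, (((gram h y)⁻¹ i j : ℝ) : ℂ)
    * α (basisVec i : TangentSpace I y)
    * (starRingEnd ℂ) (β (basisVec j : TangentSpace I y))

/-- The coordinate vector field `∂ᵢ` of the chart around `x`, at the point with coordinates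
`z`. -/
def coordField (x : Y) (z : Coord d) (i : Fin d) :
    TangentSpace I ((extChartAt I x).symm z) :=
  mfderivWithin 𝓘(ℝ, Coord d) I (extChartAt I x).symm (range I) z
    (basisVec i : TangentSpace 𝓘(ℝ, Coord d) z)

/-- The coefficients `h_{ij}(z) = h(∂ᵢ, ∂ⱼ)` of the metric in the chart around `x`. -/
def chartGram (h : Metric I Y) (x : Y) (z : Coord d) : Matrix (Fin d) (Fin d) ℝ :=
  Matrix.of fun i j =>
    h.inner ((extChartAt I x).symm z) (coordField x z i) (coordField x z j)

variable [MeasurableSpace Y]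

/-- The Riemannian volume of `h` on the domain of the chart around `x`:
`√(det h_{ij}) dz` in coordinates (and zero outside that domain). -/
def chartVolume (h : Metric I Y) (x : Y) : Measure Y :=
  Measure.map (extChartAt I x).symm
    ((volume.restrict (extChartAt I x).target).withDensity
      fun z => ENNReal.ofReal (Real.sqrt (chartGram h x z).det))

/-- The Riemannian volume measure of `(Y, h)`: the measure obtained by gluing the chart
volumes. As they agree on overlaps of charts, the glued measure is their supremum. -/
def riemannianVolume (h : Metric I Y) : Measure Y := ⨆ x : Y, chartVolume h x

end Link

section Cone

variable {d : ℕ} {H : Type*} [TopologicalSpace H] {I : ModelWithCorners ℝ (Coord d) H}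
  {Y : Type*} [TopologicalSpace Y] [ChartedSpace H Y] [IsManifold I ∞ Y]

/-- The self-adjoint boundary condition imposed at `(0, ∞) × ∂Y`; the two coincide if
`∂Y = ∅`. -/
inductive BoundaryCondition : Type
  | dirichlet
  | neumann

variable (I Y) in
/-- The part of `Y` over which the core functions of the form domain may be supported:
the interior of `Y` (Dirichlet), or all of `Y` (Neumann, the natural boundary condition). -/
def BoundaryCondition.region : BoundaryCondition → Set Y
  | .dirichlet => I.interior Y
  | .neumann => univ

variable (I) in
/-- `u ∈ C_c^∞((0, ∞) × S)`. Functions on the cone `C(Y) = (0, ∞) × Y` with compact support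
are regarded as functions on `ℝ × Y` that vanish for `r ≤ 0`. -/
structure IsTest (S : Set Y) (u : ℝ × Y → ℂ) : Prop where
  contMDiff : ContMDiff (𝓘(ℝ, ℝ).prod I) 𝓘(ℝ, ℂ) ∞ u
  hasCompactSupport : HasCompactSupport u
  tsupport_subset : tsupport u ⊆ Ioi (0 : ℝ) ×ˢ S

/-- The radial derivative `∂_r u`. -/
def radialDeriv (u : ℝ × Y → ℂ) (p : ℝ × Y) : ℂ := deriv (fun s : ℝ => u (s, p.2)) p.1

variable (I) in
/-- The differential of `u` along the link, `d_Y u`, as a covector at the point `y`. -/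
def linkDeriv (u : ℝ × Y → ℂ) (p : ℝ × Y) : TangentSpace I p.2 → ℂ :=
  fun v => mfderiv I 𝓘(ℝ, ℂ) (fun y : Y => u (p.1, y)) p.2 v

variable [MeasurableSpace Y]

/-- The Riemannian volume `r^{n-1} dr dvol_h` of the cone metric `g = dr² + r² h` on
`C(Y) = (0, ∞) × Y`, where `n - 1 = d = dim Y`. -/
def coneMeasure (h : Metric I Y) : Measure (ℝ × Y) :=
  ((volume.restrict (Ioi (0 : ℝ))).withDensity fun r => ENNReal.ofReal (r ^ d)).prod
    (riemannianVolume h)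

/-- The Hilbert space `L²(C(Y); ℂ)`. -/
abbrev ConeL2 (h : Metric I Y) : Type _ := Lp ℂ 2 (coneMeasure h)

/-- The Dirichlet form `∫ ⟨du, dv⟩_g dvol_g` of the cone metric `g = dr² + r² h`, that is,
the form of minus the Laplacian `∂_r² + ((n-1)/r) ∂_r + r⁻² Δ_h`. -/
def dirichletForm (h : Metric I Y) (u v : ℝ × Y → ℂ) : ℂ :=
  ∫ p, (radialDeriv u p * (starRingEnd ℂ) (radialDeriv v p)
    + (((p.1 ^ 2)⁻¹ : ℝ) : ℂ) * covectorInner h p.2 (linkDeriv I u p) (linkDeriv I v p))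
    ∂(coneMeasure h)

/-- The graph of the (negative) Friedrichs Laplacian `Δ` of the cone: `u` is in its domain and
`Δ u = f`. This is the operator of the closure of the Dirichlet form `q` on the core:
`u` is the `L²`-limit of a `q`-Cauchy sequence `φ k` of core functions, and
`q(u, ψ) = lim q(φ k, ψ)` equals `-⟨f, ψ⟩` for all core functions `ψ`. -/
def IsFriedrichsLaplacian (h : Metric I Y) (bc : BoundaryCondition)
    (u f : ConeL2 h) : Prop :=
  ∃ φ : ℕ → ℝ × Y → ℂ,
    (∀ k, IsTest I (bc.region I Y) (φ k)) ∧
    Tendsto (fun k => eLpNorm (fun p => φ k p - u p) 2 (coneMeasure h)) atTop (𝓝 0) ∧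
    (∀ ε > (0 : ℝ), ∃ N, ∀ k ≥ N, ∀ l ≥ N,
      (dirichletForm h (φ k - φ l) (φ k - φ l)).re < ε) ∧
    ∀ ψ, IsTest I (bc.region I Y) ψ →
      Tendsto (fun k => dirichletForm h (φ k) ψ) atTop
        (𝓝 (-∫ p, f p * (starRingEnd ℂ) (ψ p) ∂(coneMeasure h)))

/-- The bounded operator `R` is the inverse of `Δ + w`: `R f = u` if and only if `u` is in
the domain of `Δ` and `Δ u + w u = f`. -/
def IsResolventAt (h : Metric I Y) (bc : BoundaryCondition) (w : ℂ)
    (R : ConeL2 h →L[ℂ] ConeL2 h) : Prop :=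
  ∀ f u : ConeL2 h, R f = u ↔ IsFriedrichsLaplacian h bc u (f - w • u)

open Classical in
/-- The resolvent `R(lam) = (Δ + lam²)⁻¹`, for `lam` in the upper half-plane (it is zero where
`Δ + lam²` has no bounded inverse). -/
def resolvent (h : Metric I Y) (bc : BoundaryCondition) (lam : ℂ) :
    ConeL2 h →L[ℂ] ConeL2 h :=
  if hR : ∃ R, IsResolventAt h bc (lam ^ 2) R then hR.choose else 0


/-- A cutoff function `χ ∈ C_c^∞(C(Y))`; its support may reach `(0, ∞) × ∂Y`. -/
abbrev IsCutoff (I : ModelWithCorners ℝ (Coord d) H) (χ : ℝ × Y → ℂ) : Prop :=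
  IsTest I (univ : Set Y) χ

/-- A cutoff function is bounded and measurable. -/
theorem IsTest.memLp_top [BorelSpace Y] {S : Set Y} {χ : ℝ × Y → ℂ} (hχ : IsTest I S χ)
    (h : Metric I Y) : MemLp χ ⊤ (coneMeasure h) := by
  have hc : Continuous χ := hχ.contMDiff.continuous
  obtain ⟨C, hC⟩ := hχ.hasCompactSupport.exists_bound_of_continuous hc
  exact memLp_top_of_bound hc.aestronglyMeasurable C (Eventually.of_forall hC)

/-- The operator of multiplication by `χ` on `L²(C(Y))`. -/
def mulOp [BorelSpace Y] (h : Metric I Y) {χ : ℝ × Y → ℂ} (hχ : IsCutoff I χ) :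
    ConeL2 h →L[ℂ] ConeL2 h :=
  (ContinuousLinearMap.mul ℂ ℂ).holderL (coneMeasure h) ⊤ 2 2 ((hχ.memLp_top h).toLp χ)

/-- The cutoff resolvent `χ R(lam) χ`. -/
def cutoffResolvent [BorelSpace Y] (h : Metric I Y) (bc : BoundaryCondition)
    {χ : ℝ × Y → ℂ} (hχ : IsCutoff I χ) (lam : ℂ) : ConeL2 h →L[ℂ] ConeL2 h :=
  (mulOp h hχ) ∘L (resolvent h bc lam) ∘L (mulOp h hχ)

end Cone

section LogCover

/-- The logarithmic cover of `ℂ ∖ {0}`: its points are given by a magnitude in `(0, ∞)` and a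
phase in `ℝ`. -/
@[ext]
structure LogCover : Type where
  modulus : ℝ
  arg : ℝ
  modulus_pos : 0 < modulus

namespace LogCover

/-- The covering map to `ℂ ∖ {0}`. -/
def proj (lam : LogCover) : ℂ := lam.modulus * Complex.exp (lam.arg * Complex.I)

/-- The global holomorphic coordinate `log : Λ → ℂ`. -/
def log (lam : LogCover) : ℂ := Real.log lam.modulus + lam.arg * Complex.I

/-- The inverse of the global coordinate `log`. -/
def ofLog (ζ : ℂ) : LogCover := ⟨Real.exp ζ.re, ζ.im, Real.exp_pos _⟩

/-- The physical half-plane `0 < arg lam < π`. -/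
def IsPhysical (lam : LogCover) : Prop := 0 < lam.arg ∧ lam.arg < Real.pi

variable {B : Type*} [NormedAddCommGroup B] [NormedSpace ℂ B]

/-- `F` is meromorphic on the Riemann surface `Λ`. -/
def Meromorphic (F : LogCover → B) : Prop := ∀ ζ : ℂ, MeromorphicAt (F ∘ ofLog) ζ

/-- `F` has a pole at `lam`. -/
def HasPole (F : LogCover → B) (lam : LogCover) : Prop :=
  meromorphicOrderAt (F ∘ ofLog) lam.log < 0

end LogCover

end LogCover

section Resonances

variable {d : ℕ} {H : Type*} [TopologicalSpace H] {I : ModelWithCorners ℝ (Coord d) H}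
  {Y : Type*} [TopologicalSpace Y] [ChartedSpace H Y] [IsManifold I ∞ Y]
  [MeasurableSpace Y] [BorelSpace Y]

/-- `F` is a meromorphic continuation of the cutoff resolvent `χ R χ` from the physical
half-plane to the logarithmic cover, as a function with values in the bounded operators. -/
def IsContinuation (h : Metric I Y) (bc : BoundaryCondition) {χ : ℝ × Y → ℂ}
    (hχ : IsCutoff I χ) (F : LogCover → ConeL2 h →L[ℂ] ConeL2 h) : Prop :=
  LogCover.Meromorphic F ∧
    ∀ lam : LogCover, lam.IsPhysical → F lam = cutoffResolvent h bc hχ lam.proj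

/-- Resonances: poles off the physical half-plane of the continued cutoff resolvent `χ R χ`,
for some cutoff function `χ`. -/
def IsResonance (h : Metric I Y) (bc : BoundaryCondition) (lam : LogCover) : Prop :=
  ¬ lam.IsPhysical ∧ ∃ (χ : ℝ × Y → ℂ) (hχ : IsCutoff I χ)
    (F : LogCover → ConeL2 h →L[ℂ] ConeL2 h),
    IsContinuation h bc hχ F ∧ LogCover.HasPole F lam

end Resonances

end RiemannianCone

/-! For `Re λ² < 0` the resolvent is a Laplace transform of the heat semigroup, `(Δ + λ²)⁻¹ = -∫₀^∞
e^{λ² t} e^{tΔ} dt`. Continuing it in `λ` through all arguments amounts to rotating the ray of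
integration through arbitrary angles, so the question is how far `χ e^{tΔ} χ` continues in `t`, and
with what bounds.

The cone is invariant under dilations of `r`. Dilations combined with multiplication by Gaussians
`e^{-a r²}` (the lens transform) turn the heat equation of `Δ` into that of the harmonic oscillator
`A = -Δ + r²/4`. With `m = tanh(s/2)/4` this gives `e^{-m r²} e^{(sinh s) Δ} e^{-m r²} = e^{-sA}`
(`gaussL2_comp_heat_comp_gaussL2`), a Mehler formula obtained without separation of variables. Hence
`χ e^{(sinh s) Δ} χ = (χ e^{m r²}) e^{-sA} (e^{m r²} χ)`. The right side is holomorphic in `Re s >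
0`. It is bounded for `Re s ≥ 1`, uniformly in `Im s`: `e^{-sA}` is a contraction whatever `Im s`
is, `m` is bounded there, and `χ` has compact support (`exists_isContourBounded_cutoffHeat`). In
terms of `t = sinh s` this covers infinitely many sheets.

In the variable `s` the kernel `e^{λ² sinh s} cosh s` decays doubly exponentially along `Im s = φ`
as soon as `Re (λ² e^{iφ}) < 0`. The contour from `0` through `1` and `1 + iφ` to `∞ + iφ` can
follow the argument of `λ²` indefinitely, and by Cauchy's theorem the integral does not depend on
the admissible `φ`. The result is an entire function of `log λ` (`exists_entire`). It equals the
cutoff resolvent where `Re λ² < 0`, hence on the whole physical half-plane, and by the identity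
theorem every meromorphic continuation is without poles.

The intertwining is proved weakly, with no knowledge of operator domains: the transformed flow
solves the oscillator's heat equation tested against core functions, and bounded weak solutions are
unique (`weakSolution_eq_heat`, `comp_heat_eq_heat`). The boundary condition enters only through the
core, which dilations and radial factors preserve. The operators enter through `C = (A + 1)⁻¹ = j
j*`, where `j` maps the form domain to `L²`, so that all functions of `A` are continuous functions
of a bounded self-adjoint operator with spectrum in `[0, 1]`. -/

namespace RiemannianCone

open MeasureTheory Set Filter

section Semigroup

/-! ### The semigroup of a resolvent

For a form operator `A ≥ 0` with `C = (A + 1)⁻¹`, the operators `(A + 1)ᵏ e^{-sA}` are functions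
of the bounded self-adjoint operator `C`. -/

/-- The function `x ↦ x⁻ᵏ exp (-s (x⁻¹ - 1))`, extended by zero to `x ≤ 0`. -/
def heatSymbol (k : ℕ) (s : ℂ) (x : ℝ) : ℂ :=
  if x ≤ 0 then 0 else ((x⁻¹ ^ k : ℝ) : ℂ) * Complex.exp (-s * ((x⁻¹ - 1 : ℝ) : ℂ))

theorem heatSymbol_of_pos (k : ℕ) (s : ℂ) {x : ℝ} (hx : 0 < x) :
    heatSymbol k s x = ((x⁻¹ ^ k : ℝ) : ℂ) * Complex.exp (-s * ((x⁻¹ - 1 : ℝ) : ℂ)) :=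
  if_neg hx.not_ge

theorem heatSymbol_of_nonpos (k : ℕ) (s : ℂ) {x : ℝ} (hx : x ≤ 0) : heatSymbol k s x = 0 :=
  if_pos hx

theorem norm_heatSymbol_of_pos (k : ℕ) (s : ℂ) {x : ℝ} (hx : 0 < x) :
    ‖heatSymbol k s x‖ = x⁻¹ ^ k * Real.exp (-s.re * (x⁻¹ - 1)) := by
  rw [heatSymbol_of_pos k s hx, norm_mul, Complex.norm_exp, Complex.norm_real,
    Real.norm_of_nonneg (by positivity), neg_mul, Complex.neg_re, Complex.re_mul_ofReal, neg_mul]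

/-- A single term of the series of `exp (σ u)` is at most its sum. -/
theorem pow_mul_exp_neg_le (k : ℕ) {σ u : ℝ} (hσ : 0 < σ) (hu : 0 ≤ u) :
    u ^ k * Real.exp (-σ * u) ≤ k.factorial / σ ^ k := by
  have h := Real.pow_div_factorial_le_exp (σ * u) (by positivity) k
  have hk : (0 : ℝ) < k.factorial := by exact_mod_cast k.factorial_pos
  rw [div_le_iff₀ hk, mul_pow] at h
  rw [le_div_iff₀ (by positivity), neg_mul, Real.exp_neg]
  have he := Real.exp_pos (σ * u)
  rw [show u ^ k * (Real.exp (σ * u))⁻¹ * σ ^ k = (σ ^ k * u ^ k) / Real.exp (σ * u) by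
    field_simp, div_le_iff₀ he]
  linarith

/-- A bound for `heatSymbol` which vanishes linearly at the origin. -/
theorem norm_heatSymbol_le_mul (k : ℕ) {s : ℂ} (hs : 0 < s.re) {x : ℝ} (hx : 0 ≤ x) :
    ‖heatSymbol k s x‖ ≤ (Real.exp s.re * (k + 1).factorial / s.re ^ (k + 1)) * x := by
  rcases hx.eq_or_lt with rfl | hx
  · simp [heatSymbol]
  rw [norm_heatSymbol_of_pos k s hx]
  have h := pow_mul_exp_neg_le (k + 1) hs (inv_nonneg.2 hx.le)
  have e : x⁻¹ ^ k * Real.exp (-s.re * (x⁻¹ - 1))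
      = Real.exp s.re * (x⁻¹ ^ (k + 1) * Real.exp (-s.re * x⁻¹)) * x := by
    rw [show -s.re * (x⁻¹ - 1) = s.re + -s.re * x⁻¹ by ring, Real.exp_add, pow_succ]
    field_simp
  rw [e, mul_div_assoc]
  gcongr

/-- A uniform bound for `heatSymbol` on the unit interval. -/
def heatBound (k : ℕ) (σ : ℝ) : ℝ := Real.exp σ * (k + 1).factorial / σ ^ (k + 1)

theorem heatBound_nonneg (k : ℕ) {σ : ℝ} (hσ : 0 < σ) : 0 ≤ heatBound k σ := by
  unfold heatBound; positivity

theorem norm_heatSymbol_le (k : ℕ) {s : ℂ} (hs : 0 < s.re) {x : ℝ} (hx : x ∈ Icc (0 : ℝ) 1) :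
    ‖heatSymbol k s x‖ ≤ heatBound k s.re :=
  (norm_heatSymbol_le_mul k hs hx.1).trans
    (mul_le_of_le_one_right (heatBound_nonneg k hs) hx.2)

theorem norm_heatSymbol_zero_le {s : ℂ} (hs : 0 ≤ s.re) {x : ℝ} (hx : x ∈ Icc (0 : ℝ) 1) :
    ‖heatSymbol 0 s x‖ ≤ 1 := by
  rcases hx.1.eq_or_lt with rfl | h0
  · simp [heatSymbol]
  rw [norm_heatSymbol_of_pos 0 s h0, pow_zero, one_mul, Real.exp_le_one_iff]
  have : 1 ≤ x⁻¹ := (one_le_inv₀ h0).2 hx.2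
  nlinarith

/-- With `y = x⁻¹ - 1 ≥ 0` the modulus is `(y + 1) e^{-y Re s}`, and the two summands are treated
separately. This bounds the heat flow in the form norm, locally uniformly in positive time. -/
theorem norm_heatSymbol_one_le {s : ℂ} (hs : 0 < s.re) {x : ℝ} (hx : x ∈ Icc (0 : ℝ) 1) :
    ‖heatSymbol 1 s x‖ ≤ 1 + s.re⁻¹ := by
  rcases hx.1.eq_or_lt with rfl | h0
  · simp only [heatSymbol, le_refl, if_true, norm_zero]; positivity
  rw [norm_heatSymbol_of_pos 1 s h0, pow_one]
  have h1 : 0 ≤ x⁻¹ - 1 := sub_nonneg.2 ((one_le_inv₀ h0).2 hx.2)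
  have h2 := pow_mul_exp_neg_le 1 hs h1
  have h3 : Real.exp (-s.re * (x⁻¹ - 1)) ≤ 1 := by
    rw [Real.exp_le_one_iff]; nlinarith
  simp only [pow_one, Nat.factorial_one, Nat.cast_one, one_div] at h2
  nlinarith

/-- The endpoint `0` is the point: it lies in the spectrum of `(A + 1)⁻¹` when `A` is unbounded, and
there the exponential beats every power of `x⁻¹`. -/
theorem continuousOn_heatSymbol (k : ℕ) {s : ℂ} (hs : 0 < s.re) :
    ContinuousOn (heatSymbol k s) (Icc 0 1) := by
  intro x hx
  rcases hx.1.eq_or_lt with rfl | h0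
  · rw [ContinuousWithinAt, heatSymbol_of_nonpos k s le_rfl]
    refine squeeze_zero_norm' (a := fun x => heatBound k s.re * x) ?_ ?_
    · filter_upwards [self_mem_nhdsWithin] with x hx using norm_heatSymbol_le_mul k hs hx.1
    · have : Tendsto (fun x => heatBound k s.re * x) (𝓝 0) (𝓝 (heatBound k s.re * 0)) :=
        (continuous_const.mul continuous_id).tendsto 0
      rw [mul_zero] at this
      exact this.mono_left nhdsWithin_le_nhds
  · refine ContinuousAt.continuousWithinAt ?_
    have : (fun x : ℝ => ((x⁻¹ ^ k : ℝ) : ℂ) * Complex.exp (-s * ((x⁻¹ - 1 : ℝ) : ℂ)))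
        =ᶠ[𝓝 x] heatSymbol k s := by
      filter_upwards [lt_mem_nhds h0] with y hy using (heatSymbol_of_pos k s hy).symm
    refine ContinuousAt.congr ?_ this
    have hi : ContinuousAt (fun x : ℝ => x⁻¹) x := continuousAt_inv₀ h0.ne'
    fun_prop (disch := exact h0.ne')

theorem heatSymbol_pred {k : ℕ} {s : ℂ} {x : ℝ} (hx : 0 ≤ x) :
    (x : ℂ) * heatSymbol (k + 1) s x = heatSymbol k s x := by
  rcases hx.eq_or_lt with rfl | h0
  · simp [heatSymbol]
  rw [heatSymbol_of_pos _ _ h0, heatSymbol_of_pos _ _ h0, pow_succ]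
  have : (x : ℂ) ≠ 0 := by exact_mod_cast h0.ne'
  push_cast
  field_simp

theorem heatSymbol_mul (s t : ℂ) (x : ℝ) :
    heatSymbol 0 s x * heatSymbol 0 t x = heatSymbol 0 (s + t) x := by
  rcases le_or_gt x 0 with h0 | h0
  · simp [heatSymbol_of_nonpos, h0]
  simp only [heatSymbol_of_pos _ _ h0, pow_zero, Complex.ofReal_one, one_mul, ← Complex.exp_add]
  ring_nf

theorem heatSymbol_conj (k : ℕ) (s : ℂ) (x : ℝ) :
    star (heatSymbol k s x) = heatSymbol k (star s) x := by
  rcases le_or_gt x 0 with h0 | h0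
  · simp [heatSymbol_of_nonpos, h0]
  simp only [heatSymbol_of_pos _ _ h0, star_mul', Complex.star_def, Complex.conj_ofReal,
    ← Complex.exp_conj, map_mul, map_neg]

/-- Second-order Taylor estimate for `heatSymbol` in the time variable. -/
theorem norm_heatSymbol_taylor (k : ℕ) {s h : ℂ} (hs : 0 < s.re) (hh : ‖h‖ ≤ s.re / 2) {x : ℝ}
    (hx : x ∈ Icc (0 : ℝ) 1) :
    ‖heatSymbol k (s + h) x - heatSymbol k s x
      + h * (heatSymbol (k + 1) s x - heatSymbol k s x)‖
      ≤ heatBound (k + 2) (s.re / 2) * ‖h‖ ^ 2 := by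
  rcases hx.1.eq_or_lt with rfl | h0
  · simp only [heatSymbol, le_refl, if_true]
    simp only [sub_zero, mul_zero, add_zero, norm_zero]
    exact mul_nonneg (heatBound_nonneg _ (by positivity)) (by positivity)
  set y : ℝ := x⁻¹ - 1 with hy
  have hy0 : 0 ≤ y := sub_nonneg.2 ((one_le_inv₀ h0).2 hx.2)
  have hyx : y ≤ x⁻¹ := by linarith
  have e1 : heatSymbol k (s + h) x - heatSymbol k s x
      + h * (heatSymbol (k + 1) s x - heatSymbol k s x)
      = heatSymbol k s x * (Complex.exp (-h * y) - 1 + h * y) := by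
    simp only [heatSymbol_of_pos _ _ h0, ← hy]
    rw [show -(s + h) * (y : ℂ) = -s * y + -h * y by ring, Complex.exp_add, pow_succ,
      show x⁻¹ = y + 1 by rw [hy]; ring]
    push_cast
    ring
  have e2 := Complex.norm_exp_sub_sum_le_norm_mul_exp (-h * y) 2
  simp only [Finset.sum_range_succ, Finset.sum_range_zero, pow_zero, Nat.factorial_zero,
    Nat.cast_one, div_one, zero_add, pow_one, Nat.factorial_one] at e2
  rw [show Complex.exp (-h * y) - (1 + -h * y) = Complex.exp (-h * y) - 1 + h * y by ring,
    norm_mul, norm_neg, Complex.norm_real, Real.norm_of_nonneg hy0] at e2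
  rw [e1, norm_mul]
  have hs2 : 0 < ((s.re / 2 : ℝ) : ℂ).re := by simpa using hs
  have e3 := norm_heatSymbol_le (k + 2) hs2 hx
  rw [norm_heatSymbol_of_pos _ _ h0, ← hy, Complex.ofReal_re] at e3
  rw [norm_heatSymbol_of_pos _ _ h0, ← hy]
  -- The Taylor remainder costs `y² ≤ x⁻²` and a factor `e^{‖h‖ y}`. As `‖h‖ ≤ Re s / 2`, half of
  -- the decay survives, and `heatBound (k + 2)` at `Re s / 2` absorbs the `k + 2` powers of `x⁻¹`.
  calc x⁻¹ ^ k * Real.exp (-s.re * y) * ‖Complex.exp (-h * y) - 1 + h * y‖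
      ≤ x⁻¹ ^ k * Real.exp (-s.re * y) * ((‖h‖ * y) ^ 2 * Real.exp (‖h‖ * y)) := by
        have : 0 < x⁻¹ := inv_pos.2 h0
        gcongr
    _ = x⁻¹ ^ k * y ^ 2 * Real.exp (-s.re * y + ‖h‖ * y) * ‖h‖ ^ 2 := by
        rw [Real.exp_add]; ring
    _ ≤ x⁻¹ ^ k * x⁻¹ ^ 2 * Real.exp (-(s.re / 2) * y) * ‖h‖ ^ 2 := by
        have : 0 < x⁻¹ := inv_pos.2 h0
        gcongr
        nlinarith
    _ ≤ _ := by
        rw [← pow_add]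
        gcongr

variable {H : Type*} [NormedAddCommGroup H] [InnerProductSpace ℂ H] [CompleteSpace H]

/-- A self-adjoint operator with spectrum in the unit interval. -/
structure IsUnitOperator (C : H →L[ℂ] H) : Prop where
  isSelfAdjoint : IsSelfAdjoint C
  spectrum_subset : ∀ z ∈ spectrum ℂ C, z.re ∈ Icc (0 : ℝ) 1 ∧ z = z.re

/-- Functional calculus with functions of a real variable. -/
def fc (C : H →L[ℂ] H) (g : ℝ → ℂ) : H →L[ℂ] H := cfc (fun z : ℂ => g z.re) C

variable {C : H →L[ℂ] H}

namespace IsUnitOperator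

theorem continuousOn (hC : IsUnitOperator C) {g : ℝ → ℂ} (hg : ContinuousOn g (Icc 0 1)) :
    ContinuousOn (fun z : ℂ => g z.re) (spectrum ℂ C) :=
  hg.comp Complex.continuous_re.continuousOn fun z hz => (hC.spectrum_subset z hz).1

theorem norm_fc_le (hC : IsUnitOperator C) {g : ℝ → ℂ} {c : ℝ} (hc : 0 ≤ c)
    (h : ∀ x ∈ Icc (0 : ℝ) 1, ‖g x‖ ≤ c) : ‖fc C g‖ ≤ c :=
  norm_cfc_le hc fun z hz => h z.re (hC.spectrum_subset z hz).1

theorem fc_congr (hC : IsUnitOperator C) {f g : ℝ → ℂ} (h : EqOn f g (Icc 0 1)) :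
    fc C f = fc C g :=
  cfc_congr fun z hz => h (hC.spectrum_subset z hz).1

theorem fc_mul (hC : IsUnitOperator C) {f g : ℝ → ℂ} (hf : ContinuousOn f (Icc 0 1))
    (hg : ContinuousOn g (Icc 0 1)) : fc C (fun x => f x * g x) = fc C f * fc C g :=
  cfc_mul _ _ C (hC.continuousOn hf) (hC.continuousOn hg)

theorem fc_add (hC : IsUnitOperator C) {f g : ℝ → ℂ} (hf : ContinuousOn f (Icc 0 1))
    (hg : ContinuousOn g (Icc 0 1)) : fc C (fun x => f x + g x) = fc C f + fc C g :=
  cfc_add C _ _ (hC.continuousOn hf) (hC.continuousOn hg)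

theorem fc_sub (hC : IsUnitOperator C) {f g : ℝ → ℂ} (hf : ContinuousOn f (Icc 0 1))
    (hg : ContinuousOn g (Icc 0 1)) : fc C (fun x => f x - g x) = fc C f - fc C g :=
  cfc_sub _ _ C (hC.continuousOn hf) (hC.continuousOn hg)

theorem fc_const_mul (hC : IsUnitOperator C) (c : ℂ) {f : ℝ → ℂ}
    (hf : ContinuousOn f (Icc 0 1)) : fc C (fun x => c * f x) = c • fc C f :=
  cfc_const_mul c _ C (hC.continuousOn hf)

theorem fc_id (hC : IsUnitOperator C) : fc C (fun x => (x : ℂ)) = C := by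
  have : IsStarNormal C := hC.isSelfAdjoint.isStarNormal
  conv_rhs => rw [← cfc_id ℂ C]
  exact cfc_congr fun z hz => (hC.spectrum_subset z hz).2.symm

/-- The operator `(A + 1)ᵏ e^{-sA}` for `C = (A + 1)⁻¹`. -/
def _root_.RiemannianCone.heat (C : H →L[ℂ] H) (k : ℕ) (s : ℂ) : H →L[ℂ] H :=
  fc C (heatSymbol k s)

theorem norm_heat_zero_le (hC : IsUnitOperator C) {s : ℂ} (hs : 0 ≤ s.re) : ‖heat C 0 s‖ ≤ 1 :=
  hC.norm_fc_le zero_le_one fun _ hx => norm_heatSymbol_zero_le hs hx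

theorem norm_heat_one_le (hC : IsUnitOperator C) {s : ℂ} (hs : 0 < s.re) :
    ‖heat C 1 s‖ ≤ 1 + s.re⁻¹ :=
  hC.norm_fc_le (by positivity) fun _ hx => norm_heatSymbol_one_le hs hx

theorem mul_heat_succ (hC : IsUnitOperator C) (k : ℕ) {s : ℂ} (hs : 0 < s.re) :
    C * heat C (k + 1) s = heat C k s := by
  conv_lhs => enter [1]; rw [← hC.fc_id]
  rw [heat, ← hC.fc_mul Complex.continuous_ofReal.continuousOn (continuousOn_heatSymbol _ hs)]
  exact hC.fc_congr fun x hx => heatSymbol_pred hx.1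

theorem heat_succ_mul (hC : IsUnitOperator C) (k : ℕ) {s : ℂ} (hs : 0 < s.re) :
    heat C (k + 1) s * C = heat C k s := by
  conv_lhs => enter [2]; rw [← hC.fc_id]
  rw [heat, ← hC.fc_mul (continuousOn_heatSymbol _ hs) Complex.continuous_ofReal.continuousOn]
  exact hC.fc_congr fun x hx => (mul_comm _ _).trans (heatSymbol_pred hx.1)

theorem heat_mul_heat (hC : IsUnitOperator C) {s t : ℂ} (hs : 0 < s.re) (ht : 0 < t.re) :
    heat C 0 s * heat C 0 t = heat C 0 (s + t) := by
  rw [heat, heat, ← hC.fc_mul (continuousOn_heatSymbol _ hs) (continuousOn_heatSymbol _ ht)]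
  exact hC.fc_congr fun x _ => heatSymbol_mul s t x

theorem adjoint_heat (k : ℕ) (s : ℂ) :
    ContinuousLinearMap.adjoint (heat C k s) = heat C k (star s) := by
  rw [← ContinuousLinearMap.star_eq_adjoint, heat, fc, ← cfc_star]
  simp only [heatSymbol_conj]
  rfl

/-- The derivative is `-A (A + 1)ᵏ e^{-sA}`, with `A` written as `(A + 1) - 1`. The second-order
Taylor estimate of the symbol is uniform on the spectrum, so differentiability holds in operator
norm and in complex `s`. -/
theorem hasDerivAt_heat (hC : IsUnitOperator C) (k : ℕ) {s : ℂ} (hs : 0 < s.re) :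
    HasDerivAt (heat C k) (-(heat C (k + 1) s - heat C k s)) s := by
  rw [hasDerivAt_iff_isLittleO_nhds_zero]
  refine Asymptotics.IsBigO.trans_isLittleO (g := fun h : ℂ => ‖h‖ ^ 2) ?_ ?_
  · refine Asymptotics.IsBigO.of_bound (heatBound (k + 2) (s.re / 2)) ?_
    have hball : ∀ᶠ h : ℂ in 𝓝 0, ‖h‖ < s.re / 2 :=
      (continuous_norm.tendsto' (0 : ℂ) 0 norm_zero).eventually (gt_mem_nhds (by positivity))
    filter_upwards [hball] with h hh
    have hsh : 0 < (s + h).re := by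
      have := (abs_le.1 (Complex.abs_re_le_norm h)).1
      rw [Complex.add_re]; linarith
    have c0 := continuousOn_heatSymbol k hs
    have c1 := continuousOn_heatSymbol (k + 1) hs
    have c2 := continuousOn_heatSymbol k hsh
    have e : heat C k (s + h) - heat C k s - h • -(heat C (k + 1) s - heat C k s)
        = fc C (fun x => heatSymbol k (s + h) x - heatSymbol k s x
          + h * (heatSymbol (k + 1) s x - heatSymbol k s x)) := by
      rw [hC.fc_add (f := fun x => heatSymbol k (s + h) x - heatSymbol k s x) (c2.sub c0)
        (g := fun x => h * (heatSymbol (k + 1) s x - heatSymbol k s x))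
        (continuousOn_const.mul (c1.sub c0)), hC.fc_sub c2 c0,
        hC.fc_const_mul h (f := fun x => heatSymbol (k + 1) s x - heatSymbol k s x) (c1.sub c0),
        hC.fc_sub c1 c0, smul_neg, sub_neg_eq_add]
      rfl
    rw [e, Real.norm_of_nonneg (by positivity : 0 ≤ ‖h‖ ^ 2)]
    refine hC.norm_fc_le (mul_nonneg (heatBound_nonneg _ (by positivity)) (by positivity)) ?_
    intro x hx
    exact norm_heatSymbol_taylor k hs hh.le hx
  · exact Asymptotics.isLittleO_norm_pow_id one_lt_two

theorem continuousAt_heat (hC : IsUnitOperator C) (k : ℕ) {s : ℂ} (hs : 0 < s.re) :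
    ContinuousAt (heat C k) s :=
  (hC.hasDerivAt_heat k hs).continuousAt

end IsUnitOperator

/-! ### The resolvent in terms of the semigroup -/

section

variable {V : Type*} [NormedAddCommGroup V] [InnerProductSpace ℂ V] [CompleteSpace V]

open scoped ComplexOrder in
/-- The operator `j j*` of a contraction `j`. -/
theorem isUnitOperator_comp_adjoint {j : V →L[ℂ] H} (hj : ‖j‖ ≤ 1) :
    IsUnitOperator (j ∘L ContinuousLinearMap.adjoint j) := by
  set C := j ∘L ContinuousLinearMap.adjoint j
  have hp : C.IsPositive := ContinuousLinearMap.isPositive_self_comp_adjoint j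
  have hsa : IsSelfAdjoint C := hp.isSelfAdjoint
  have hn : ‖C‖ ≤ 1 := by
    refine (ContinuousLinearMap.opNorm_comp_le _ _).trans ?_
    rw [LinearIsometryEquiv.norm_map]
    nlinarith [norm_nonneg j]
  refine ⟨hsa, fun z hz => ?_⟩
  have hre : z = z.re := hsa.mem_spectrum_eq_re hz
  have h0 : 0 ≤ z := spectrum_nonneg_of_nonneg ((ContinuousLinearMap.nonneg_iff_isPositive C).2 hp) hz
  have h1 : ‖z‖ ≤ 1 := (spectrum.norm_le_norm_mul_of_mem hz).trans <| by
    have : ‖(1 : H →L[ℂ] H)‖ ≤ 1 := ContinuousLinearMap.norm_id_le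
    nlinarith [norm_nonneg C]
  exact ⟨⟨(Complex.le_def.1 h0).1, (Complex.re_le_norm z).trans h1⟩, hre⟩

/-- Strong continuity of the semigroup at time zero, on the form domain. -/
theorem norm_sub_heat_comp_sq_le {j : V →L[ℂ] H} (hj : ‖j‖ ≤ 1) {t : ℝ} (ht : 0 < t) (v : V) :
    ‖j v - heat (j ∘L ContinuousLinearMap.adjoint j) 0 t (j v)‖ ^ 2 ≤ t * ‖v‖ ^ 2 := by
  set C := j ∘L ContinuousLinearMap.adjoint j with hCdef
  have hC : IsUnitOperator C := isUnitOperator_comp_adjoint hj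
  have hts : 0 < (t : ℂ).re := by simpa using ht
  set P := heat C 0 t with hP
  have hPa : ContinuousLinearMap.adjoint P = P := by
    rw [hP, IsUnitOperator.adjoint_heat]; simp
  set D := j - P ∘L j with hD
  have hDa : ContinuousLinearMap.adjoint D
      = ContinuousLinearMap.adjoint j - ContinuousLinearMap.adjoint j ∘L P := by
    rw [hD, map_sub, ContinuousLinearMap.adjoint_comp, hPa]
  have ce := continuousOn_heatSymbol 0 hts
  have ci : ContinuousOn (fun x : ℝ => (x : ℂ)) (Icc 0 1) := Complex.continuous_ofReal.continuousOn
  have c1 : ContinuousOn (fun x : ℝ => (x : ℂ) - heatSymbol 0 t x * x) (Icc 0 1) :=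
    ci.sub (ce.mul ci)
  -- `D = (1 - P) j`, so `D D* = (1 - P) C (1 - P)` is again a function of `C`, and by the
  -- C*-identity its norm is `‖D‖²`.
  have hDD : D ∘L ContinuousLinearMap.adjoint D
      = fc C (fun x => ((x : ℂ) - heatSymbol 0 t x * x)
        - ((x : ℂ) - heatSymbol 0 t x * x) * heatSymbol 0 t x) := by
    rw [hC.fc_sub c1 (g := fun x => ((x : ℂ) - heatSymbol 0 t x * x) * heatSymbol 0 t x)
      (c1.mul ce), hC.fc_mul c1 ce, hC.fc_sub ci (g := fun x => heatSymbol 0 t x * x) (ce.mul ci),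
      hC.fc_mul ce ci, hC.fc_id]
    change _ = C - P * C - (C - P * C) * P
    ext v
    simp [hD, hPa, hCdef]
  have hn : ‖D‖ * ‖D‖ ≤ t := by
    have h1 := ContinuousLinearMap.norm_adjoint_comp_self (ContinuousLinearMap.adjoint D)
    rw [ContinuousLinearMap.adjoint_adjoint, LinearIsometryEquiv.norm_map] at h1
    rw [← h1, hDD]
    refine hC.norm_fc_le ht.le fun x hx => ?_
    rcases hx.1.eq_or_lt with rfl | h0
    · simpa [heatSymbol] using ht.le
    have h1x : 1 ≤ x⁻¹ := (one_le_inv₀ h0).2 hx.2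
    set e : ℝ := Real.exp (-t * (x⁻¹ - 1)) with he
    have hsym : heatSymbol 0 t x = (e : ℂ) := by
      rw [heatSymbol_of_pos _ _ h0, he]; push_cast; simp
    have he0 : 0 ≤ e := (Real.exp_pos _).le
    have he1 : e ≤ 1 := by rw [he, Real.exp_le_one_iff]; nlinarith
    have he2 : 1 - e ≤ t * (x⁻¹ - 1) := by
      have := Real.add_one_le_exp (-t * (x⁻¹ - 1)); linarith
    rw [hsym, show ((x : ℂ) - e * x) - ((x : ℂ) - e * x) * e = ((x * (1 - e) ^ 2 : ℝ) : ℂ) by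
      push_cast; ring, Complex.norm_real, Real.norm_of_nonneg (by positivity)]
    -- From `0 ≤ 1 - e ≤ 1`, one of the two factors can be dropped.
    have h3 : (1 - e) ^ 2 ≤ t * (x⁻¹ - 1) := by nlinarith
    calc x * (1 - e) ^ 2 ≤ x * (t * (x⁻¹ - 1)) := by gcongr
      _ = t * (1 - x) := by field_simp
      _ ≤ t := by nlinarith
  have h2 : j v - P (j v) = D v := by simp [hD]
  rw [h2]
  calc ‖D v‖ ^ 2 ≤ (‖D‖ * ‖v‖) ^ 2 := by gcongr; exact D.le_opNorm v
    _ = (‖D‖ * ‖D‖) * ‖v‖ ^ 2 := by ring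
    _ ≤ t * ‖v‖ ^ 2 := by gcongr

end

/-- `C - 1/(w+1)` is invertible, up to scaling, for `w` off the half-line `[0, ∞)`. -/
theorem IsUnitOperator.isUnit_sub_one (hC : IsUnitOperator C) {w : ℂ}
    (hw : ∀ y : ℝ, 0 ≤ y → w ≠ y) : IsUnit ((w + 1) • C - 1) := by
  -- The value `w = -1` has no counterpart in the spectral parameter of `C`. Otherwise a spectral
  -- value `x = (w + 1)⁻¹` in `[0, 1]` would give `w = x⁻¹ - 1 ≥ 0`.
  by_cases h1 : w + 1 = 0
  · rw [h1, zero_smul, zero_sub]; exact isUnit_one.neg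
  have hs : (w + 1)⁻¹ ∉ spectrum ℂ C := by
    intro hmem
    obtain ⟨⟨h0, h1'⟩, he⟩ := hC.spectrum_subset _ hmem
    set x := ((w + 1)⁻¹).re with hx
    have hx0 : x ≠ 0 := by
      intro h; rw [h, Complex.ofReal_zero, inv_eq_zero] at he; exact h1 he
    have hpos : 0 < x := lt_of_le_of_ne h0 (Ne.symm hx0)
    refine hw (x⁻¹ - 1) (sub_nonneg.2 ((one_le_inv₀ hpos).2 h1')) ?_
    have : w + 1 = (x : ℂ)⁻¹ := by rw [← he, inv_inv]
    push_cast
    rw [← this]; ring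
  rw [spectrum.notMem_iff] at hs
  have e : (w + 1) • C - 1
      = algebraMap ℂ (H →L[ℂ] H) (-(w + 1)) * (algebraMap ℂ (H →L[ℂ] H) (w + 1)⁻¹ - C) := by
    rw [mul_sub, ← map_mul, neg_mul, mul_inv_cancel₀ h1, map_neg, map_neg, map_one, neg_mul,
      ← Algebra.smul_def]
    abel
  rw [e]
  refine IsUnit.mul ?_ hs
  exact (IsUnit.mk0 _ (neg_ne_zero.2 h1)).map (algebraMap ℂ (H →L[ℂ] H))

/-- The integrand has the bounded antiderivative `-δ⁻¹ exp (-δ eˣ)`. It is the majorant of all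
Laplace integrals after the substitution `t = sinh x`. -/
theorem integrableOn_exp_mul_exp_neg_exp {δ : ℝ} (hδ : 0 < δ) (a : ℝ) :
    IntegrableOn (fun x : ℝ => Real.exp x * Real.exp (-δ * Real.exp x)) (Ioi a) := by
  have hd : ∀ x : ℝ, HasDerivAt (fun x : ℝ => -δ⁻¹ * Real.exp (-δ * Real.exp x))
      (Real.exp x * Real.exp (-δ * Real.exp x)) x := by
    intro x
    have h := (((Real.hasDerivAt_exp x).const_mul (-δ)).exp).const_mul (-δ⁻¹)
    refine h.congr_deriv ?_
    have := hδ.ne'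
    field_simp
  refine integrableOn_Ioi_deriv_of_nonneg' (fun x _ => hd x) (fun x _ => by positivity)
    (l := -δ⁻¹ * 0) ?_
  refine Tendsto.const_mul _ (Real.tendsto_exp_atBot.comp ?_)
  exact Real.tendsto_exp_atTop.const_mul_atTop_of_neg (neg_lt_zero.2 hδ)

theorem norm_cosh_le {s : ℂ} (hs : 0 ≤ s.re) : ‖Complex.cosh s‖ ≤ Real.exp s.re := by
  rw [Complex.cosh, norm_div, Complex.norm_two]
  have h := norm_add_le (Complex.exp s) (Complex.exp (-s))
  rw [Complex.norm_exp, Complex.norm_exp, Complex.neg_re] at h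
  have : Real.exp (-s.re) ≤ Real.exp s.re := Real.exp_le_exp.2 (by linarith)
  linarith

/-- Double exponential decay of `exp (w sinh s)` in the directions `Im s = φ` with
`Re (w e^{iφ}) < 0`. -/
theorem re_mul_sinh_le (w : ℂ) {s : ℂ} (hs : 0 ≤ s.re) :
    (w * Complex.sinh s).re
      ≤ (w * Complex.exp (s.im * Complex.I)).re / 2 * Real.exp s.re + ‖w‖ / 2 := by
  have e1 : Complex.exp s = Real.exp s.re * Complex.exp (s.im * Complex.I) := by
    rw [Complex.ofReal_exp, ← Complex.exp_add, Complex.re_add_im]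
  have e2 : w * Complex.sinh s = (Real.exp s.re / 2 : ℝ) * (w * Complex.exp (s.im * Complex.I))
      + -(w * Complex.exp (-s)) / 2 := by
    rw [Complex.sinh, e1]; push_cast; ring
  rw [e2, Complex.add_re, Complex.re_ofReal_mul]
  have h3 : (-(w * Complex.exp (-s)) / 2).re ≤ ‖w‖ / 2 := by
    refine (Complex.re_le_norm _).trans ?_
    rw [norm_div, norm_neg, norm_mul, Complex.norm_two, Complex.norm_exp, Complex.neg_re]
    have : Real.exp (-s.re) ≤ 1 := Real.exp_le_one_iff.2 (by linarith)
    have := mul_le_of_le_one_right (norm_nonneg w) this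
    linarith
  linarith

/-- For large `Re s`, `sinh s` is close to `eˢ / 2`, so decay is decided by the sign of `Re (w e^{i
Im s})` alone. The remainder `e^{-s} / 2` costs only the constant `exp (‖w‖ / 2)`. -/
theorem norm_exp_mul_sinh_mul_cosh_le (w : ℂ) {s : ℂ} (hs : 0 ≤ s.re) {δ : ℝ}
    (hδ : (w * Complex.exp (s.im * Complex.I)).re ≤ -δ) :
    ‖Complex.exp (w * Complex.sinh s) * Complex.cosh s‖
      ≤ Real.exp (‖w‖ / 2) * (Real.exp s.re * Real.exp (-(δ / 2) * Real.exp s.re)) := by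
  rw [norm_mul, Complex.norm_exp]
  have h1 := re_mul_sinh_le w hs
  have h2 : (w * Complex.sinh s).re ≤ ‖w‖ / 2 + -(δ / 2) * Real.exp s.re := by
    have := mul_le_mul_of_nonneg_right hδ (Real.exp_pos s.re).le
    linarith
  calc _ ≤ Real.exp (‖w‖ / 2 + -(δ / 2) * Real.exp s.re) * Real.exp s.re := by
        gcongr
        exact norm_cosh_le hs
    _ = _ := by rw [Real.exp_add]; ring

theorem IsUnitOperator.integrableOn_exp_mul_cosh_smul_heat (hC : IsUnitOperator C) {w : ℂ}
    (hw : w.re < 0) :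
    IntegrableOn (fun x : ℝ => (Complex.exp (w * Complex.sinh x) * Complex.cosh x) •
      heat C 0 (Complex.sinh x)) (Ioi 0) := by
  have hsinh : ∀ {x : ℝ}, 0 < x → 0 < (Complex.sinh x).re := fun {x} hx => by
    rw [Complex.sinh_ofReal_re]; exact Real.sinh_pos_iff.2 hx
  set F : ℝ → H →L[ℂ] H := fun x => (Complex.exp (w * Complex.sinh x) * Complex.cosh x) •
      heat C 0 (Complex.sinh x) with hF
  have hsd : ∀ x : ℝ, HasDerivAt (fun x : ℝ => Complex.sinh x) (Complex.cosh x) x := fun x =>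
    (Complex.hasDerivAt_sinh x).comp_ofReal
  have hmeas : ContinuousOn F (Ioi 0) := by
    intro x hx
    refine ContinuousAt.continuousWithinAt ?_
    have h1 : ContinuousAt (fun x : ℝ => heat C 0 (Complex.sinh x)) x :=
      (hC.continuousAt_heat 0 (hsinh hx)).comp_of_eq (hsd x).continuousAt rfl
    have hce : Continuous fun x : ℝ => Complex.exp (w * Complex.sinh x) * Complex.cosh x := by
      fun_prop
    exact hce.continuousAt.smul h1
  have hbound : ∀ x ∈ Ioi (0 : ℝ), ‖F x‖
      ≤ Real.exp (‖w‖ / 2) * (Real.exp x * Real.exp (-(-w.re / 2) * Real.exp x)) := by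
    intro x hx
    rw [hF]; dsimp only
    rw [norm_smul]
    have h1 := hC.norm_heat_zero_le (hsinh hx).le
    have h2 := norm_exp_mul_sinh_mul_cosh_le w (s := x) (by simpa using (mem_Ioi.1 hx).le)
      (δ := -w.re) (by simp)
    rw [Complex.ofReal_re] at h2
    exact (mul_le_of_le_one_right (norm_nonneg _) h1).trans h2
  refine Integrable.mono' ((integrableOn_exp_mul_exp_neg_exp (δ := -w.re / 2) (by linarith)
      0).const_mul (Real.exp (‖w‖ / 2))) (hmeas.aestronglyMeasurable measurableSet_Ioi) ?_
  exact (ae_restrict_iff' measurableSet_Ioi).2 (Eventually.of_forall hbound)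

/-- The resolvent `(w - A)⁻¹` as the Laplace transform of the semigroup `e^{-tA}`, in the variable
`x` with `t = sinh x`. -/
theorem IsUnitOperator.integral_heat_mul (hC : IsUnitOperator C) {w : ℂ} (hw : w.re < 0) :
    (∫ x in Ioi (0 : ℝ), (Complex.exp (w * Complex.sinh x) * Complex.cosh x) •
      heat C 0 (Complex.sinh x)) * ((w + 1) • C - 1) = -C := by
  have hsinh : ∀ {x : ℝ}, 0 < x → 0 < (Complex.sinh x).re := fun {x} hx => by
    rw [Complex.sinh_ofReal_re]; exact Real.sinh_pos_iff.2 hx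
  -- `g x = e^{-tA} C` with `t = sinh x`. The semigroup need not be norm continuous at `t = 0`, but
  -- with the factor `C` it is. Since `(w - A) C = (w + 1) C - 1`, the function `f = e^{wt} e^{-tA}
  -- C` has exactly the required integrand as derivative, and the integral is `-f 0 = -C`.
  set g : ℝ → H →L[ℂ] H := fun x => fc C fun y => heatSymbol 0 (Complex.sinh x) y * y with hg
  set f : ℝ → H →L[ℂ] H := fun x => Complex.exp (w * Complex.sinh x) • g x with hf
  have ci : ContinuousOn (fun x : ℝ => (x : ℂ)) (Icc 0 1) := Complex.continuous_ofReal.continuousOn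
  have hgpos : ∀ {x : ℝ}, 0 < x → g x = heat C 0 (Complex.sinh x) * C := fun {x} hx => by
    rw [hg]; dsimp only
    rw [hC.fc_mul (continuousOn_heatSymbol 0 (hsinh hx)) ci, hC.fc_id]; rfl
  have hg0 : g 0 = C := by
    conv_rhs => rw [← hC.fc_id]
    refine hC.fc_congr fun y hy => ?_
    rcases hy.1.eq_or_lt with rfl | h0
    · simp
    · simp [heatSymbol_of_pos _ _ h0]
  have hgc : Tendsto g (𝓝[≥] 0) (𝓝 C) := by
    rw [tendsto_iff_norm_sub_tendsto_zero]
    refine squeeze_zero' (g := Real.sinh) (Eventually.of_forall fun _ => norm_nonneg _) ?_ ?_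
    · filter_upwards [self_mem_nhdsWithin] with x hx
      rcases (mem_Ici.1 hx).eq_or_lt with rfl | h0
      · simp [hg0]
      have hsx : 0 < Real.sinh x := Real.sinh_pos_iff.2 h0
      have ce := continuousOn_heatSymbol 0 (hsinh h0)
      conv_lhs => enter [1, 2]; rw [← hC.fc_id]
      rw [← hC.fc_sub (f := fun y => heatSymbol 0 (Complex.sinh x) y * y) (ce.mul ci) ci]
      refine hC.norm_fc_le hsx.le fun y hy => ?_
      rcases hy.1.eq_or_lt with rfl | h0
      · simpa using hsx.le
      set e : ℝ := Real.exp (-Real.sinh x * (y⁻¹ - 1)) with he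
      have hsym : heatSymbol 0 (Complex.sinh x) y = (e : ℂ) := by
        rw [heatSymbol_of_pos _ _ h0, he]; push_cast; simp
      have h1y : 1 ≤ y⁻¹ := (one_le_inv₀ h0).2 hy.2
      have he1 : e ≤ 1 := by rw [he, Real.exp_le_one_iff]; nlinarith
      have he2 : 1 - e ≤ Real.sinh x * (y⁻¹ - 1) := by
        have := Real.add_one_le_exp (-Real.sinh x * (y⁻¹ - 1)); linarith
      rw [hsym, show (e : ℂ) * y - y = ((-(y * (1 - e)) : ℝ) : ℂ) by push_cast; ring,
        Complex.norm_real, norm_neg, Real.norm_of_nonneg (mul_nonneg h0.le (by linarith))]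
      calc y * (1 - e) ≤ y * (Real.sinh x * (y⁻¹ - 1)) := by gcongr
        _ = Real.sinh x * (1 - y) := by field_simp
        _ ≤ Real.sinh x := by nlinarith
    · exact (Real.continuous_sinh.tendsto' 0 0 Real.sinh_zero).mono_left nhdsWithin_le_nhds
  have hfc : ContinuousWithinAt f (Ici 0) 0 := by
    have hce : Continuous fun x : ℝ => Complex.exp (w * Complex.sinh x) := by fun_prop
    refine hce.continuousWithinAt.smul ?_
    rw [ContinuousWithinAt, hg0]; exact hgc
  set F : ℝ → H →L[ℂ] H := fun x => (Complex.exp (w * Complex.sinh x) * Complex.cosh x) •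
      heat C 0 (Complex.sinh x) with hF
  have hsd : ∀ x : ℝ, HasDerivAt (fun x : ℝ => Complex.sinh x) (Complex.cosh x) x := fun x =>
    (Complex.hasDerivAt_sinh x).comp_ofReal
  have hFd : ∀ x ∈ Ioi (0 : ℝ), HasDerivAt f (F x * ((w + 1) • C - 1)) x := by
    intro x hx
    have hx0 := hsinh hx
    have h1 : HasDerivAt (fun x : ℝ => heat C 0 (Complex.sinh x))
        (Complex.cosh x • -(heat C 1 (Complex.sinh x) - heat C 0 (Complex.sinh x))) x :=
      HasDerivAt.scomp x (hC.hasDerivAt_heat 0 hx0) (hsd x)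
    have h2 := ((hsd x).const_mul w).cexp.smul (h1.mul_const C)
    have h3 : f =ᶠ[𝓝 x] fun x : ℝ => Complex.exp (w * Complex.sinh x) •
        (heat C 0 (Complex.sinh x) * C) := by
      filter_upwards [lt_mem_nhds hx] with y hy
      rw [hf]; dsimp only; rw [hgpos hy]
    refine (h2.congr_of_eventuallyEq h3).congr_deriv ?_
    rw [hF]; dsimp only
    rw [smul_mul_assoc, smul_mul_assoc, neg_mul, sub_mul, hC.heat_succ_mul 0 hx0, mul_sub, mul_one,
      mul_smul_comm]
    module
  have hFi : IntegrableOn F (Ioi 0) := hC.integrableOn_exp_mul_cosh_smul_heat hw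
  have hlim : Tendsto f atTop (𝓝 0) := by
    have hb : ∀ᶠ x : ℝ in atTop, ‖f x‖ ≤ Real.exp (w.re * Real.sinh x) * ‖C‖ := by
      filter_upwards [eventually_gt_atTop 0] with x hx
      rw [hf]; dsimp only
      rw [hgpos hx, norm_smul, Complex.norm_exp, ← Complex.ofReal_sinh, Complex.re_mul_ofReal]
      have := norm_mul_le (heat C 0 (Complex.sinh x)) C
      have h1 := hC.norm_heat_zero_le (hsinh hx).le
      rw [Complex.ofReal_sinh]
      gcongr
      exact this.trans (mul_le_of_le_one_left (norm_nonneg _) h1)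
    refine squeeze_zero_norm' hb ?_
    rw [← zero_mul ‖C‖]
    refine (Real.tendsto_exp_atBot.comp ?_).mul_const _
    refine Tendsto.const_mul_atTop_of_neg hw ?_
    refine tendsto_atTop_mono' atTop ?_ tendsto_id
    filter_upwards [eventually_ge_atTop 0] with x hx using Real.self_le_sinh_iff.2 hx
  have hint : IntegrableOn (fun x => F x * ((w + 1) • C - 1)) (Ioi 0) :=
    ((ContinuousLinearMap.mul ℂ (H →L[ℂ] H)).flip ((w + 1) • C - 1)).integrable_comp hFi
  have hmain := integral_Ioi_of_hasDerivAt_of_tendsto hfc hFd hint hlim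
  have hpull := ((ContinuousLinearMap.mul ℂ (H →L[ℂ] H)).flip
    ((w + 1) • C - 1)).integral_comp_comm hFi
  simp only [ContinuousLinearMap.flip_apply, ContinuousLinearMap.mul_apply'] at hpull
  rw [← hpull, hmain, hf]
  simp [hg0]

end Semigroup
end RiemannianCone

namespace RiemannianCone

open MeasureTheory Set Filter

/-! ### Uniqueness of weak solutions and intertwining of heat semigroups -/

section Intertwining
set_option linter.unusedSectionVars false

local notation "⟪" x ", " y "⟫" => inner ℂ x y

variable {H V₁ V₂ : Type*}
  [NormedAddCommGroup H] [InnerProductSpace ℂ H] [CompleteSpace H]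
  [NormedAddCommGroup V₁] [InnerProductSpace ℂ V₁] [CompleteSpace V₁]
  [NormedAddCommGroup V₂] [InnerProductSpace ℂ V₂] [CompleteSpace V₂]

/-- The operator `(A + 1)⁻¹`, for the operator `A` of the form with domain `j : V → H`, where the
inner product of `V` is the form plus that of `H`. -/
abbrev formResolvent {V : Type*} [NormedAddCommGroup V] [InnerProductSpace ℂ V] [CompleteSpace V]
    (j : V →L[ℂ] H) : H →L[ℂ] H :=
  j ∘L ContinuousLinearMap.adjoint j

/-- A weak solution of `z' = -A z`: the curve `z = j x` solves the equation tested against `v`. -/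
def IsWeakSolutionAt (j : V₂ →L[ℂ] H) (x : ℝ → V₂) (v : V₂) : Prop :=
  ∀ s > 0, HasDerivAt (fun s => ⟪j (x s), j v⟫) (-(⟪x s, v⟫ - ⟪j (x s), j v⟫)) s

/-- A weak solution tested against a dense set is one tested against the whole form domain. -/
theorem IsWeakSolutionAt.of_dense {j : V₂ →L[ℂ] H} (hj : ‖j‖ ≤ 1) {x : ℝ → V₂} {M : ℝ → ℝ}
    (hM : ContinuousOn M (Ioi 0)) (hxM : ∀ s > 0, ‖x s‖ ≤ M s) {E : Type*} {e : E → V₂}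
    (he : DenseRange e) (h : ∀ ψ, IsWeakSolutionAt j x (e ψ)) (v : V₂) :
    IsWeakSolutionAt j x v := by
  intro s hs
  obtain ⟨w, hw, hwv⟩ := mem_closure_iff_seq_limit.1 (he v)
  choose ψ hψ using hw
  have hjn : ∀ y : V₂, ‖j y‖ ≤ ‖y‖ := fun y =>
    (j.le_opNorm y).trans (mul_le_of_le_one_left (norm_nonneg y) hj)
  -- Derivatives pass to the limit when they converge locally uniformly in time; the continuous
  -- majorant `M` of the form norm of `x s` provides this.
  refine hasDerivAt_of_tendstoLocallyUniformlyOn (l := atTop) (s := Ioi (0 : ℝ))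
    (f := fun n s => ⟪j (x s), j (w n)⟫) (f' := fun n s => -(⟪x s, w n⟫ - ⟪j (x s), j (w n)⟫))
    (g' := fun s => -(⟪x s, v⟫ - ⟪j (x s), j v⟫))
    isOpen_Ioi ?_ ?_ ?_ hs
  · rw [Metric.tendstoLocallyUniformlyOn_iff]
    intro ε hε s₀ hs₀
    have hMpos : 0 ≤ M s₀ := (norm_nonneg _).trans (hxM s₀ hs₀)
    have hnhd : {s | M s < M s₀ + 1} ∩ Ioi 0 ∈ 𝓝[Ioi 0] s₀ :=
      inter_mem ((hM s₀ hs₀).eventually (gt_mem_nhds (lt_add_one _))) self_mem_nhdsWithin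
    refine ⟨_, hnhd, ?_⟩
    have hlim : Tendsto (fun n => 2 * (M s₀ + 1) * ‖v - w n‖) atTop (𝓝 0) := by
      have h1 : Tendsto (fun n => ‖v - w n‖) atTop (𝓝 0) := by
        have := (tendsto_const_nhds (x := v)).sub hwv
        rw [sub_self] at this
        simpa using this.norm
      simpa using h1.const_mul (2 * (M s₀ + 1))
    filter_upwards [hlim.eventually (gt_mem_nhds hε)] with n hn s hs
    refine lt_of_le_of_lt ?_ hn
    rw [dist_eq_norm]
    have e1 : -(⟪x s, v⟫ - ⟪j (x s), j v⟫) - -(⟪x s, w n⟫ - ⟪j (x s), j (w n)⟫)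
        = -⟪x s, v - w n⟫ + ⟪j (x s), j (v - w n)⟫ := by
      rw [map_sub, inner_sub_right, inner_sub_right]; ring
    have hxs : ‖x s‖ ≤ M s₀ + 1 := (hxM s hs.2).trans (le_of_lt hs.1)
    rw [e1]
    refine (norm_add_le _ _).trans ?_
    rw [norm_neg]
    have h1 := norm_inner_le_norm (𝕜 := ℂ) (x s) (v - w n)
    have h2 := norm_inner_le_norm (𝕜 := ℂ) (j (x s)) (j (v - w n))
    have h3 : ‖j (x s)‖ * ‖j (v - w n)‖ ≤ ‖x s‖ * ‖v - w n‖ := by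
      gcongr <;> exact hjn _
    have h4 : ‖x s‖ * ‖v - w n‖ ≤ (M s₀ + 1) * ‖v - w n‖ := by gcongr
    linarith
  · refine Eventually.of_forall fun n s hs => ?_
    rw [← hψ n]
    exact h (ψ n) s hs
  · intro s _
    exact ((continuous_const.inner j.continuous).tendsto v).comp hwv

/-- Uniqueness of weak solutions: a bounded weak solution of `z' = -A z` with initial value `f` is
`e^{-sA} f`. -/
theorem weakSolution_eq_heat {j : V₂ →L[ℂ] H} (hj : ‖j‖ ≤ 1) {x : ℝ → V₂}
    (h : ∀ v, IsWeakSolutionAt j x v) {f : H} {K : ℝ} (hK : ∀ s > 0, ‖j (x s)‖ ≤ K)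
    (h0 : ∀ v, Tendsto (fun s => ⟪j (x s), j v⟫) (𝓝[>] 0) (𝓝 ⟪f, j v⟫)) {S : ℝ} (hS : 0 < S) :
    j (x S) = heat (formResolvent j) 0 S f := by
  set C := formResolvent j with hCdef
  have hC : IsUnitOperator C := isUnitOperator_comp_adjoint hj
  have hjn : ∀ y : V₂, ‖j y‖ ≤ ‖y‖ := fun y =>
    (j.le_opNorm y).trans (mul_le_of_le_one_left (norm_nonneg y) hj)
  have hre : ∀ {s : ℝ}, s < S → 0 < ((S - s : ℝ) : ℂ).re := fun {s} hs => by
    rw [Complex.ofReal_re]; linarith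
  have hrange : ∀ (k : ℕ) {s : ℂ} (_ : 0 < s.re) (g : H),
      heat C k s g = j (ContinuousLinearMap.adjoint j (heat C (k + 1) s g)) := fun k s hs g => by
    rw [← hC.mul_heat_succ k hs]; rfl
  have key : ∀ v₀ : V₂, ⟪j (x S), j v₀⟫ = ⟪heat C 0 S f, j v₀⟫ := by
    intro v₀
    -- Duality with the backward flow `u s = e^{-(S - s) A} (j v₀)`: the pairing `k` is constant on
    -- `(0, S)`, and its limits at the two ends are the two sides of the claim.
    set u : ℝ → H := fun s => heat C 0 ((S - s : ℝ) : ℂ) (j v₀) with hu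
    set k : ℝ → ℂ := fun s => ⟪j (x s), u s⟫ with hk
    have hud : ∀ s < S, HasDerivAt u
        (heat C 1 ((S - s : ℝ) : ℂ) (j v₀) - heat C 0 ((S - s : ℝ) : ℂ) (j v₀)) s := by
      intro s hs
      have h1 : HasDerivAt (fun s : ℝ => ((S - s : ℝ) : ℂ)) (((-1 : ℝ)) : ℂ) s :=
        ((hasDerivAt_id s).const_sub S).ofReal_comp
      have h2 := HasDerivAt.scomp s (hC.hasDerivAt_heat 0 (hre hs)) h1
      have h3 := ((ContinuousLinearMap.apply ℂ H (j v₀)).restrictScalars ℝ).hasFDerivAt.comp_hasDerivAt s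
        (f := fun s : ℝ => (heat C 0 ((S - s : ℝ) : ℂ)))
        (h2)
      refine h3.congr_deriv ?_
      simp
    have hzc : ∀ (v : V₂) {s : ℝ}, 0 < s →
        Tendsto (fun s => ⟪j (x s), j v⟫) (𝓝 s) (𝓝 ⟪j (x s), j v⟫) := fun v s hs =>
      (h v s hs).continuousAt
    have hkd : ∀ s ∈ Ioo 0 S, HasDerivAt k 0 s := by
      intro s hs
      set v := ContinuousLinearMap.adjoint j (heat C 1 ((S - s : ℝ) : ℂ) (j v₀)) with hv
      have hjv : j v = u s := (hrange 0 (hre hs.2) (j v₀)).symm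
      set v' := ContinuousLinearMap.adjoint j (heat C 2 ((S - s : ℝ) : ℂ) (j v₀)) with hv'
      have hjv' : j v' = heat C 1 ((S - s : ℝ) : ℂ) (j v₀) := (hrange 1 (hre hs.2) (j v₀)).symm
      have hud' := hud s hs.2
      rw [← hjv', show heat C 0 ((S - s : ℝ) : ℂ) (j v₀) = j v from hjv.symm, ← map_sub] at hud'
      have hw := h v s hs.1
      -- `v` is of the form `j* g`, so its form-domain pairing becomes an `L²` pairing with `g = (A
      -- + 1) u s`. This makes the two derivatives cancel.
      have hin : ⟪x s, v⟫ = ⟪j (x s), j v'⟫ := by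
        rw [hv, ContinuousLinearMap.adjoint_inner_right, hjv']
      rw [hasDerivAt_iff_tendsto_slope] at hw hud' ⊢
      have e1 : ∀ σ, slope k s σ
          = ⟪j (x σ), slope u s σ⟫ + slope (fun s => ⟪j (x s), j v⟫) s σ := by
        intro σ
        simp only [slope_def_module, hk, ← hjv]
        rw [← Complex.coe_smul (σ - s)⁻¹ (u σ - j v), inner_smul_right, inner_sub_right]
        simp only [Complex.real_smul]
        ring
      have e2 : Tendsto (fun σ => ⟪j (x σ), slope u s σ⟫) (𝓝[≠] s)
          (𝓝 ⟪j (x s), j (v' - v)⟫) := by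
        have e3 : ∀ σ, ⟪j (x σ), slope u s σ⟫
            = ⟪j (x σ), slope u s σ - j (v' - v)⟫ + ⟪j (x σ), j (v' - v)⟫ := fun σ => by
          rw [← inner_add_right]; simp
        simp only [e3]
        rw [← zero_add ⟪j (x s), j (v' - v)⟫]
        refine Tendsto.add ?_ ((hzc (v' - v) hs.1).mono_left nhdsWithin_le_nhds)
        refine squeeze_zero_norm' (a := fun σ => K * ‖slope u s σ - j (v' - v)‖) ?_ ?_
        · have : ∀ᶠ σ in 𝓝[≠] s, 0 < σ := nhdsWithin_le_nhds (lt_mem_nhds hs.1)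
          filter_upwards [this] with σ hσ
          exact (norm_inner_le_norm _ _).trans (by gcongr; exact hK σ hσ)
        · have := (hud'.sub_const (j (v' - v))).norm.const_mul K
          simpa using this
      simp only [funext e1]
      have := e2.add hw
      convert this using 2
      rw [hin, map_sub, inner_sub_right]
      ring
    have hconst : ∀ s ∈ Ioo 0 S, ∀ s' ∈ Ioo 0 S, k s = k s' := fun s hs s' hs' =>
      isOpen_Ioo.is_const_of_deriv_eq_zero (convex_Ioo 0 S).isPreconnected
        (fun s hs => (hkd s hs).differentiableAt.differentiableWithinAt)
        (fun s hs => (hkd s hs).deriv) hs hs'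
    have hmid : S / 2 ∈ Ioo 0 S := ⟨by linarith, by linarith⟩
    -- the limits of `k` at both ends of the interval
    have hleft : Tendsto k (𝓝[>] 0) (𝓝 ⟪f, heat C 0 S (j v₀)⟫) := by
      have hu0 : Tendsto u (𝓝[>] 0) (𝓝 (heat C 0 S (j v₀))) := by
        have := (hud 0 hS).continuousAt.tendsto
        simp only [hu, sub_zero] at this
        exact this.mono_left nhdsWithin_le_nhds
      obtain ⟨v, hv⟩ : ∃ v, j v = heat C 0 S (j v₀) :=
        ⟨_, (hrange 0 (by simpa using hS) (j v₀)).symm⟩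
      have e3 : ∀ σ, k σ = ⟪j (x σ), u σ - j v⟫ + ⟪j (x σ), j v⟫ := fun σ => by
        rw [← inner_add_right]; simp [hk]
      simp only [funext e3]
      rw [← zero_add ⟪f, heat C 0 S (j v₀)⟫, ← hv]
      refine Tendsto.add ?_ (h0 v)
      refine squeeze_zero_norm' (a := fun σ => K * ‖u σ - j v‖) ?_ ?_
      · filter_upwards [self_mem_nhdsWithin] with σ hσ
        exact (norm_inner_le_norm _ _).trans (by gcongr; exact hK σ hσ)
      · rw [← hv] at hu0
        simpa using (hu0.sub_const (j v)).norm.const_mul K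
    have hright : Tendsto k (𝓝[<] S) (𝓝 ⟪j (x S), j v₀⟫) := by
      have e3 : ∀ σ, k σ = ⟪j (x σ), u σ - j v₀⟫ + ⟪j (x σ), j v₀⟫ := fun σ => by
        rw [← inner_add_right]; simp [hk]
      simp only [funext e3]
      rw [← zero_add ⟪j (x S), j v₀⟫]
      refine Tendsto.add ?_ ((hzc v₀ hS).mono_left nhdsWithin_le_nhds)
      refine squeeze_zero_norm' (a := fun σ => K * Real.sqrt ((S - σ) * ‖v₀‖ ^ 2)) ?_ ?_
      · have : ∀ᶠ σ in 𝓝[<] S, 0 < σ := nhdsWithin_le_nhds (lt_mem_nhds hS)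
        filter_upwards [this, self_mem_nhdsWithin] with σ hσ hσS
        refine (norm_inner_le_norm _ _).trans ?_
        have hKp : 0 ≤ K := (norm_nonneg _).trans (hK σ hσ)
        gcongr
        · exact hK σ hσ
        · refine Real.le_sqrt_of_sq_le ?_
          rw [norm_sub_rev]
          exact norm_sub_heat_comp_sq_le hj (sub_pos.2 hσS) v₀
      · have : Continuous fun σ => K * Real.sqrt ((S - σ) * ‖v₀‖ ^ 2) := by fun_prop
        refine (this.tendsto' S 0 (by simp)).mono_left nhdsWithin_le_nhds
    have hL : Tendsto k (𝓝[>] 0) (𝓝 (k (S / 2))) := by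
      refine tendsto_const_nhds.congr' ?_
      filter_upwards [Ioo_mem_nhdsGT hS] with s hs using hconst _ hmid _ hs
    have hR : Tendsto k (𝓝[<] S) (𝓝 (k (S / 2))) := by
      refine tendsto_const_nhds.congr' ?_
      filter_upwards [Ioo_mem_nhdsLT hS] with s hs using hconst _ hmid _ hs
    rw [tendsto_nhds_unique hright hR, ← tendsto_nhds_unique hleft hL,
      ← ContinuousLinearMap.adjoint_inner_left, IsUnitOperator.adjoint_heat]
    simp
  -- `key` only tests against the range of `j`. Both vectors lie in that range, so their difference
  -- may be tested against itself and density of the range is not needed.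
  have hS' : heat C 0 S f = j (ContinuousLinearMap.adjoint j (heat C 1 S f)) :=
    hrange 0 (by simpa using hS) f
  have hz : ⟪j (x S) - heat C 0 S f, j (x S) - heat C 0 S f⟫ = 0 := by
    conv_lhs => enter [3]; rw [hS', ← map_sub]
    rw [inner_sub_left, key, sub_self]
  exact sub_eq_zero.1 (inner_self_eq_zero.1 hz)

/-- A time-dependent intertwining of two semigroups: if contractions `T s` transform the equation
`w' = -A₁ w` in the time `t s` into `z' = -A₂ z` in the time `s`, and `U` is the inverse of the
isometry that is the limit of `T s` as `s → 0`, then `T s e^{-t(s) A₁} U = e^{-s A₂}`. -/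
theorem comp_heat_eq_heat {j₁ : V₁ →L[ℂ] H} {j₂ : V₂ →L[ℂ] H} (hj₁ : ‖j₁‖ ≤ 1) (hj₂ : ‖j₂‖ ≤ 1)
    {E : Type*} {e : E → V₂} (he : DenseRange e) {T : ℝ → H →L[ℂ] H} {TV : ℝ → V₁ →L[ℂ] V₂}
    {t τ B : ℝ → ℝ} {Ψ : E → ℝ → V₁} {Ψ' : E → ℝ → H}
    (ht : ∀ s > 0, 0 < t s) (htd : ∀ s > 0, HasDerivAt t (τ s) s)
    (ht0 : Tendsto t (𝓝[>] 0) (𝓝 0))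
    (hT : ∀ s > 0, ‖T s‖ ≤ 1) (hTV : ∀ s > 0, ∀ v, j₂ (TV s v) = T s (j₁ v))
    (hB : ContinuousOn B (Ioi 0)) (hTB : ∀ s > 0, ‖TV s‖ ≤ B s)
    {U : H →L[ℂ] H} (hU : ∀ f g, ⟪U f, U g⟫ = ⟪f, g⟫)
    (hcore : ∀ ψ, ∃ v, j₁ v = U (j₂ (e ψ)))
    (hΨ : ∀ ψ, ∀ s > 0, ContinuousLinearMap.adjoint (T s) (j₂ (e ψ)) = j₁ (Ψ ψ s))
    (hΨd : ∀ ψ, ∀ s > 0, HasDerivAt (fun s => j₁ (Ψ ψ s)) (Ψ' ψ s) s)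
    (hΨ0 : ∀ ψ, Tendsto (fun s => j₁ (Ψ ψ s)) (𝓝[>] 0) (𝓝 (U (j₂ (e ψ)))))
    (hid : ∀ ψ, ∀ s > 0, ∀ v, ⟪j₁ v, Ψ' ψ s⟫ = τ s * (⟪v, Ψ ψ s⟫ - ⟪j₁ v, j₁ (Ψ ψ s)⟫)
      - (⟪TV s v, e ψ⟫ - ⟪j₂ (TV s v), j₂ (e ψ)⟫))
    {s : ℝ} (hs : 0 < s) :
    T s ∘L heat (formResolvent j₁) 0 (t s) ∘L U = heat (formResolvent j₂) 0 s := by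
  have hC₁ : IsUnitOperator (formResolvent j₁) := isUnitOperator_comp_adjoint hj₁
  have hre : ∀ {s : ℝ}, 0 < s → 0 < ((t s : ℝ) : ℂ).re := fun {s} hs => by simpa using ht s hs
  ext f₀
  set f : H := U f₀ with hf
  have hfn : ‖f‖ = ‖f₀‖ := by
    rw [@norm_eq_sqrt_re_inner ℂ, @norm_eq_sqrt_re_inner ℂ _ _ _ _ f₀, hf, hU]
  set P : ℝ → H := fun s => heat (formResolvent j₁) 0 (t s) f with hP
  -- The flow `P s` is lifted to the form domain as `j₁* (A₁ + 1) e^{-t A₁} f`, where the bounded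
  -- map `TV s` can act on it.
  set v : ℝ → V₁ := fun s => ContinuousLinearMap.adjoint j₁ (heat (formResolvent j₁) 1 (t s) f)
    with hv
  set x : ℝ → V₂ := fun s => TV s (v s) with hx
  have hjv : ∀ s > 0, j₁ (v s) = P s := fun s hs => by
    simp only [hP]
    rw [← hC₁.mul_heat_succ 0 (hre hs)]; rfl
  have hjx : ∀ s > 0, j₂ (x s) = T s (P s) := fun s hs => by rw [hx, hTV s hs, hjv s hs]
  have hPn : ∀ s > 0, ‖P s‖ ≤ ‖f‖ := fun s hs =>
    ((heat (formResolvent j₁) 0 (t s)).le_opNorm f).trans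
      (mul_le_of_le_one_left (norm_nonneg f) (hC₁.norm_heat_zero_le (hre hs).le))
  have hxK : ∀ s > 0, ‖j₂ (x s)‖ ≤ ‖f‖ := fun s hs => by
    rw [hjx s hs]
    exact ((T s).le_opNorm _).trans
      ((mul_le_of_le_one_left (norm_nonneg _) (hT s hs)).trans (hPn s hs))
  have hinner : ∀ ψ, ∀ s > 0, ⟪j₂ (x s), j₂ (e ψ)⟫ = ⟪P s, j₁ (Ψ ψ s)⟫ := fun ψ s hs => by
    rw [hjx s hs, ← hΨ ψ s hs, ContinuousLinearMap.adjoint_inner_right]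
  have hPd : ∀ s > 0, HasDerivAt P
      (τ s • -(heat (formResolvent j₁) 1 (t s) f - heat (formResolvent j₁) 0 (t s) f)) s := by
    intro s hs
    have h2 := HasDerivAt.scomp s (hC₁.hasDerivAt_heat 0 (hre hs)) (htd s hs).ofReal_comp
    have h3 := ((ContinuousLinearMap.apply ℂ H f).restrictScalars ℝ).hasFDerivAt.comp_hasDerivAt s
      (f := fun s : ℝ => (heat (formResolvent j₁) 0 (t s : ℂ))) h2
    refine h3.congr_deriv ?_
    simp
  have hweak : ∀ ψ, IsWeakSolutionAt j₂ x (e ψ) := by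
    intro ψ s hs
    have h1 := (hPd s hs).inner ℂ (hΨd ψ s hs)
    have h2 : (fun s => ⟪P s, j₁ (Ψ ψ s)⟫) =ᶠ[𝓝 s] fun s => ⟪j₂ (x s), j₂ (e ψ)⟫ := by
      filter_upwards [lt_mem_nhds hs] with s hs using (hinner ψ s hs).symm
    refine (h1.congr_of_eventuallyEq h2.symm).congr_deriv ?_
    have h3 : ⟪v s, Ψ ψ s⟫ = ⟪heat (formResolvent j₁) 1 (t s) f, j₁ (Ψ ψ s)⟫ :=
      ContinuousLinearMap.adjoint_inner_left _ _ _
    -- `hid` differentiates the adjoint transform in form terms. Its `A₁`-part cancels against the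
    -- derivative of `P`, whose speed is `τ s`; what remains is minus the form of `A₂`.
    have h4 := hid ψ s hs (v s)
    rw [h3, hjv s hs] at h4
    have h5 : heat (formResolvent j₁) 0 (t s) f = P s := rfl
    rw [h4, ← Complex.coe_smul, inner_smul_left, inner_neg_left, inner_sub_left, h5,
      Complex.conj_ofReal]
    ring
  have hM : ContinuousOn (fun s => B s * ((1 + (t s)⁻¹) * ‖f‖)) (Ioi 0) := by
    have htc : ContinuousOn t (Ioi 0) := fun s hs => (htd s hs).continuousAt.continuousWithinAt
    exact hB.mul ((continuousOn_const.add (htc.inv₀ fun s hs => (ht s hs).ne')).mul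
      continuousOn_const)
  have hxM : ∀ s > 0, ‖x s‖ ≤ B s * ((1 + (t s)⁻¹) * ‖f‖) := by
    intro s hs
    have h1 : ‖v s‖ ≤ (1 + (t s)⁻¹) * ‖f‖ := by
      have h2 := (ContinuousLinearMap.adjoint j₁).le_opNorm (heat (formResolvent j₁) 1 (t s) f)
      rw [LinearIsometryEquiv.norm_map] at h2
      have h3 := (heat (formResolvent j₁) 1 (t s)).le_opNorm f
      have h4 := hC₁.norm_heat_one_le (hre hs)
      rw [Complex.ofReal_re] at h4
      refine h2.trans ((mul_le_of_le_one_left (norm_nonneg _) hj₁).trans (h3.trans ?_))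
      gcongr
    exact ((TV s).le_opNorm _).trans (mul_le_mul (hTB s hs) h1 (norm_nonneg _)
      ((norm_nonneg _).trans (hTB s hs)))
  have hwk := fun v => IsWeakSolutionAt.of_dense hj₂ hM hxM he hweak v
  -- the initial value, first on the form domain of `A₁`, then against the dense set
  have hinit : ∀ ψ, Tendsto (fun s => ⟪j₂ (x s), j₂ (e ψ)⟫) (𝓝[>] 0) (𝓝 ⟪f₀, j₂ (e ψ)⟫) := by
    intro ψ
    -- Strong continuity at time zero is known with a rate on the range of `j₁`, so the self-adjoint
    -- semigroup is moved from `f` to `j₁ y`.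
    obtain ⟨y, hy⟩ := hcore ψ
    have e1 : ∀ s > 0, ⟪j₂ (x s), j₂ (e ψ)⟫ = ⟪P s, j₁ (Ψ ψ s) - U (j₂ (e ψ))⟫
        + (⟪f, heat (formResolvent j₁) 0 (t s) (j₁ y) - j₁ y⟫ + ⟪f, U (j₂ (e ψ))⟫) := by
      intro s hs
      have hsym : ⟪P s, j₁ y⟫ = ⟪f, heat (formResolvent j₁) 0 (t s) (j₁ y)⟫ := by
        rw [hP, ← ContinuousLinearMap.adjoint_inner_right, IsUnitOperator.adjoint_heat,
          show star ((t s : ℝ) : ℂ) = t s by simp]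
      rw [hinner ψ s hs, inner_sub_right, inner_sub_right, ← hy, hsym]
      ring
    have e2 : Tendsto (fun s => ⟪P s, j₁ (Ψ ψ s) - U (j₂ (e ψ))⟫
        + (⟪f, heat (formResolvent j₁) 0 (t s) (j₁ y) - j₁ y⟫ + ⟪f, U (j₂ (e ψ))⟫)) (𝓝[>] 0)
        (𝓝 (0 + (0 + ⟪f, U (j₂ (e ψ))⟫))) := by
      refine Tendsto.add ?_ (Tendsto.add ?_ tendsto_const_nhds)
      · refine squeeze_zero_norm' (a := fun s => ‖f‖ * ‖j₁ (Ψ ψ s) - U (j₂ (e ψ))‖) ?_ ?_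
        · filter_upwards [self_mem_nhdsWithin] with s hs
          exact (norm_inner_le_norm _ _).trans (by gcongr; exact hPn s hs)
        · simpa using ((hΨ0 ψ).sub_const (U (j₂ (e ψ)))).norm.const_mul ‖f‖
      · refine squeeze_zero_norm' (a := fun s => ‖f‖ * Real.sqrt (t s * ‖y‖ ^ 2)) ?_ ?_
        · filter_upwards [self_mem_nhdsWithin] with s hs
          refine (norm_inner_le_norm _ _).trans ?_
          gcongr
          refine Real.le_sqrt_of_sq_le ?_
          rw [norm_sub_rev]
          exact norm_sub_heat_comp_sq_le hj₁ (ht s hs) y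
        · have := ((Real.continuous_sqrt.tendsto 0).comp
            (by simpa using ht0.mul_const (‖y‖ ^ 2))).const_mul ‖f‖
          simpa using this
    rw [zero_add, zero_add, show ⟪f, U (j₂ (e ψ))⟫ = ⟪f₀, j₂ (e ψ)⟫ from hU _ _] at e2
    refine e2.congr' ?_
    filter_upwards [self_mem_nhdsWithin] with s hs
    rw [e1 s hs, show ⟪f, U (j₂ (e ψ))⟫ = ⟪f₀, j₂ (e ψ)⟫ from hU _ _]
  have hall : ∀ v, Tendsto (fun s => ⟪j₂ (x s), j₂ v⟫) (𝓝[>] 0) (𝓝 ⟪f₀, j₂ v⟫) := by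
    intro v
    rw [Metric.tendsto_nhds]
    intro ε hε
    -- Two approximation errors of size `‖f₀‖ ε / (2K)` then add up to less than `ε / 2`; the
    -- summand `1` keeps `K` positive when `f₀ = 0`.
    set K := 2 * ‖f₀‖ + 1 with hK
    have hKp : 0 < K := by positivity
    obtain ⟨ψ, hψ⟩ := he.exists_dist_lt v (show 0 < ε / (2 * K) by positivity)
    filter_upwards [(Metric.tendsto_nhds.1 (hinit ψ)) (ε / 2) (by positivity),
      self_mem_nhdsWithin] with s h1 hs
    have hd : ∀ y : H, ‖y‖ ≤ ‖f₀‖ → ‖⟪y, j₂ v⟫ - ⟪y, j₂ (e ψ)⟫‖ ≤ ‖f₀‖ * (ε / (2 * K)) := by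
      intro y hy
      rw [← inner_sub_right, ← map_sub]
      refine (norm_inner_le_norm _ _).trans ?_
      have h2 : ‖j₂ (v - e ψ)‖ ≤ ‖v - e ψ‖ :=
        (j₂.le_opNorm _).trans (mul_le_of_le_one_left (norm_nonneg _) hj₂)
      rw [dist_eq_norm] at hψ
      gcongr
      linarith
    have h2 := hd _ ((hxK s hs).trans_eq hfn)
    have h3 := hd f₀ le_rfl
    rw [dist_eq_norm] at h1 ⊢
    have e1 : ⟪j₂ (x s), j₂ v⟫ - ⟪f₀, j₂ v⟫ = (⟪j₂ (x s), j₂ v⟫ - ⟪j₂ (x s), j₂ (e ψ)⟫)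
      + (⟪j₂ (x s), j₂ (e ψ)⟫ - ⟪f₀, j₂ (e ψ)⟫) - (⟪f₀, j₂ v⟫ - ⟪f₀, j₂ (e ψ)⟫) := by ring
    rw [e1]
    have h4 := norm_sub_le ((⟪j₂ (x s), j₂ v⟫ - ⟪j₂ (x s), j₂ (e ψ)⟫)
      + (⟪j₂ (x s), j₂ (e ψ)⟫ - ⟪f₀, j₂ (e ψ)⟫)) (⟪f₀, j₂ v⟫ - ⟪f₀, j₂ (e ψ)⟫)
    have h5 := norm_add_le (⟪j₂ (x s), j₂ v⟫ - ⟪j₂ (x s), j₂ (e ψ)⟫)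
      (⟪j₂ (x s), j₂ (e ψ)⟫ - ⟪f₀, j₂ (e ψ)⟫)
    have h6 : 2 * (‖f₀‖ * (ε / (2 * K))) < ε / 2 := by
      rw [show 2 * (‖f₀‖ * (ε / (2 * K))) = (2 * ‖f₀‖ / K) * (ε / 2) by field_simp]
      have : 2 * ‖f₀‖ / K < 1 := by rw [div_lt_one hKp]; linarith
      nlinarith
    linarith
  have := weakSolution_eq_heat hj₂ hwk hxK hall hs
  rw [hjx s hs] at this
  exact this

end Intertwining
end RiemannianCone

namespace RiemannianCone

open MeasureTheory Set Filter

/-! ### Gram matrices and pairings of covectors -/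

section BilinearGram

variable {d : ℕ}

/-- The Gram matrix of a bilinear form on `ℝᵈ`. -/
def bilinGram (B : Coord d →L[ℝ] Coord d →L[ℝ] ℝ) : Matrix (Fin d) (Fin d) ℝ :=
  Matrix.of fun i j => B (basisVec i) (basisVec j)

/-- The matrix of a linear map of `ℝᵈ`. -/
def stdMatrix (L : Coord d →L[ℝ] Coord d) : Matrix (Fin d) (Fin d) ℝ :=
  Matrix.of fun i j => L (basisVec j) i

theorem sum_smul_basisVec (v : Coord d) : ∑ i, v i • basisVec i = v := by
  ext j
  simp [basisVec, Pi.single_apply]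

theorem det_stdMatrix (L : Coord d →L[ℝ] Coord d) : (stdMatrix L).det = L.det := by
  rw [ContinuousLinearMap.det, ← LinearMap.det_toMatrix (EuclideanSpace.basisFun (Fin d) ℝ).toBasis]
  congr 1

theorem apply_basisVec (L : Coord d →L[ℝ] Coord d) (j : Fin d) :
    L (basisVec j) = ∑ i, stdMatrix L i j • basisVec i :=
  (sum_smul_basisVec (L (basisVec j))).symm

theorem bilinGram_comp (B : Coord d →L[ℝ] Coord d →L[ℝ] ℝ) (L : Coord d →L[ℝ] Coord d) :
    bilinGram (B.bilinearComp L L) = (stdMatrix L).transpose * bilinGram B * stdMatrix L := by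
  ext i j
  simp only [bilinGram, Matrix.of_apply, ContinuousLinearMap.bilinearComp_apply, Matrix.mul_apply,
    Matrix.transpose_apply]
  rw [apply_basisVec L i, apply_basisVec L j]
  simp only [map_sum, map_smul, sum_apply, smul_apply,
    smul_eq_mul, Finset.sum_mul, Finset.mul_sum]
  refine Finset.sum_congr rfl fun k _ => Finset.sum_congr rfl fun l _ => ?_
  ring

theorem posDef_bilinGram {B : Coord d →L[ℝ] Coord d →L[ℝ] ℝ} (hsymm : ∀ v w, B v w = B w v)
    (hpos : ∀ v, v ≠ 0 → 0 < B v v) : (bilinGram B).PosDef := by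
  refine Matrix.PosDef.of_dotProduct_mulVec_pos ?_ ?_
  · ext i j
    simp [bilinGram, Matrix.conjTranspose_apply, hsymm (basisVec j)]
  · intro x hx
    have h1 : star x ⬝ᵥ (bilinGram B).mulVec x = B (WithLp.toLp 2 x) (WithLp.toLp 2 x) := by
      conv_rhs => rw [← sum_smul_basisVec (WithLp.toLp 2 x)]
      simp only [map_sum, map_smul, sum_apply, smul_apply,
        smul_eq_mul, dotProduct, Matrix.mulVec, bilinGram, Matrix.of_apply, Finset.mul_sum,
        star_trivial]
      rw [Finset.sum_comm]
      refine Finset.sum_congr rfl fun k _ => Finset.sum_congr rfl fun l _ => ?_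
      ring
    rw [h1]
    exact hpos _ (by simpa using hx)

/-- The pairing of complex covectors, given by their values on the standard basis, induced by a
symmetric matrix. -/
def matrixPairing (G : Matrix (Fin d) (Fin d) ℝ) (a b : Fin d → ℂ) : ℂ :=
  ∑ i, ∑ j, ((G⁻¹ i j : ℝ) : ℂ) * a i * (starRingEnd ℂ) (b j)

theorem matrixPairing_eq (G : Matrix (Fin d) (Fin d) ℝ) (a b : Fin d → ℂ) :
    matrixPairing G a b = a ⬝ᵥ ((G⁻¹).map ((↑) : ℝ → ℂ)).mulVec (star b) := by
  simp only [matrixPairing, dotProduct, Matrix.mulVec, Matrix.map_apply, Finset.mul_sum,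
    Pi.star_apply]
  refine Finset.sum_congr rfl fun k _ => Finset.sum_congr rfl fun l _ => ?_
  rw [starRingEnd_apply]
  ring

theorem matrixPairing_conj {G : Matrix (Fin d) (Fin d) ℝ} (hG : G.PosDef) (a b : Fin d → ℂ) :
    (starRingEnd ℂ) (matrixPairing G a b) = matrixPairing G b a := by
  simp only [matrixPairing, map_sum, map_mul, Complex.conj_ofReal, Complex.conj_conj]
  rw [Finset.sum_comm]
  refine Finset.sum_congr rfl fun k _ => Finset.sum_congr rfl fun l _ => ?_
  have : G⁻¹ l k = G⁻¹ k l := by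
    have := hG.isHermitian.inv.apply k l
    simpa using this
  rw [this]
  ring

/-- The real part splits into the real quadratic form of `G⁻¹` on the real parts plus the same form
on the imaginary parts. -/
theorem matrixPairing_self_nonneg {G : Matrix (Fin d) (Fin d) ℝ} (hG : G.PosDef)
    (a : Fin d → ℂ) : 0 ≤ (matrixPairing G a a).re := by
  have h1 : (matrixPairing G a a).re
      = (fun i => (a i).re) ⬝ᵥ (G⁻¹).mulVec (fun i => (a i).re)
        + (fun i => (a i).im) ⬝ᵥ (G⁻¹).mulVec (fun i => (a i).im) := by
    simp only [matrixPairing, dotProduct, Matrix.mulVec, Finset.mul_sum, ← Finset.sum_add_distrib,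
      Complex.re_sum]
    refine Finset.sum_congr rfl fun k _ => Finset.sum_congr rfl fun l _ => ?_
    simp only [Complex.mul_re, Complex.mul_im, Complex.conj_re, Complex.conj_im, Complex.ofReal_re,
      Complex.ofReal_im]
    ring
  rw [h1]
  have h2 := hG.inv.posSemidef.dotProduct_mulVec_nonneg (fun i => (a i).re)
  have h3 := hG.inv.posSemidef.dotProduct_mulVec_nonneg (fun i => (a i).im)
  simp only [star_trivial] at h2 h3
  exact add_nonneg h2 h3

/-- The pairing of covectors does not depend on the frame. -/
theorem matrixPairing_change (G A : Matrix (Fin d) (Fin d) ℝ) (hA : IsUnit A.det)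
    (a b : Fin d → ℂ) :
    matrixPairing (A.transpose * G * A) ((A.map ((↑) : ℝ → ℂ)).transpose.mulVec a)
      ((A.map ((↑) : ℝ → ℂ)).transpose.mulVec b) = matrixPairing G a b := by
  rw [matrixPairing_eq, matrixPairing_eq]
  set A' := A.map ((↑) : ℝ → ℂ) with hA'
  have hcast : ∀ M N : Matrix (Fin d) (Fin d) ℝ,
      (M * N).map ((↑) : ℝ → ℂ) = M.map ((↑) : ℝ → ℂ) * N.map ((↑) : ℝ → ℂ) := fun M N =>
    Matrix.map_mul (f := Complex.ofRealHom)
  have hAA : A * A⁻¹ = 1 := Matrix.mul_nonsing_inv A hA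
  have hAA' : A' * (A⁻¹).map ((↑) : ℝ → ℂ) = 1 := by
    rw [hA', ← hcast, hAA]
    exact Matrix.map_one _ Complex.ofReal_zero Complex.ofReal_one
  have hstar : star (A'.transpose.mulVec b) = A'.transpose.mulVec (star b) := by
    ext i
    simp [Matrix.mulVec, dotProduct, hA']
  have e2 : (A.transpose⁻¹).map ((↑) : ℝ → ℂ) * A'.transpose = 1 := by
    have := congrArg Matrix.transpose hAA'
    rwa [Matrix.transpose_mul, Matrix.transpose_one, ← Matrix.transpose_map,
      Matrix.transpose_nonsing_inv] at this
  rw [Matrix.mul_inv_rev, Matrix.mul_inv_rev, hcast, hcast, hstar, Matrix.mulVec_mulVec,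
    Matrix.mulVec_transpose, ← Matrix.dotProduct_mulVec, Matrix.mulVec_mulVec, Matrix.mul_assoc,
    Matrix.mul_assoc, e2, Matrix.mul_one, ← Matrix.mul_assoc, hAA', Matrix.one_mul]

end BilinearGram

/-! ### The metric and differentials in the frame of a fixed chart -/

section Frame

variable {d : ℕ} {H : Type*} [TopologicalSpace H] {I : ModelWithCorners ℝ (Coord d) H}
  {Y : Type*} [TopologicalSpace Y] [ChartedSpace H Y] [IsManifold I ∞ Y]

/-- The metric as a bilinear form on `ℝᵈ`, in the coordinates of the preferred chart at `y`. -/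
def metricAt (h : Metric I Y) (y : Y) : Coord d →L[ℝ] Coord d →L[ℝ] ℝ := h.inner y

theorem gram_eq (h : Metric I Y) (y : Y) : gram h y = bilinGram (metricAt h y) := rfl

theorem metricAt_symm (h : Metric I Y) (y : Y) (v w : Coord d) :
    metricAt h y v w = metricAt h y w v := h.symm y v w

theorem metricAt_pos (h : Metric I Y) (y : Y) (v : Coord d) (hv : v ≠ 0) :
    0 < metricAt h y v v := h.pos y v hv

variable (I) in
/-- The coordinate change at `y` from the chart around `x` to the preferred chart at `y`. -/
def frame (x y : Y) : Coord d →L[ℝ] Coord d := tangentCoordChange I x y y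

/-- The coefficients of the metric at `y` in the chart around `x`. -/
def frameGram (h : Metric I Y) (x y : Y) : Matrix (Fin d) (Fin d) ℝ :=
  bilinGram ((metricAt h y).bilinearComp (frame I x y) (frame I x y))

/-- The reverse coordinate change is an inverse, by the cocycle identity. -/
theorem isUnit_det_frame {x y : Y} (hy : y ∈ (extChartAt I x).source) :
    IsUnit (stdMatrix (frame I x y)).det := by
  rw [det_stdMatrix]
  have h1 : (tangentCoordChange I y x y).comp (frame I x y) = ContinuousLinearMap.id ℝ _ := by
    ext1 v
    have h := tangentCoordChange_comp (I := I) (w := x) (x := y) (y := x) (z := y) (v := v)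
      ⟨⟨hy, mem_extChartAt_source y⟩, hy⟩
    rw [tangentCoordChange_self hy] at h
    exact h
  have h2 := congrArg ContinuousLinearMap.det h1
  have h3 : (tangentCoordChange I y x y).det * (frame I x y).det = 1 := by
    simpa [ContinuousLinearMap.det, LinearMap.det_comp] using h2
  exact IsUnit.of_mul_eq_one_right _ h3

theorem frameGram_eq (h : Metric I Y) (x y : Y) : frameGram h x y
    = (stdMatrix (frame I x y)).transpose * gram h y * stdMatrix (frame I x y) := by
  rw [frameGram, bilinGram_comp, gram_eq]

theorem posDef_gram (h : Metric I Y) (y : Y) : (gram h y).PosDef :=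
  posDef_bilinGram (metricAt_symm h y) (metricAt_pos h y)

theorem det_frameGram (h : Metric I Y) (x y : Y) :
    (frameGram h x y).det = (frame I x y).det ^ 2 * (gram h y).det := by
  rw [frameGram_eq, Matrix.det_mul, Matrix.det_mul, Matrix.det_transpose, det_stdMatrix]
  ring

/-- The pairing of covectors computed in the frame of the chart around `x`. -/
theorem covectorInner_eq_frame (h : Metric I Y) {x y : Y} (hy : y ∈ (extChartAt I x).source)
    (α β : TangentSpace I y →L[ℝ] ℂ) :
    covectorInner h y α β = matrixPairing (frameGram h x y)
      (fun i => α (frame I x y (basisVec i))) (fun i => β (frame I x y (basisVec i))) := by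
  have hα : ∀ α : Coord d →L[ℝ] ℂ, (fun i => α (frame I x y (basisVec i)))
      = ((stdMatrix (frame I x y)).map ((↑) : ℝ → ℂ)).transpose.mulVec
        fun i => α (basisVec i) := by
    intro α
    ext i
    rw [apply_basisVec]
    simp [Matrix.mulVec, dotProduct]
  rw [frameGram_eq]
  erw [hα α, hα β]
  rw [matrixPairing_change _ _ (isUnit_det_frame hy)]
  rfl

/-- The coordinate fields are the images of the standard basis under the tangent trivialization at
`x`, which are coordinate changes. Passing through `frame` matters because `gram h y` refers to the
preferred chart at `y`, which may jump with `y`; only after conjugation to a fixed chart do the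
coefficients become continuous. -/
theorem chartGram_eq (h : Metric I Y) (x : Y) {z : Coord d} (hz : z ∈ (extChartAt I x).target) :
    chartGram h x z = frameGram h x ((extChartAt I x).symm z) := by
  have hy := (extChartAt I x).map_target hz
  have hf : ∀ i, (coordField (I := I) x z i : Coord d) = frame I x ((extChartAt I x).symm z) (basisVec i) := by
    intro i
    set y := (extChartAt I x).symm z with hydef
    have hzy : extChartAt I x y = z := (extChartAt I x).right_inv hz
    have hyc : y ∈ (chartAt H x).source := by rwa [← extChartAt_source I x]
    have h1 := TangentBundle.symmL_trivializationAt (I := I) hyc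
    have h2 : Bundle.Trivialization.symmL ℝ (trivializationAt (Coord d) (TangentSpace I) x) y
        = tangentCoordChange I x y y :=
      (tangentBundleCore I Y).trivializationAt_symmL (b₀ := x) (b := y) hyc
    have h3 : ∀ z' z : Coord d, z' = z →
        (mfderivWithin 𝓘(ℝ, Coord d) I (extChartAt I x).symm (range I) z' : Coord d →L[ℝ] Coord d)
        = mfderivWithin 𝓘(ℝ, Coord d) I (extChartAt I x).symm (range I) z := by
      rintro z' z rfl; rfl
    have h4 := (h3 _ _ hzy).symm.trans (h1.symm.trans h2)
    exact congrArg (fun L : Coord d →L[ℝ] Coord d => L (basisVec i)) h4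
  ext i j
  simp only [chartGram, Matrix.of_apply, hf]
  rfl

open Bundle in
/-- The metric coefficients in the chart around `x` are continuous at `x`. -/
theorem continuousAt_frameGram (h : Metric I Y) (x : Y) (i j : Fin d) :
    ContinuousAt (fun y => frameGram h x y i j) x := by
  set e := trivializationAt (Coord d) (TangentSpace I : Y → Type _) x with he
  set b := (EuclideanSpace.basisFun (Fin d) ℝ).toBasis with hb
  have hx : x ∈ e.baseSet := FiberBundle.mem_baseSet_trivializationAt' x
  -- The frame of a fixed trivialization consists of smooth sections, so the smooth bundle metric
  -- evaluated on it is a continuous function.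
  have hsec : ∀ k, ContMDiffAt I (I.prod 𝓘(ℝ, Coord d)) 0
      (fun y => TotalSpace.mk' (Coord d) y (e.localFrame b k y)) x := fun k =>
    contMDiffAt_localFrame_of_mem 0 e b k hx
  have h1 : ContMDiffAt I (I.prod 𝓘(ℝ)) 0
      (fun y => TotalSpace.mk' ℝ (E := Bundle.Trivial Y ℝ) y
        (h.inner y (e.localFrame b i y) (e.localFrame b j y))) x := by
    apply ContMDiffAt.clm_bundle_apply₂ (F₁ := Coord d) (F₂ := Coord d)
    · exact (h.contMDiff.of_le (by simp)).contMDiffAt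
    · exact hsec i
    · exact hsec j
  have h2 : ContinuousAt (fun y => h.inner y (e.localFrame b i y) (e.localFrame b j y)) x := by
    simp only [contMDiffAt_totalSpace] at h1
    exact h1.2.continuousAt
  refine h2.congr ?_
  have hU : e.baseSet ∈ 𝓝 x := e.open_baseSet.mem_nhds hx
  filter_upwards [hU] with y hy
  have hf : ∀ k, (e.localFrame b k y : Coord d) = frame I x y (basisVec k) := by
    intro k
    have hyc : y ∈ (chartAt H x).source := by
      rwa [he, TangentBundle.trivializationAt_baseSet] at hy
    have h2 : Bundle.Trivialization.symmL ℝ (trivializationAt (Coord d) (TangentSpace I) x) y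
        = tangentCoordChange I x y y :=
      (tangentBundleCore I Y).trivializationAt_symmL (b₀ := x) (b := y) hyc
    have h3 : e.localFrame b k y = e.symmL ℝ y (b k) := by
      rw [e.localFrame_apply_of_mem_baseSet b hy]
      simp only [Trivialization.basisAt, Module.Basis.map_apply]
      rw [Trivialization.linearEquivAt_symm_apply, e.symmL_apply hy]
    have h4 : b k = basisVec k := by simp [hb, basisVec]
    rw [h3, h4]
    exact congrArg (fun L : Coord d →L[ℝ] Coord d => L (basisVec k)) h2
  change metricAt h y (e.localFrame b i y) (e.localFrame b j y)
    = metricAt h y (frame I x y (basisVec i)) (frame I x y (basisVec j))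
  rw [hf, hf]

/-- The link derivative, in the frame of a fixed chart, is continuous. -/
theorem continuousAt_linkDeriv_frame {u : ℝ × Y → ℂ}
    (hu : ContMDiff (𝓘(ℝ, ℝ).prod I) 𝓘(ℝ, ℂ) ∞ u) (p : ℝ × Y) (v : Coord d) :
    ContinuousAt (fun q : ℝ × Y => linkDeriv I u q (frame I p.2 q.2 v)) p := by
  have h1 : ContMDiffAt (𝓘(ℝ, ℝ).prod I) 𝓘(ℝ, Coord d →L[ℝ] ℂ) 0
      (inTangentCoordinates I 𝓘(ℝ, ℂ) (fun q : ℝ × Y => q.2) (fun q => u (q.1, q.2))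
        (fun q => mfderiv I 𝓘(ℝ, ℂ) (fun y => u (q.1, y)) q.2) p) p := by
    refine ContMDiffAt.mfderiv (n := 1) (fun (q : ℝ × Y) y => u (q.1, y)) (fun q => q.2) ?_ ?_
      (by simp)
    · have : ContMDiff ((𝓘(ℝ, ℝ).prod I).prod I) 𝓘(ℝ, ℂ) 1
          (Function.uncurry fun (q : ℝ × Y) y => u (q.1, y)) :=
        (hu.of_le (by simp)).comp ((contMDiff_fst.comp contMDiff_fst).prodMk contMDiff_snd)
      exact this.contMDiffAt
    · exact contMDiffAt_snd
  have h2 := (h1.continuousAt.clm_apply (continuousAt_const (y := v)))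
  refine h2.congr ?_
  have hU : {q : ℝ × Y | q.2 ∈ (chartAt H p.2).source} ∈ 𝓝 p :=
    continuous_snd.continuousAt.preimage_mem_nhds ((chartAt H p.2).open_source.mem_nhds
      (mem_chart_source H p.2))
  filter_upwards [hU] with q hq
  have h3 := inTangentCoordinates_eq (I := I) (I' := 𝓘(ℝ, ℂ)) (fun q : ℝ × Y => q.2)
    (fun q => u (q.1, q.2)) (fun q => (mfderiv I 𝓘(ℝ, ℂ) (fun y => u (q.1, y)) q.2))
    (x₀ := p) (x := q) hq (by rw [chartAt_self_eq]; exact mem_univ _)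
  have h4 := congrArg (fun L : Coord d →L[ℝ] ℂ => L v) h3
  refine h4.trans ?_
  simp only [tangentBundleCore_coordChange_model_space]
  rfl

end Frame
end RiemannianCone

namespace RiemannianCone

open MeasureTheory Set Filter

/-! ### The Riemannian volume and its finiteness -/

section Volume
set_option linter.unusedSectionVars false

variable {d : ℕ} {H : Type*} [TopologicalSpace H] {I : ModelWithCorners ℝ (Coord d) H}
  {Y : Type*} [TopologicalSpace Y] [ChartedSpace H Y] [IsManifold I ∞ Y]

theorem covectorInner_conj (h : Metric I Y) (y : Y) (α β : TangentSpace I y → ℂ) :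
    (starRingEnd ℂ) (covectorInner h y α β) = covectorInner h y β α :=
  matrixPairing_conj (posDef_gram h y) (fun i => α (basisVec i)) (fun i => β (basisVec i))

theorem covectorInner_self_nonneg (h : Metric I Y) (y : Y) (α : TangentSpace I y → ℂ) :
    0 ≤ (covectorInner h y α α).re :=
  matrixPairing_self_nonneg (posDef_gram h y) (fun i => α (basisVec i))

theorem det_frameGram_pos (h : Metric I Y) {x y : Y} (hy : y ∈ (extChartAt I x).source) :
    0 < (frameGram h x y).det := by
  have h1 := (isUnit_det_frame (I := I) hy).ne_zero
  rw [det_stdMatrix] at h1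
  rw [det_frameGram]
  exact mul_pos (by positivity) (posDef_gram h y).det_pos

/-- The pairing of the link derivatives of smooth functions is continuous. -/
theorem continuous_covectorInner_linkDeriv (h : Metric I Y) {u v : ℝ × Y → ℂ}
    (hu : ContMDiff (𝓘(ℝ, ℝ).prod I) 𝓘(ℝ, ℂ) ∞ u) (hv : ContMDiff (𝓘(ℝ, ℝ).prod I) 𝓘(ℝ, ℂ) ∞ v) :
    Continuous fun p : ℝ × Y => covectorInner h p.2 (linkDeriv I u p) (linkDeriv I v p) := by
  rw [continuous_iff_continuousAt]
  intro p
  -- Everything is computed in the chart around `p.2`. The inverse Gram matrix is continuous because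
  -- the determinant does not vanish at `p.2`.
  have hG : ContinuousAt (fun q : ℝ × Y => frameGram h p.2 q.2) p :=
    continuousAt_pi.2 fun i => continuousAt_pi.2 fun j =>
      (continuousAt_frameGram h p.2 i j).comp_of_eq continuous_snd.continuousAt rfl
  have hdet : (frameGram h p.2 p.2).det ≠ 0 :=
    (det_frameGram_pos h (mem_extChartAt_source p.2)).ne'
  have hGi : ContinuousAt (fun q : ℝ × Y => (frameGram h p.2 q.2)⁻¹) p := by
    simp only [Matrix.inv_def, Ring.inverse_eq_inv']
    have hd : ContinuousAt (fun q : ℝ × Y => (frameGram h p.2 q.2).det) p :=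
      (continuous_id.matrix_det.continuousAt).comp hG
    exact (hd.inv₀ hdet).smul ((continuous_id.matrix_adjugate.continuousAt).comp hG)
  have hmain : ContinuousAt (fun q : ℝ × Y => matrixPairing (frameGram h p.2 q.2)
      (fun i => linkDeriv I u q (frame I p.2 q.2 (basisVec i)))
      (fun i => linkDeriv I v q (frame I p.2 q.2 (basisVec i)))) p := by
    unfold matrixPairing
    refine tendsto_finsetSum _ fun i _ => tendsto_finsetSum _ fun j _ => ?_
    refine Tendsto.mul (Tendsto.mul ?_ (continuousAt_linkDeriv_frame hu p _)) ?_
    · exact (Complex.continuous_ofReal.tendsto _).comp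
        ((continuous_apply_apply i j).continuousAt.tendsto.comp hGi)
    · exact (Complex.continuous_conj.tendsto _).comp (continuousAt_linkDeriv_frame hv p _)
  refine hmain.congr ?_
  have hU : {q : ℝ × Y | q.2 ∈ (extChartAt I p.2).source} ∈ 𝓝 p :=
    continuous_snd.continuousAt.preimage_mem_nhds (extChartAt_source_mem_nhds p.2)
  filter_upwards [hU] with q hq
  exact (covectorInner_eq_frame h hq (mfderiv I 𝓘(ℝ, ℂ) (fun y => u (q.1, y)) q.2)
    (mfderiv I 𝓘(ℝ, ℂ) (fun y => v (q.1, y)) q.2)).symm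

variable [MeasurableSpace Y] [BorelSpace Y]

variable (I) in
theorem measurableSet_extChartAt_target (x : Y) :
    MeasurableSet (extChartAt I x).target := by
  rw [extChartAt_target]
  exact ((chartAt H x).open_target.preimage I.continuous_symm).measurableSet.inter
    I.isClosed_range.measurableSet

variable (I) in
theorem measurableSet_extChartAt_symm_preimage (x : Y) {B : Set Y} (hB : MeasurableSet B) :
    MeasurableSet ((extChartAt I x).symm ⁻¹' B ∩ (extChartAt I x).target) := by
  have h1 := (continuousOn_iff_continuous_domRestrict.1 (continuousOn_extChartAt_symm (I := I) x)).measurable hB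
  have h2 := (measurableSet_extChartAt_target I x).subtype_image h1
  convert h2 using 1
  ext z
  simp [and_comm]

/-- The density splits into `|det frame|`, which carries all dependence on the chart, and a factor
depending on the point only. Comparing two charts is then multiplicativity of the determinant. -/
theorem chartVolume_apply (h : Metric I Y) (x : Y) {B : Set Y} (hB : MeasurableSet B) :
    chartVolume h x B = ∫⁻ z in (extChartAt I x).symm ⁻¹' B ∩ (extChartAt I x).target,
      ENNReal.ofReal (|(frame I x ((extChartAt I x).symm z)).det|
        * Real.sqrt (gram h ((extChartAt I x).symm z)).det) := by
  have hT := measurableSet_extChartAt_target I x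
  have hae : AEMeasurable (extChartAt I x).symm ((volume.restrict (extChartAt I x).target).withDensity
      fun z => ENNReal.ofReal (Real.sqrt (chartGram h x z).det)) :=
    ((continuousOn_extChartAt_symm x).aemeasurable hT).mono_ac (withDensity_absolutelyContinuous _ _)
  rw [chartVolume, Measure.map_apply_of_aemeasurable hae hB, withDensity_apply',
    Measure.restrict_restrict' hT]
  refine setLIntegral_congr_fun (measurableSet_extChartAt_symm_preimage I x hB) fun z hz => ?_
  rw [chartGram_eq h x hz.2, det_frameGram, Real.sqrt_mul (sq_nonneg _), Real.sqrt_sq_eq_abs]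

theorem chartVolume_eq_inter_source (h : Metric I Y) (x : Y) {B : Set Y} (hB : MeasurableSet B) :
    chartVolume h x B = chartVolume h x (B ∩ (extChartAt I x).source) := by
  rw [chartVolume_apply h x hB,
    chartVolume_apply h x (hB.inter (isOpen_extChartAt_source x).measurableSet)]
  congr 2
  ext z
  simp only [mem_inter_iff, mem_preimage]
  exact ⟨fun hz => ⟨⟨hz.1, (extChartAt I x).map_target hz.2⟩, hz.2⟩, fun hz => ⟨hz.1.1, hz.2⟩⟩

/-- The chart volumes agree on overlaps. -/
theorem chartVolume_eq_of_subset (h : Metric I Y) (x x' : Y) {B : Set Y} (hB : MeasurableSet B)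
    (hx : B ⊆ (extChartAt I x).source) (hx' : B ⊆ (extChartAt I x').source) :
    chartVolume h x B = chartVolume h x' B := by
  rw [chartVolume_apply h x hB, chartVolume_apply h x' hB]
  set φ := extChartAt I x with hφ
  set φ' := extChartAt I x' with hφ'
  set S := φ.symm ⁻¹' B ∩ φ.target with hS
  have himage : φ'.symm ⁻¹' B ∩ φ'.target = (φ' ∘ φ.symm) '' S := by
    ext z
    constructor
    · rintro ⟨hz, hzt⟩
      refine ⟨φ (φ'.symm z), ⟨?_, φ.map_source (hx hz)⟩, ?_⟩
      · rw [mem_preimage, φ.left_inv (hx hz)]; exact hz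
      · rw [Function.comp_apply, φ.left_inv (hx hz), φ'.right_inv hzt]
    · rintro ⟨w, ⟨hw, hwt⟩, rfl⟩
      refine ⟨?_, φ'.map_source (hx' hw)⟩
      rw [mem_preimage, Function.comp_apply, φ'.left_inv (hx' hw)]; exact hw
  -- Only a derivative within the range of the model is available at boundary points, and the change
  -- of variables formula on the set `S` asks for no more.
  have hder : ∀ z ∈ S, HasFDerivWithinAt (φ' ∘ φ.symm) (tangentCoordChange I x x' (φ.symm z)) S z := by
    intro z hz
    have h1 := hasFDerivWithinAt_tangentCoordChange (I := I) (x := x) (y := x') (z := φ.symm z)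
      ⟨hx hz.1, hx' hz.1⟩
    rw [← hφ, ← hφ', φ.right_inv hz.2] at h1
    exact h1.mono fun w hw => extChartAt_target_subset_range x hw.2
  have hinj : InjOn (φ' ∘ φ.symm) S := by
    intro z hz w hw hzw
    have h1 : φ.symm z = φ.symm w := φ'.injOn (hx' hz.1) (hx' hw.1) hzw
    rw [← φ.right_inv hz.2, h1, φ.right_inv hw.2]
  have hSm : MeasurableSet S := measurableSet_extChartAt_symm_preimage I x hB
  rw [himage, lintegral_image_eq_lintegral_abs_det_fderiv_mul volume hSm hder hinj]
  refine setLIntegral_congr_fun hSm fun z hz => ?_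
  rw [Function.comp_apply, φ'.left_inv (hx' hz.1), ← ENNReal.ofReal_mul (abs_nonneg _), ← mul_assoc,
    ← abs_mul]
  have hcomp : (frame I x' (φ.symm z)).comp (tangentCoordChange I x x' (φ.symm z))
      = frame I x (φ.symm z) := by
    ext1 v
    exact tangentCoordChange_comp ⟨⟨hx hz.1, hx' hz.1⟩, mem_extChartAt_source _⟩
  have hdet : (frame I x (φ.symm z)).det
      = (tangentCoordChange I x x' (φ.symm z)).det * (frame I x' (φ.symm z)).det := by
    rw [← hcomp, mul_comm]
    exact LinearMap.det_comp _ _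
  rw [hdet]

/-- Near `x` the continuous density is bounded and the coordinates stay in a unit ball. -/
theorem exists_isOpen_chartVolume_lt_top (h : Metric I Y) (x : Y) :
    ∃ U : Set Y, IsOpen U ∧ x ∈ U ∧ U ⊆ (extChartAt I x).source ∧ chartVolume h x U < ⊤ := by
  have hG : ContinuousAt (fun y => (frameGram h x y).det) x :=
    (continuous_id.matrix_det.continuousAt).comp
      (continuousAt_pi.2 fun i => continuousAt_pi.2 fun j => continuousAt_frameGram h x i j)
  set c := (frameGram h x x).det + 1 with hc
  have h1 : ∀ᶠ y in 𝓝 x, (frameGram h x y).det < c := hG.eventually (gt_mem_nhds (lt_add_one _))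
  have h2 : ∀ᶠ y in 𝓝 x, extChartAt I x y ∈ Metric.ball (extChartAt I x x) 1 :=
    (continuousAt_extChartAt x).eventually (Metric.ball_mem_nhds _ one_pos)
  obtain ⟨U, hUsub, hUo, hxU⟩ := mem_nhds_iff.1
    (inter_mem (inter_mem h1 h2) (extChartAt_source_mem_nhds (I := I) x))
  refine ⟨U, hUo, hxU, fun y hy => (hUsub hy).2, ?_⟩
  rw [chartVolume_apply h x hUo.measurableSet]
  calc ∫⁻ z in (extChartAt I x).symm ⁻¹' U ∩ (extChartAt I x).target,
        ENNReal.ofReal (|(frame I x ((extChartAt I x).symm z)).det|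
          * Real.sqrt (gram h ((extChartAt I x).symm z)).det)
      ≤ ∫⁻ _ in (extChartAt I x).symm ⁻¹' U ∩ (extChartAt I x).target,
        ENNReal.ofReal (Real.sqrt c) := by
        refine setLIntegral_mono' (measurableSet_extChartAt_symm_preimage I x hUo.measurableSet) ?_
        intro z hz
        rw [← Real.sqrt_sq_eq_abs, ← Real.sqrt_mul (sq_nonneg _), ← det_frameGram]
        exact ENNReal.ofReal_le_ofReal (Real.sqrt_le_sqrt (hUsub hz.1).1.1.le)
    _ ≤ ∫⁻ _ in Metric.ball (extChartAt I x x) 1, ENNReal.ofReal (Real.sqrt c) := by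
        refine lintegral_mono_set fun z hz => ?_
        have := (hUsub hz.1).1.2
        simpa only [mem_ofPred_eq, (extChartAt I x).right_inv hz.2] using this
    _ < ⊤ := by
        rw [setLIntegral_const]
        exact ENNReal.mul_lt_top ENNReal.ofReal_lt_top measure_ball_lt_top

/-- The Riemannian volume of a compact manifold is finite. -/
theorem isFiniteMeasure_riemannianVolume [CompactSpace Y] (h : Metric I Y) :
    IsFiniteMeasure (riemannianVolume h) := by
  choose U hUo hxU hUs hUfin using exists_isOpen_chartVolume_lt_top h
  obtain ⟨t, ht⟩ := isCompact_univ.elim_finite_subcover U hUo fun x _ => mem_iUnion.2 ⟨x, hxU x⟩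
  set μ : Measure Y := ∑ x ∈ t, (chartVolume h x).restrict (U x) with hμ
  -- A supremum of measures is bounded by bounding each one: a set is cut along the finite cover,
  -- and each piece is moved to the chart of its cover element, where the chart volumes agree.
  have hle : riemannianVolume h ≤ μ := by
    refine iSup_le fun x' => Measure.le_iff.2 fun B hB => ?_
    have hV : MeasurableSet (extChartAt I x').source := (isOpen_extChartAt_source x').measurableSet
    calc chartVolume h x' B ≤ ∑ x ∈ t, chartVolume h x' (B ∩ U x) := by
          refine (measure_mono ?_).trans (measure_biUnion_finset_le t fun x => B ∩ U x)
          intro y hy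
          obtain ⟨x, hx⟩ := mem_iUnion.1 (ht (mem_univ y))
          obtain ⟨hxt, hyx⟩ := mem_iUnion.1 hx
          exact mem_iUnion₂.2 ⟨x, hxt, hy, hyx⟩
      _ ≤ ∑ x ∈ t, chartVolume h x (B ∩ U x) := by
          refine Finset.sum_le_sum fun x _ => ?_
          have hm : MeasurableSet (B ∩ U x) := hB.inter (hUo x).measurableSet
          rw [chartVolume_eq_inter_source h x' hm, chartVolume_eq_of_subset h x' x (hm.inter hV)
            inter_subset_right (fun y hy => hUs x hy.1.2)]
          exact measure_mono inter_subset_left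
      _ = μ B := by
          rw [hμ, Measure.finsetSum_apply]
          exact Finset.sum_congr rfl fun x _ => (Measure.restrict_apply hB).symm
  refine ⟨(hle univ).trans_lt ?_⟩
  rw [hμ, Measure.finsetSum_apply]
  refine ENNReal.sum_lt_top.2 fun x _ => ?_
  rw [Measure.restrict_apply MeasurableSet.univ, univ_inter]
  exact hUfin x

end Volume
end RiemannianCone

namespace RiemannianCone

open MeasureTheory Set Filter

/-! ### Test functions, the divergence theorem and dilations on the cone -/

section TestFunctions
set_option linter.unusedSectionVars false

variable {d : ℕ} {H : Type*} [TopologicalSpace H] {I : ModelWithCorners ℝ (Coord d) H}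
  {Y : Type*} [TopologicalSpace Y] [ChartedSpace H Y] [IsManifold I ∞ Y]

/-- `u` is supported in `[a, b] × Y`. -/
def StripSupport (a b : ℝ) (u : ℝ × Y → ℂ) : Prop := ∀ p : ℝ × Y, p.1 ∉ Icc a b → u p = 0

/-- Compact support in `(0, ∞) × Y` keeps a positive distance from the tip. The strip is what makes
the factor `r⁻²` of the form harmless. -/
theorem IsTest.exists_strip {S : Set Y} {u : ℝ × Y → ℂ} (hu : IsTest I S u) :
    ∃ a b : ℝ, 0 < a ∧ StripSupport a b u := by
  have hK : IsCompact (Prod.fst '' tsupport u) := hu.hasCompactSupport.image continuous_fst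
  rcases (Prod.fst '' tsupport u).eq_empty_or_nonempty with he | hne
  · refine ⟨1, 1, one_pos, fun p _ => image_eq_zero_of_notMem_tsupport fun hp => ?_⟩
    have : p.1 ∈ Prod.fst '' tsupport u := mem_image_of_mem _ hp
    rw [he] at this
    exact this
  · obtain ⟨a, ha⟩ := hK.exists_isLeast hne
    obtain ⟨b, hb⟩ := hK.exists_isGreatest hne
    obtain ⟨q, hq, hqa⟩ := ha.1
    refine ⟨a, b, hqa ▸ (hu.tsupport_subset hq).1, fun p hp => ?_⟩
    refine image_eq_zero_of_notMem_tsupport fun hps => hp ?_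
    exact ⟨ha.2 (mem_image_of_mem _ hps), hb.2 (mem_image_of_mem _ hps)⟩

theorem contDiff_radial {u : ℝ × Y → ℂ} (hu : ContMDiff (𝓘(ℝ, ℝ).prod I) 𝓘(ℝ, ℂ) ∞ u) (y : Y) :
    ContDiff ℝ ∞ fun s : ℝ => u (s, y) :=
  contMDiff_iff_contDiff.1 (hu.comp (contMDiff_id.prodMk contMDiff_const))

theorem hasDerivAt_radial {u : ℝ × Y → ℂ} (hu : ContMDiff (𝓘(ℝ, ℝ).prod I) 𝓘(ℝ, ℂ) ∞ u)
    (p : ℝ × Y) : HasDerivAt (fun s : ℝ => u (s, p.2)) (radialDeriv u p) p.1 :=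
  ((contDiff_radial hu p.2).differentiable (by simp)).differentiableAt.hasDerivAt

theorem mdifferentiable_link {u : ℝ × Y → ℂ} (hu : ContMDiff (𝓘(ℝ, ℝ).prod I) 𝓘(ℝ, ℂ) ∞ u)
    (r : ℝ) : MDifferentiable I 𝓘(ℝ, ℂ) fun y => u (r, y) :=
  (hu.comp (contMDiff_const.prodMk contMDiff_id)).mdifferentiable (by simp)

/-- Joint continuity is obtained by differentiating a smooth family of functions of `r`, with the
point of the cone as parameter. -/
theorem continuous_radialDeriv {u : ℝ × Y → ℂ} (hu : ContMDiff (𝓘(ℝ, ℝ).prod I) 𝓘(ℝ, ℂ) ∞ u) :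
    Continuous (radialDeriv u) := by
  rw [continuous_iff_continuousAt]
  intro p
  have h1 : ContMDiffAt (𝓘(ℝ, ℝ).prod I) 𝓘(ℝ, ℝ →L[ℝ] ℂ) 0
      (inTangentCoordinates 𝓘(ℝ, ℝ) 𝓘(ℝ, ℂ) (fun q : ℝ × Y => q.1) (fun q => u (q.1, q.2))
        (fun q => mfderiv 𝓘(ℝ, ℝ) 𝓘(ℝ, ℂ) (fun s => u (s, q.2)) q.1) p) p := by
    refine ContMDiffAt.mfderiv (n := 1) (fun (q : ℝ × Y) s => u (s, q.2)) (fun q => q.1) ?_ ?_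
      (by simp)
    · have : ContMDiff ((𝓘(ℝ, ℝ).prod I).prod 𝓘(ℝ, ℝ)) 𝓘(ℝ, ℂ) 1
          (Function.uncurry fun (q : ℝ × Y) s => u (s, q.2)) :=
        (hu.of_le (by simp)).comp (contMDiff_snd.prodMk (contMDiff_snd.comp contMDiff_fst))
      exact this.contMDiffAt
    · exact contMDiffAt_fst
  have h2 := h1.continuousAt.clm_apply (continuousAt_const (y := (1 : ℝ)))
  refine h2.congr (Eventually.of_forall fun q => ?_)
  have h3 := congrFun (inTangentCoordinates_model_space (I := 𝓘(ℝ, ℝ)) (I' := 𝓘(ℝ, ℂ))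
    (fun q : ℝ × Y => q.1) (fun q => u (q.1, q.2))
    (fun q => fderiv ℝ (fun s => u (s, q.2)) q.1) p) q
  have h4 := congrArg (fun L : ℝ →L[ℝ] ℂ => L 1) h3
  simp only [mfderiv_eq_fderiv]
  refine h4.trans ?_
  rw [radialDeriv]
  exact fderiv_apply_one_eq_deriv

theorem StripSupport.radialDeriv {a b : ℝ} {u : ℝ × Y → ℂ} (hu : StripSupport a b u) :
    StripSupport a b (radialDeriv u) := by
  intro p hp
  have h1 : (fun s : ℝ => u (s, p.2)) =ᶠ[𝓝 p.1] fun _ => 0 := by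
    filter_upwards [isClosed_Icc.isOpen_compl.mem_nhds hp] with s hs using hu (s, p.2) hs
  rw [RiemannianCone.radialDeriv, h1.deriv_eq]
  simp

theorem linkDeriv_eq_zero {u : ℝ × Y → ℂ} {p : ℝ × Y} (hu : ∀ y, u (p.1, y) = 0) :
    linkDeriv I u p = 0 := by
  have h1 : (fun y => u (p.1, y)) = fun _ => 0 := funext hu
  funext v
  rw [linkDeriv, h1, mfderiv_const]
  rfl

theorem covectorInner_zero_left (h : Metric I Y) (y : Y) (β : TangentSpace I y → ℂ) :
    covectorInner h y 0 β = 0 := by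
  refine Finset.sum_eq_zero fun i _ => Finset.sum_eq_zero fun j _ => ?_
  change _ * (0 : ℂ) * _ = 0
  ring

theorem matrixPairing_add_left (G : Matrix (Fin d) (Fin d) ℝ) (a a' b : Fin d → ℂ) :
    matrixPairing G (a + a') b = matrixPairing G a b + matrixPairing G a' b := by
  simp only [matrixPairing, Pi.add_apply, mul_add, add_mul, Finset.sum_add_distrib]

theorem matrixPairing_smul_left (G : Matrix (Fin d) (Fin d) ℝ) (c : ℂ) (a b : Fin d → ℂ) :
    matrixPairing G (c • a) b = c * matrixPairing G a b := by
  simp only [matrixPairing, Pi.smul_apply, smul_eq_mul, Finset.mul_sum]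
  refine Finset.sum_congr rfl fun i _ => Finset.sum_congr rfl fun j _ => ?_
  ring

theorem matrixPairing_smul_right (G : Matrix (Fin d) (Fin d) ℝ) (c : ℂ) (a b : Fin d → ℂ) :
    matrixPairing G a (c • b) = (starRingEnd ℂ) c * matrixPairing G a b := by
  simp only [matrixPairing, Pi.smul_apply, smul_eq_mul, Finset.mul_sum, map_mul]
  refine Finset.sum_congr rfl fun i _ => Finset.sum_congr rfl fun j _ => ?_
  ring

theorem covectorInner_add_left (h : Metric I Y) (y : Y) (α α' β : TangentSpace I y → ℂ) :
    covectorInner h y (α + α') β = covectorInner h y α β + covectorInner h y α' β :=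
  matrixPairing_add_left _ _ _ _

theorem covectorInner_smul_left (h : Metric I Y) (y : Y) (c : ℂ) (α β : TangentSpace I y → ℂ) :
    covectorInner h y (c • α) β = c * covectorInner h y α β :=
  matrixPairing_smul_left _ _ _ _

theorem covectorInner_smul_right (h : Metric I Y) (y : Y) (c : ℂ) (α β : TangentSpace I y → ℂ) :
    covectorInner h y α (c • β) = (starRingEnd ℂ) c * covectorInner h y α β :=
  matrixPairing_smul_right _ _ _ _

theorem radialDeriv_add {u v : ℝ × Y → ℂ} (hu : ContMDiff (𝓘(ℝ, ℝ).prod I) 𝓘(ℝ, ℂ) ∞ u)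
    (hv : ContMDiff (𝓘(ℝ, ℝ).prod I) 𝓘(ℝ, ℂ) ∞ v) (p : ℝ × Y) :
    radialDeriv (u + v) p = radialDeriv u p + radialDeriv v p :=
  ((hasDerivAt_radial hu p).add (hasDerivAt_radial hv p)).deriv

theorem radialDeriv_smul (c : ℂ) (u : ℝ × Y → ℂ) (p : ℝ × Y) :
    radialDeriv (c • u) p = c * radialDeriv u p :=
  deriv_const_mul_field c

theorem linkDeriv_add {u v : ℝ × Y → ℂ} (hu : ContMDiff (𝓘(ℝ, ℝ).prod I) 𝓘(ℝ, ℂ) ∞ u)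
    (hv : ContMDiff (𝓘(ℝ, ℝ).prod I) 𝓘(ℝ, ℂ) ∞ v) (p : ℝ × Y) :
    linkDeriv I (u + v) p = linkDeriv I u p + linkDeriv I v p := by
  funext w
  have h := mfderiv_add (mdifferentiable_link hu p.1 p.2) (mdifferentiable_link hv p.1 p.2)
  exact congrArg (fun L : Coord d →L[ℝ] ℂ => L w) h

theorem linkDeriv_const_smul {u : ℝ × Y → ℂ} (hu : ContMDiff (𝓘(ℝ, ℝ).prod I) 𝓘(ℝ, ℂ) ∞ u)
    (c : ℂ) (p : ℝ × Y) : linkDeriv I (c • u) p = c • linkDeriv I u p := by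
  funext w
  have h1 := (mdifferentiable_link hu p.1 p.2).hasMFDerivAt
  have h2 : HasMFDerivAt I 𝓘(ℝ, ℂ) (fun y => c * u (p.1, y)) p.2
      ((ContinuousLinearMap.mul ℝ ℂ c).comp (mfderiv I 𝓘(ℝ, ℂ) (fun y => u (p.1, y)) p.2)) :=
    ((ContinuousLinearMap.mul ℝ ℂ c).hasMFDerivAt).comp p.2 h1
  exact congrArg (fun L : Coord d →L[ℝ] ℂ => L w) h2.mfderiv

theorem IsTest.zero (S : Set Y) : IsTest I S (0 : ℝ × Y → ℂ) where
  contMDiff := contMDiff_const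
  hasCompactSupport := HasCompactSupport.zero
  tsupport_subset := by simp [tsupport]

theorem IsTest.add {S : Set Y} {u v : ℝ × Y → ℂ} (hu : IsTest I S u) (hv : IsTest I S v) :
    IsTest I S (u + v) where
  contMDiff := hu.contMDiff.add hv.contMDiff
  hasCompactSupport := hu.hasCompactSupport.add hv.hasCompactSupport
  tsupport_subset := (tsupport_add u v).trans (union_subset hu.tsupport_subset hv.tsupport_subset)

theorem IsTest.const_smul {S : Set Y} {u : ℝ × Y → ℂ} (hu : IsTest I S u) (c : ℂ) :
    IsTest I S (c • u) where
  contMDiff := ((ContinuousLinearMap.mul ℝ ℂ c).contDiff (n := ∞)).contMDiff.comp hu.contMDiff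
  hasCompactSupport := hu.hasCompactSupport.smul_left (f := fun _ => c)
  tsupport_subset := (tsupport_smul_subset_right (fun _ => c) u).trans hu.tsupport_subset

/-- Multiplication by a smooth radial function. -/
theorem IsTest.radial_mul {S : Set Y} {u : ℝ × Y → ℂ} (hu : IsTest I S u) {g : ℝ → ℂ}
    (hg : ContDiff ℝ ∞ g) : IsTest I S fun p => g p.1 * u p where
  contMDiff := by
    have : ContMDiff (𝓘(ℝ, ℝ).prod I) 𝓘(ℝ, ℂ) ∞ fun p : ℝ × Y => g p.1 :=
      hg.contMDiff.comp contMDiff_fst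
    exact (contDiff_mul (𝕜 := ℝ) (n := ∞) (𝔸 := ℂ)).contMDiff.comp (this.prodMk_space hu.contMDiff)
  hasCompactSupport := hu.hasCompactSupport.smul_left (f := fun p : ℝ × Y => g p.1)
  tsupport_subset :=
    (tsupport_smul_subset_right (fun p : ℝ × Y => g p.1) u).trans hu.tsupport_subset

/-- The dilation `(r, y) ↦ (ρ r, y)` of the cone. -/
def dilate (Y : Type*) (ρ : ℝ) (p : ℝ × Y) : ℝ × Y := (ρ * p.1, p.2)

theorem IsTest.comp_dilate {S : Set Y} {u : ℝ × Y → ℂ} (hu : IsTest I S u) {ρ : ℝ} (hρ : 0 < ρ) :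
    IsTest I S fun p => u (dilate Y ρ p) := by
  set e : ℝ × Y ≃ₜ ℝ × Y := (Homeomorph.mulLeft₀ ρ hρ.ne').prodCongr (Homeomorph.refl Y) with he
  have heq : (fun p => u (dilate Y ρ p)) = u ∘ e := rfl
  refine ⟨?_, ?_, ?_⟩
  · have h1 : ContMDiff (𝓘(ℝ, ℝ).prod I) 𝓘(ℝ, ℝ) ∞ fun p : ℝ × Y => ρ * p.1 :=
      ((contDiff_const.mul contDiff_id : ContDiff ℝ ∞ fun r : ℝ => ρ * r).contMDiff).comp
        contMDiff_fst
    exact hu.contMDiff.comp (h1.prodMk contMDiff_snd)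
  · rw [heq]
    exact hu.hasCompactSupport.comp_homeomorph e
  · rw [heq, tsupport_comp_eq_preimage]
    intro p hp
    obtain ⟨h1, h2⟩ := hu.tsupport_subset hp
    exact ⟨(mul_pos_iff_of_pos_left hρ).1 h1, h2⟩

theorem radialDeriv_comp_dilate {u : ℝ × Y → ℂ}
    (hu : ContMDiff (𝓘(ℝ, ℝ).prod I) 𝓘(ℝ, ℂ) ∞ u) (ρ : ℝ) (p : ℝ × Y) :
    radialDeriv (fun p => u (dilate Y ρ p)) p = ρ * radialDeriv u (dilate Y ρ p) := by
  have h1 := (hasDerivAt_radial hu (dilate Y ρ p)).scomp p.1 ((hasDerivAt_id p.1).const_mul ρ)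
  refine h1.deriv.trans ?_
  simp

theorem radialDeriv_radial_mul {u : ℝ × Y → ℂ}
    (hu : ContMDiff (𝓘(ℝ, ℝ).prod I) 𝓘(ℝ, ℂ) ∞ u) {g : ℝ → ℂ} {g' : ℂ} {p : ℝ × Y}
    (hg : HasDerivAt g g' p.1) :
    radialDeriv (fun p => g p.1 * u p) p = g' * u p + g p.1 * radialDeriv u p :=
  (hg.mul (hasDerivAt_radial hu p)).deriv

theorem linkDeriv_radial_mul {u : ℝ × Y → ℂ}
    (hu : ContMDiff (𝓘(ℝ, ℝ).prod I) 𝓘(ℝ, ℂ) ∞ u) (g : ℝ → ℂ) (p : ℝ × Y) :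
    linkDeriv I (fun p => g p.1 * u p) p = g p.1 • linkDeriv I u p :=
  linkDeriv_const_smul hu (g p.1) p

variable [MeasurableSpace Y] [BorelSpace Y] [CompactSpace Y] (h : Metric I Y)

instance : IsFiniteMeasure (riemannianVolume h) := isFiniteMeasure_riemannianVolume h

/-- The measure `r^d dr` on `(0, ∞)`. -/
def radialMeasure (d : ℕ) : Measure ℝ :=
  (volume.restrict (Ioi (0 : ℝ))).withDensity fun r => ENNReal.ofReal (r ^ d)

instance : SFinite (radialMeasure d) := by unfold radialMeasure; infer_instance

theorem coneMeasure_eq : coneMeasure h = (radialMeasure d).prod (riemannianVolume h) := rfl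

theorem coneMeasure_strip_lt_top (a b : ℝ) : coneMeasure h (Icc a b ×ˢ univ) < ⊤ := by
  rw [coneMeasure, Measure.prod_prod, withDensity_apply _ measurableSet_Icc]
  refine ENNReal.mul_lt_top ?_ (measure_lt_top _ _)
  rw [Measure.restrict_restrict measurableSet_Icc]
  refine (lintegral_mono_set inter_subset_left).trans_lt ?_
  have h1 : IntegrableOn (fun r : ℝ => r ^ d) (Icc a b) :=
    (continuous_pow d).continuousOn.integrableOn_compact isCompact_Icc
  exact (lintegral_ofReal_le_lintegral_enorm _).trans_lt h1.2

/-- Strip-supported functions which are continuous for `r > 0` are integrable. -/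
theorem integrable_of_strip {f : ℝ × Y → ℂ} {a b : ℝ} (ha : 0 < a) (hs : StripSupport a b f)
    (hf : ContinuousOn f (Ioi 0 ×ˢ univ)) : Integrable f (coneMeasure h) := by
  have hK : IsCompact (Icc a b ×ˢ (univ : Set Y)) := isCompact_Icc.prod isCompact_univ
  have hKm : MeasurableSet (Icc a b ×ˢ (univ : Set Y)) := measurableSet_Icc.prod MeasurableSet.univ
  have hfK : ContinuousOn f (Icc a b ×ˢ univ) :=
    hf.mono (prod_mono (fun r hr => ha.trans_le hr.1) subset_rfl)
  obtain ⟨C, hC⟩ := hK.exists_bound_of_continuousOn hfK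
  have h1 : IntegrableOn f (Icc a b ×ˢ univ) (coneMeasure h) := by
    refine ⟨hfK.aestronglyMeasurable hKm, ?_⟩
    exact HasFiniteIntegral.restrict_of_bounded C (coneMeasure_strip_lt_top h a b)
      ((ae_restrict_iff' hKm).2 (Eventually.of_forall hC))
  refine (integrableOn_iff_integrable_of_support_subset ?_).1 h1
  intro p hp
  by_contra hn
  exact hp (hs p fun hh => hn ⟨hh, mem_univ _⟩)

theorem integral_radialMeasure (g : ℝ → ℂ) :
    ∫ r, g r ∂(radialMeasure d) = ∫ r in Ioi (0 : ℝ), ((r ^ d : ℝ) : ℂ) * g r := by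
  rw [radialMeasure, integral_withDensity_eq_integral_toReal_smul₀ (by fun_prop)
    (Eventually.of_forall fun _ => ENNReal.ofReal_lt_top)]
  refine setIntegral_congr_fun measurableSet_Ioi fun r hr => ?_
  have : (0 : ℝ) ≤ r ^ d := pow_nonneg (le_of_lt hr) d
  simp [ENNReal.toReal_ofReal this]

/-- The divergence theorem for radial vector fields. -/
theorem integral_radial_divergence {k k' : ℝ × Y → ℂ} {a b : ℝ} (ha : 0 < a)
    (hs : StripSupport a b k) (hk : Continuous k) (hk' : Continuous k')
    (hd : ∀ p : ℝ × Y, HasDerivAt (fun s => k (s, p.2)) (k' p) p.1) :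
    ∫ p, (p.1 * k' p + (d + 1) * k p) ∂(coneMeasure h) = 0 := by
  have hk's : StripSupport a b k' := fun p hp => by
    have h1 : (fun s : ℝ => k (s, p.2)) =ᶠ[𝓝 p.1] fun _ => 0 := by
      filter_upwards [isClosed_Icc.isOpen_compl.mem_nhds hp] with s hs' using hs (s, p.2) hs'
    rw [← (hd p).deriv, h1.deriv_eq, deriv_const]
  have hint : Integrable (fun p : ℝ × Y => p.1 * k' p + (d + 1) * k p) (coneMeasure h) := by
    refine integrable_of_strip h (a := a) (b := b) ha (fun p hp => ?_) (Continuous.continuousOn ?_)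
    · rw [hs p hp, hk's p hp]; ring
    · exact ((Complex.continuous_ofReal.comp continuous_fst).mul hk').add (continuous_const.mul hk)
  rw [coneMeasure_eq] at hint ⊢
  rw [integral_prod_symm _ hint]
  refine integral_eq_zero_of_ae (Eventually.of_forall fun y => ?_)
  change ∫ r, _ ∂(radialMeasure d) = 0
  rw [integral_radialMeasure]
  -- `r^{d+1} k` is a primitive of `r^d (r k' + (d + 1) k)`; the integrand is the divergence of the
  -- field `k r ∂_r`.
  set g : ℝ → ℂ := fun r => ((r ^ (d + 1) : ℝ) : ℂ) * k (r, y) with hg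
  have hgd : ∀ r, HasDerivAt g (((r ^ d : ℝ) : ℂ) * (r * k' (r, y) + (d + 1) * k (r, y))) r := by
    intro r
    have h1 : HasDerivAt (fun r : ℝ => ((r ^ (d + 1) : ℝ) : ℂ)) (((d + 1 : ℕ) * r ^ d : ℝ) : ℂ) r :=
      (hasDerivAt_pow (d + 1) r).ofReal_comp
    refine (h1.mul (hd (r, y))).congr_deriv ?_
    push_cast
    ring
  have hz : ∀ r, r ∉ Icc a b → g r = 0 := fun r hr => by simp [hg, hs (r, y) hr]
  have hcont : Continuous fun r : ℝ =>
      ((r ^ d : ℝ) : ℂ) * (r * k' (r, y) + (d + 1) * k (r, y)) := by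
    have e1 : Continuous fun r : ℝ => k (r, y) := hk.comp (by fun_prop)
    have e2 : Continuous fun r : ℝ => k' (r, y) := hk'.comp (by fun_prop)
    fun_prop
  have hsupp : ∀ r, r ∉ Icc a b →
      ((r ^ d : ℝ) : ℂ) * (r * k' (r, y) + (d + 1) * k (r, y)) = 0 := fun r hr => by
    rw [hs (r, y) hr, hk's (r, y) hr]; ring
  have hI : IntegrableOn (fun r : ℝ =>
      ((r ^ d : ℝ) : ℂ) * (r * k' (r, y) + (d + 1) * k (r, y))) (Ioi 0) := by
    refine (hcont.integrable_of_hasCompactSupport ?_).integrableOn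
    exact HasCompactSupport.intro isCompact_Icc hsupp
  have htop : Tendsto g atTop (𝓝 0) := by
    refine tendsto_const_nhds.congr' ?_
    filter_upwards [eventually_gt_atTop b] with r hr
    exact (hz r fun hh => absurd hh.2 (not_le.2 hr)).symm
  have := integral_Ioi_of_hasDerivAt_of_tendsto (a := 0) (f := g) (m := 0)
    (hgd 0).continuousAt.continuousWithinAt (fun r _ => hgd r) hI htop
  rw [this, hz 0 fun hh => absurd hh.1 (not_le.2 ha), sub_zero]

/-- The exponent `d + 1` collects `d` from the density and `1` from Lebesgue measure. -/
theorem map_mul_radialMeasure {ρ : ℝ} (hρ : 0 < ρ) :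
    Measure.map (fun r => ρ * r) (radialMeasure d) =
      ENNReal.ofReal (ρ⁻¹ ^ (d + 1)) • radialMeasure d := by
  ext s hs
  have hm : Measurable fun r : ℝ => ρ * r := measurable_const_mul ρ
  rw [Measure.map_apply hm hs, Measure.smul_apply, radialMeasure, withDensity_apply _ (hm hs),
    withDensity_apply _ hs, smul_eq_mul, Measure.restrict_restrict (hm hs),
    Measure.restrict_restrict hs]
  have h0 : (fun r : ℝ => ρ * r) ⁻¹' s ∩ Ioi 0 = (fun r : ℝ => ρ * r) ⁻¹' (s ∩ Ioi 0) := by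
    ext r
    simp [mul_pos_iff_of_pos_left hρ]
  have hsm : MeasurableSet (s ∩ Ioi (0 : ℝ)) := hs.inter measurableSet_Ioi
  have hme : Measurable fun r : ℝ => ENNReal.ofReal (r ^ d) := by fun_prop
  have h1 : ∫⁻ r in s ∩ Ioi 0, ENNReal.ofReal (r ^ d) ∂(Measure.map (fun r => ρ * r) volume) =
      ∫⁻ r in (fun r : ℝ => ρ * r) ⁻¹' (s ∩ Ioi 0), ENNReal.ofReal ((ρ * r) ^ d) :=
    setLIntegral_map hsm hme hm
  rw [Real.map_volume_mul_left hρ.ne', Measure.restrict_smul, lintegral_smul_measure,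
    smul_eq_mul, abs_of_pos (inv_pos.2 hρ)] at h1
  have h2 : ∀ r : ℝ, ENNReal.ofReal (r ^ d) =
      ENNReal.ofReal (ρ⁻¹ ^ d) * ENNReal.ofReal ((ρ * r) ^ d) := fun r => by
    rw [← ENNReal.ofReal_mul (by positivity), ← mul_pow, inv_mul_cancel_left₀ hρ.ne']
  rw [h0, lintegral_congr (μ := volume.restrict ((fun r : ℝ => ρ * r) ⁻¹' (s ∩ Ioi 0))) h2,
    lintegral_const_mul _ (by fun_prop), ← h1, ← mul_assoc, ← ENNReal.ofReal_mul (by positivity),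
    ← pow_succ]

/-- The change of variables under dilations. -/
theorem map_dilate_coneMeasure {ρ : ℝ} (hρ : 0 < ρ) :
    Measure.map (dilate Y ρ) (coneMeasure h) = ENNReal.ofReal (ρ⁻¹ ^ (d + 1)) • coneMeasure h := by
  have h1 := Measure.map_prod_map (radialMeasure d) (riemannianVolume h)
    (measurable_const_mul ρ) measurable_id
  rw [Measure.map_id, map_mul_radialMeasure hρ, Measure.prod_smul_left] at h1
  exact h1.symm

end TestFunctions
end RiemannianCone

namespace RiemannianCone

open MeasureTheory Set Filter

/-! ### Form domains and the Friedrichs Laplacian -/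

section FormDomain
set_option linter.unusedSectionVars false

variable {d : ℕ} {H : Type*} [TopologicalSpace H] {I : ModelWithCorners ℝ (Coord d) H}
  {Y : Type*} [TopologicalSpace Y] [ChartedSpace H Y] [IsManifold I ∞ Y]

/-- The density of the form of `-Δ + κ r² + 1`. -/
def formDensity (h : Metric I Y) (κ : ℝ) (u v : ℝ × Y → ℂ) (p : ℝ × Y) : ℂ :=
  radialDeriv u p * (starRingEnd ℂ) (radialDeriv v p)
    + (((p.1 ^ 2)⁻¹ : ℝ) : ℂ) * covectorInner h p.2 (linkDeriv I u p) (linkDeriv I v p)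
    + ((κ * p.1 ^ 2 + 1 : ℝ) : ℂ) * (u p * (starRingEnd ℂ) (v p))

variable (h : Metric I Y) (κ : ℝ)

theorem formDensity_conj (u v : ℝ × Y → ℂ) (p : ℝ × Y) :
    (starRingEnd ℂ) (formDensity h κ u v p) = formDensity h κ v u p := by
  simp only [formDensity, map_add, map_mul, Complex.conj_conj, Complex.conj_ofReal,
    covectorInner_conj]
  ring

theorem formDensity_add_left {u u' : ℝ × Y → ℂ} (v : ℝ × Y → ℂ)
    (hu : ContMDiff (𝓘(ℝ, ℝ).prod I) 𝓘(ℝ, ℂ) ∞ u) (hu' : ContMDiff (𝓘(ℝ, ℝ).prod I) 𝓘(ℝ, ℂ) ∞ u')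
    (p : ℝ × Y) : formDensity h κ (u + u') v p = formDensity h κ u v p + formDensity h κ u' v p := by
  simp only [formDensity, radialDeriv_add hu hu', linkDeriv_add hu hu', covectorInner_add_left,
    Pi.add_apply]
  ring

theorem formDensity_smul_left {u : ℝ × Y → ℂ} (v : ℝ × Y → ℂ)
    (hu : ContMDiff (𝓘(ℝ, ℝ).prod I) 𝓘(ℝ, ℂ) ∞ u) (c : ℂ) (p : ℝ × Y) :
    formDensity h κ (c • u) v p = c * formDensity h κ u v p := by
  simp only [formDensity, radialDeriv_smul, linkDeriv_const_smul hu, covectorInner_smul_left,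
    Pi.smul_apply, smul_eq_mul]
  ring

theorem formDensity_self_re (u : ℝ × Y → ℂ) (p : ℝ × Y) :
    (formDensity h κ u u p).re = ‖radialDeriv u p‖ ^ 2
      + (p.1 ^ 2)⁻¹ * (covectorInner h p.2 (linkDeriv I u p) (linkDeriv I u p)).re
      + (κ * p.1 ^ 2 + 1) * ‖u p‖ ^ 2 := by
  simp only [formDensity, Complex.add_re, Complex.mul_conj, Complex.re_ofReal_mul,
    Complex.ofReal_re, Complex.normSq_eq_norm_sq]

theorem norm_sq_le_formDensity_self (hκ : 0 ≤ κ) (u : ℝ × Y → ℂ) (p : ℝ × Y) :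
    ‖u p‖ ^ 2 ≤ (formDensity h κ u u p).re := by
  rw [formDensity_self_re]
  have h1 := mul_nonneg (inv_nonneg.2 (sq_nonneg p.1))
    (covectorInner_self_nonneg h p.2 (linkDeriv I u p))
  have h2 := mul_nonneg (mul_nonneg hκ (sq_nonneg p.1)) (sq_nonneg ‖u p‖)
  nlinarith [sq_nonneg ‖radialDeriv u p‖]

theorem continuousOn_formDensity {u v : ℝ × Y → ℂ}
    (hu : ContMDiff (𝓘(ℝ, ℝ).prod I) 𝓘(ℝ, ℂ) ∞ u) (hv : ContMDiff (𝓘(ℝ, ℝ).prod I) 𝓘(ℝ, ℂ) ∞ v) :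
    ContinuousOn (formDensity h κ u v) (Ioi 0 ×ˢ univ) := by
  have h1 := continuous_radialDeriv hu
  have h2 := continuous_radialDeriv hv
  have h3 := continuous_covectorInner_linkDeriv h hu hv
  have h4 := hu.continuous
  have h5 := hv.continuous
  have h6 : ContinuousOn (fun p : ℝ × Y => (((p.1 ^ 2)⁻¹ : ℝ) : ℂ)) (Ioi 0 ×ˢ univ) := by
    refine Complex.continuous_ofReal.comp_continuousOn (ContinuousOn.inv₀ (by fun_prop) ?_)
    rintro p ⟨hp, -⟩
    exact pow_ne_zero 2 (ne_of_gt hp)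
  have h7 : Continuous fun p : ℝ × Y => ((κ * p.1 ^ 2 + 1 : ℝ) : ℂ) := by fun_prop
  exact ((h1.mul (Complex.continuous_conj.comp h2)).continuousOn.add
    (h6.mul h3.continuousOn)).add (h7.mul (h4.mul (Complex.continuous_conj.comp h5))).continuousOn

theorem StripSupport.formDensity {a b : ℝ} {u : ℝ × Y → ℂ} (hu : StripSupport a b u)
    (v : ℝ × Y → ℂ) : StripSupport a b (formDensity h κ u v) := by
  intro p hp
  rw [RiemannianCone.formDensity, hu p hp, hu.radialDeriv p hp,
    linkDeriv_eq_zero fun y => hu (p.1, y) hp, covectorInner_zero_left]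
  ring

variable [MeasurableSpace Y] [BorelSpace Y] [CompactSpace Y]

theorem IsTest.integrable_formDensity {S : Set Y} {u v : ℝ × Y → ℂ} (hu : IsTest I S u)
    (hv : IsTest I S v) : Integrable (formDensity h κ u v) (coneMeasure h) := by
  obtain ⟨a, b, ha, hs⟩ := hu.exists_strip
  exact integrable_of_strip h ha (hs.formDensity h κ v)
    (continuousOn_formDensity h κ hu.contMDiff hv.contMDiff)

/-- Test functions are square integrable. -/
theorem IsTest.memLp {S : Set Y} {u : ℝ × Y → ℂ} (hu : IsTest I S u) :
    MemLp u 2 (coneMeasure h) := by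
  obtain ⟨a, b, ha, hs⟩ := hu.exists_strip
  have hc := hu.contMDiff.continuous
  rw [memLp_two_iff_integrable_sq_norm hc.aestronglyMeasurable]
  have h1 : Integrable (fun p => u p * (starRingEnd ℂ) (u p)) (coneMeasure h) :=
    integrable_of_strip h ha (fun p hp => by rw [hs p hp, zero_mul])
      (hc.mul (Complex.continuous_conj.comp hc)).continuousOn
  refine h1.re.congr (Eventually.of_forall fun p => ?_)
  simp only [Complex.mul_conj, RCLike.re_to_complex, Complex.ofReal_re, Complex.normSq_eq_norm_sq]

variable (I) in
/-- The space of test functions. -/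
def coreSubmodule (S : Set Y) : Submodule ℂ (ℝ × Y → ℂ) where
  carrier := {u | IsTest I S u}
  add_mem' := fun hu hv => IsTest.add hu hv
  zero_mem' := IsTest.zero S
  smul_mem' := fun c _ hu => IsTest.const_smul hu c

/-- The space of test functions, with the inner product of the form of `-Δ + κ r² + 1`. -/
def CoreSpace (_h : Metric I Y) (S : Set Y) (_κ : NNReal) : Type _ := coreSubmodule I S

variable (S : Set Y) (ν : NNReal)

instance : AddCommGroup (CoreSpace h S ν) := inferInstanceAs (AddCommGroup (coreSubmodule I S))

instance : Module ℂ (CoreSpace h S ν) := inferInstanceAs (Module ℂ (coreSubmodule I S))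

/-- A test function, as an element of the core. -/
def CoreSpace.mk {S : Set Y} {u : ℝ × Y → ℂ} (hu : IsTest I S u) : CoreSpace h S ν := ⟨u, hu⟩

variable {h S ν} in
/-- The underlying function. -/
def CoreSpace.toFun (u : CoreSpace h S ν) : ℝ × Y → ℂ := u.1

variable {h S ν} in
theorem CoreSpace.isTest (u : CoreSpace h S ν) : IsTest I S u.toFun := u.2

/-- The pre-inner product of the core. -/
instance CoreSpace.core : PreInnerProductSpace.Core ℂ (CoreSpace h S ν) where
  inner u v := ∫ p, formDensity h ν v.toFun u.toFun p ∂(coneMeasure h)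
  conj_inner_symm u v := by
    rw [← integral_conj]
    simp only [formDensity_conj]
  re_inner_nonneg u := by
    have h1 := integral_re (𝕜 := ℂ) (u.isTest.integrable_formDensity h ν u.isTest)
    refine h1 ▸ integral_nonneg fun p => ?_
    exact (sq_nonneg _).trans (norm_sq_le_formDensity_self h ν ν.2 u.toFun p)
  add_left u v w := by
    rw [← integral_add (w.isTest.integrable_formDensity h ν u.isTest)
      (w.isTest.integrable_formDensity h ν v.isTest)]
    refine integral_congr_ae (Eventually.of_forall fun p => ?_)
    have := congrArg (starRingEnd ℂ)
      (formDensity_add_left h ν w.toFun u.isTest.contMDiff v.isTest.contMDiff p)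
    simp only [map_add, formDensity_conj] at this
    exact this
  smul_left u v c := by
    rw [← integral_const_mul]
    refine integral_congr_ae (Eventually.of_forall fun p => ?_)
    have := congrArg (starRingEnd ℂ)
      (formDensity_smul_left h ν v.toFun u.isTest.contMDiff c p)
    simp only [map_mul, formDensity_conj] at this
    exact this

instance : SeminormedAddCommGroup (CoreSpace h S ν) :=
  InnerProductSpace.Core.toSeminormedAddCommGroup (𝕜 := ℂ)

instance : InnerProductSpace ℂ (CoreSpace h S ν) := InnerProductSpace.ofCore (CoreSpace.core h S ν)

/-- The arguments are exchanged because `inner` is conjugate-linear in the first variable, while the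
form is linear in its first. -/
theorem CoreSpace.inner_def (u v : CoreSpace h S ν) :
    inner ℂ u v = ∫ p, formDensity h ν v.toFun u.toFun p ∂(coneMeasure h) := rfl

/-- The form domain of `-Δ + κ r² + 1`. -/
abbrev FormDomain : Type _ := UniformSpace.Completion (CoreSpace h S ν)

/-- A test function as an element of `L²`. -/
def testL2 {S : Set Y} {u : ℝ × Y → ℂ} (hu : IsTest I S u) : ConeL2 h := (hu.memLp h).toLp u

theorem coeFn_testL2 {S : Set Y} {u : ℝ × Y → ℂ} (hu : IsTest I S u) :
    testL2 h hu =ᵐ[coneMeasure h] u := (hu.memLp h).coeFn_toLp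

theorem inner_testL2 {S : Set Y} {u v : ℝ × Y → ℂ} (hu : IsTest I S u) (hv : IsTest I S v) :
    inner ℂ (testL2 h hu) (testL2 h hv)
      = ∫ p, v p * (starRingEnd ℂ) (u p) ∂(coneMeasure h) := by
  rw [L2.inner_def]
  refine integral_congr_ae ?_
  filter_upwards [coeFn_testL2 h hu, coeFn_testL2 h hv] with p h1 h2
  rw [h1, h2]
  simp

theorem inner_testL2_left {S : Set Y} {u : ℝ × Y → ℂ} (hu : IsTest I S u) (f : ConeL2 h) :
    inner ℂ (testL2 h hu) f = ∫ p, f p * (starRingEnd ℂ) (u p) ∂(coneMeasure h) := by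
  rw [L2.inner_def]
  refine integral_congr_ae ?_
  filter_upwards [coeFn_testL2 h hu] with p h1
  rw [h1]
  simp

theorem norm_testL2_le (u : CoreSpace h S ν) : ‖testL2 h u.isTest‖ ≤ ‖u‖ := by
  have h1 : ‖testL2 h u.isTest‖ ^ 2 ≤ ‖u‖ ^ 2 := by
    rw [@norm_sq_eq_re_inner ℂ, @norm_sq_eq_re_inner ℂ _ _ _ _ u, inner_testL2,
      CoreSpace.inner_def]
    have hc := u.isTest.contMDiff.continuous
    have hi : Integrable (fun p => u.toFun p * (starRingEnd ℂ) (u.toFun p)) (coneMeasure h) := by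
      obtain ⟨a, b, ha, hs⟩ := u.isTest.exists_strip
      exact integrable_of_strip h ha (fun p hp => by rw [hs p hp, zero_mul])
        (hc.mul (Complex.continuous_conj.comp hc)).continuousOn
    have hi2 := u.isTest.integrable_formDensity h ν u.isTest
    rw [← integral_re hi, ← integral_re hi2]
    refine integral_mono hi.re hi2.re fun p => ?_
    refine le_trans (le_of_eq ?_) (norm_sq_le_formDensity_self h ν ν.2 u.toFun p)
    simp only [Complex.mul_conj, RCLike.re_to_complex, Complex.ofReal_re, Complex.normSq_eq_norm_sq]
  exact le_of_sq_le_sq h1 (norm_nonneg _)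

/-- The inclusion of the core in `L²`. -/
def coreInclusion : CoreSpace h S ν →L[ℂ] ConeL2 h :=
  LinearMap.mkContinuous
    { toFun := fun u => testL2 h u.isTest
      map_add' := fun u v => by
        exact MemLp.toLp_add (u.isTest.memLp h) (v.isTest.memLp h)
      map_smul' := fun c u => by
        exact MemLp.toLp_const_smul c (u.isTest.memLp h) } 1
    fun u => (norm_testL2_le h S ν u).trans_eq (one_mul _).symm

/-- The map of the form domain to `L²`. -/
def formInclusion : FormDomain h S ν →L[ℂ] ConeL2 h :=
  (coreInclusion h S ν).extend UniformSpace.Completion.toComplL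

theorem formInclusion_coe (u : CoreSpace h S ν) :
    formInclusion h S ν (u : FormDomain h S ν) = testL2 h u.isTest :=
  ContinuousLinearMap.extend_eq _ UniformSpace.Completion.denseRange_coe
    (UniformSpace.Completion.isUniformInducing_coe _) u

/-- The summand `1` in the form density dominates the `L²` norm. Injectivity of the map, that is,
closability of the form, is never needed: the operator is read off from `j j*`. -/
theorem norm_formInclusion_le : ‖formInclusion h S ν‖ ≤ 1 := by
  refine ContinuousLinearMap.opNorm_le_bound _ zero_le_one fun v => ?_
  induction v using UniformSpace.Completion.induction_on with
  | hp => exact isClosed_le (by fun_prop) (by fun_prop)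
  | ih u =>
    rw [formInclusion_coe, one_mul, UniformSpace.Completion.norm_coe]
    exact norm_testL2_le h S ν u

/-- The resolvent `(-Δ + κ r² + 1)⁻¹`. -/
abbrev coneResolvent : ConeL2 h →L[ℂ] ConeL2 h := formResolvent (formInclusion h S ν)

theorem isUnitOperator_coneResolvent : IsUnitOperator (coneResolvent h S ν) :=
  isUnitOperator_comp_adjoint (norm_formInclusion_le h S ν)

theorem IsTest.dirichletForm_eq {S : Set Y} {u v : ℝ × Y → ℂ} (hu : IsTest I S u)
    (hv : IsTest I S v) : dirichletForm h u v =
      inner ℂ (CoreSpace.mk h 0 hv) (CoreSpace.mk h 0 hu)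
        - inner ℂ (testL2 h hv) (testL2 h hu) := by
  have hi : Integrable (fun p => u p * (starRingEnd ℂ) (v p)) (coneMeasure h) := by
    obtain ⟨a, b, ha, hs⟩ := hu.exists_strip
    exact integrable_of_strip h ha (fun p hp => by rw [hs p hp, zero_mul])
      (hu.contMDiff.continuous.mul (Complex.continuous_conj.comp
        hv.contMDiff.continuous)).continuousOn
  rw [inner_testL2, CoreSpace.inner_def]
  change _ = (∫ p, formDensity h ((0 : NNReal) : ℝ) u v p ∂(coneMeasure h)) - _
  rw [← integral_sub (hu.integrable_formDensity h _ hv) hi]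
  refine integral_congr_ae (Eventually.of_forall fun p => ?_)
  simp [formDensity]

theorem tendsto_testL2_iff {S : Set Y} {φ : ℕ → ℝ × Y → ℂ} (hφ : ∀ k, IsTest I S (φ k))
    (u : ConeL2 h) : Tendsto (fun k => testL2 h (hφ k)) atTop (𝓝 u) ↔
      Tendsto (fun k => eLpNorm (fun p => φ k p - u p) 2 (coneMeasure h)) atTop (𝓝 0) := by
  rw [Lp.tendsto_Lp_iff_tendsto_eLpNorm']
  refine tendsto_congr fun k => eLpNorm_congr_ae ?_
  filter_upwards [coeFn_testL2 h (hφ k)] with p hp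
  rw [Pi.sub_apply, hp]

/-- The Friedrichs Laplacian in terms of the resolvent of its form. -/
theorem isFriedrichsLaplacian_iff (bc : BoundaryCondition) (u f : ConeL2 h) :
    IsFriedrichsLaplacian h bc u f ↔ u = coneResolvent h (bc.region I Y) 0 (u - f) := by
  set S := bc.region I Y
  set j := formInclusion h S 0 with hj
  have hadj : ∀ {ψ : ℝ × Y → ℂ} (hψ : IsTest I S ψ) (g : ConeL2 h),
      inner ℂ (CoreSpace.mk h 0 hψ : FormDomain h S 0) (ContinuousLinearMap.adjoint j g)
        = inner ℂ (testL2 h hψ) g := fun hψ g => by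
    rw [ContinuousLinearMap.adjoint_inner_right, formInclusion_coe]
    rfl
  constructor
  · rintro ⟨φ, hφ, hL, hC, hq⟩
    rw [← tendsto_testL2_iff h hφ] at hL
    set e : ℕ → FormDomain h S 0 := fun k => (CoreSpace.mk h 0 (hφ k) : FormDomain h S 0) with he
    -- A sequence that is Cauchy for the Dirichlet form and in `L²` is Cauchy for the sum, the form
    -- norm.
    have hcau : CauchySeq e := by
      have hLc := hL.cauchySeq
      rw [Metric.cauchySeq_iff] at hLc ⊢
      intro ε hε
      obtain ⟨N, hN⟩ := hLc (ε / 2) (by positivity)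
      obtain ⟨M, hM⟩ := hC (ε ^ 2 / 2) (by positivity)
      refine ⟨max N M, fun k hk l hl => ?_⟩
      have h1 := hN k (le_of_max_le_left hk) l (le_of_max_le_left hl)
      have h2 := hM k (le_of_max_le_right hk) l (le_of_max_le_right hl)
      have hsub : IsTest I S (φ k - φ l) := (coreSubmodule I S).sub_mem (hφ k) (hφ l)
      rw [hsub.dirichletForm_eq h hsub, Complex.sub_re] at h2
      have e1 : e k - e l = (CoreSpace.mk h 0 hsub : FormDomain h S 0) :=
        (UniformSpace.Completion.coe_sub _ _).symm
      have e2 : testL2 h (hφ k) - testL2 h (hφ l) = testL2 h hsub :=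
        (MemLp.toLp_sub ((hφ k).memLp h) ((hφ l).memLp h)).symm
      rw [dist_eq_norm, e2] at h1
      rw [dist_eq_norm, e1, UniformSpace.Completion.norm_coe]
      have h3 := @norm_sq_eq_re_inner ℂ _ _ _ _ (CoreSpace.mk h 0 hsub)
      have h4 := @norm_sq_eq_re_inner ℂ _ _ _ _ (testL2 h hsub)
      simp only [RCLike.re_to_complex] at h3 h4
      rw [← h3, ← h4] at h2
      refine lt_of_pow_lt_pow_left₀ 2 hε.le ?_
      nlinarith [norm_nonneg (testL2 h hsub)]
    obtain ⟨x, hx⟩ := cauchySeq_tendsto_of_complete hcau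
    have hjx : j x = u := by
      refine tendsto_nhds_unique ((j.continuous.tendsto x).comp hx) ?_
      refine hL.congr fun k => ?_
      exact (formInclusion_coe h S 0 (CoreSpace.mk h 0 (hφ k))).symm
    -- The weak equation says that `x` and `j* (u - f)` have the same pairing with every core
    -- function, and the core is dense.
    have hxe : x = ContinuousLinearMap.adjoint j (u - f) := by
      refine ext_inner_left ℂ fun v => ?_
      induction v using UniformSpace.Completion.induction_on with
      | hp => exact isClosed_eq (by fun_prop) (by fun_prop)
      | ih ψ =>
        obtain ⟨ψ, hψ⟩ : ∃ (ψ' : ℝ × Y → ℂ) (hψ : IsTest I S ψ'), ψ = CoreSpace.mk h 0 hψ :=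
          ⟨ψ.toFun, ψ.isTest, rfl⟩
        obtain ⟨hψ, rfl⟩ := hψ
        rw [hadj hψ]
        have h1 : Tendsto (fun k => inner ℂ (CoreSpace.mk h 0 hψ : FormDomain h S 0) (e k)
            - inner ℂ (testL2 h hψ) (testL2 h (hφ k))) atTop
            (𝓝 (inner ℂ (CoreSpace.mk h 0 hψ : FormDomain h S 0) x - inner ℂ (testL2 h hψ) u)) :=
          (tendsto_const_nhds.inner hx).sub (tendsto_const_nhds.inner hL)
        have h2 := hq ψ hψ
        simp only [fun k => (hφ k).dirichletForm_eq h hψ] at h2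
        simp only [he, UniformSpace.Completion.inner_coe] at h1
        have h3 := tendsto_nhds_unique h1 h2
        rw [← inner_testL2_left h hψ] at h3
        rw [inner_sub_right]
        linear_combination h3
    rw [coneResolvent, ContinuousLinearMap.comp_apply, ← hj, ← hxe, hjx]
  · intro hu
    -- Conversely, any core sequence converging to `j* (u - f)` in the form norm is a valid witness.
    set x := ContinuousLinearMap.adjoint j (u - f) with hx
    have hjx : j x = u := hu.symm
    obtain ⟨e, he, hex⟩ := mem_closure_iff_seq_limit.1
      ((UniformSpace.Completion.denseRange_coe (α := CoreSpace h S 0)) x)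
    choose φ hφ using he
    have hxlim : Tendsto (fun k => (φ k : FormDomain h S 0)) atTop (𝓝 x) :=
      hex.congr fun k => (hφ k).symm
    have hL : Tendsto (fun k => testL2 h (φ k).isTest) atTop (𝓝 u) := by
      rw [← hjx]
      refine ((j.continuous.tendsto x).comp hxlim).congr fun k => ?_
      exact formInclusion_coe h S 0 _
    refine ⟨fun k => (φ k).toFun, fun k => (φ k).isTest, (tendsto_testL2_iff h _ u).1 hL, ?_, ?_⟩
    · intro ε hε
      have hc := hxlim.cauchySeq
      rw [Metric.cauchySeq_iff] at hc
      obtain ⟨N, hN⟩ := hc (Real.sqrt ε) (Real.sqrt_pos.2 hε)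
      refine ⟨N, fun k hk l hl => ?_⟩
      have h1 := hN k hk l hl
      have hsub : IsTest I S ((φ k).toFun - (φ l).toFun) :=
        (coreSubmodule I S).sub_mem (φ k).isTest (φ l).isTest
      rw [hsub.dirichletForm_eq h hsub, Complex.sub_re]
      have e1 : (φ k : FormDomain h S 0) - φ l = (CoreSpace.mk h 0 hsub : FormDomain h S 0) :=
        (UniformSpace.Completion.coe_sub _ _).symm
      rw [dist_eq_norm, e1, UniformSpace.Completion.norm_coe, Real.lt_sqrt (norm_nonneg _),
        @norm_sq_eq_re_inner ℂ] at h1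
      have h4 := @norm_sq_eq_re_inner ℂ _ _ _ _ (testL2 h hsub)
      simp only [RCLike.re_to_complex] at h1 h4
      nlinarith [sq_nonneg ‖testL2 h hsub‖]
    · intro ψ hψ
      have h1 : Tendsto (fun k => inner ℂ (CoreSpace.mk h 0 hψ : FormDomain h S 0) (φ k)
          - inner ℂ (testL2 h hψ) (testL2 h (φ k).isTest)) atTop
          (𝓝 (inner ℂ (CoreSpace.mk h 0 hψ : FormDomain h S 0) x - inner ℂ (testL2 h hψ) u)) :=
        (tendsto_const_nhds.inner hxlim).sub (tendsto_const_nhds.inner hL)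
      simp only [UniformSpace.Completion.inner_coe] at h1
      rw [hadj hψ, inner_sub_right, sub_sub_cancel_left, inner_testL2_left] at h1
      simp only [fun k => (φ k).isTest.dirichletForm_eq h hψ]
      exact h1

/-- The resolvent of the Friedrichs Laplacian off the spectrum. -/
theorem isResolventAt_of_isUnit (bc : BoundaryCondition) (w : ℂ)
    (N : (ConeL2 h →L[ℂ] ConeL2 h)ˣ)
    (hN : (N : ConeL2 h →L[ℂ] ConeL2 h) = (w + 1) • coneResolvent h (bc.region I Y) 0 - 1) :
    IsResolventAt h bc w (↑N⁻¹ * coneResolvent h (bc.region I Y) 0) := by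
  intro f u
  set C := coneResolvent h (bc.region I Y) 0
  rw [isFriedrichsLaplacian_iff]
  -- The equation `u = C (u - f + w u)` is `((w + 1) C - 1) u = C f`, which the unit `N` solves.
  have e1 : C (u - (f - w • u)) = (w + 1) • C u - C f := by
    simp only [map_sub, map_smul, add_smul, one_smul]
    abel
  have e2 : (N : ConeL2 h →L[ℂ] ConeL2 h) u = (w + 1) • C u - u := by rw [hN]; rfl
  rw [e1]
  constructor
  · rintro rfl
    have h1 : (N : ConeL2 h →L[ℂ] ConeL2 h) ((↑N⁻¹ * C) f) = C f := by
      rw [← mul_apply_eq_comp, ← mul_assoc, N.mul_inv, one_mul]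
    rw [h1] at e2
    rw [e2]
    abel
  · intro hu
    have h1 : C f = (N : ConeL2 h →L[ℂ] ConeL2 h) u := by
      rw [e2]
      rw [eq_sub_iff_add_eq] at hu ⊢
      rw [← hu]
      abel
    rw [mul_apply_eq_comp, h1, ← mul_apply_eq_comp, N.inv_mul]
    rfl

theorem IsResolventAt.unique {bc : BoundaryCondition} {w : ℂ} {R R' : ConeL2 h →L[ℂ] ConeL2 h}
    (hR : IsResolventAt h bc w R) (hR' : IsResolventAt h bc w R') : R = R' :=
  ContinuousLinearMap.ext fun f => ((hR' f (R f)).2 ((hR f (R f)).1 rfl)).symm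

theorem resolvent_eq {bc : BoundaryCondition} {lam : ℂ} {R : ConeL2 h →L[ℂ] ConeL2 h}
    (hR : IsResolventAt h bc (lam ^ 2) R) : resolvent h bc lam = R := by
  have hex : ∃ R, IsResolventAt h bc (lam ^ 2) R := ⟨R, hR⟩
  rw [resolvent, dif_pos hex]
  exact hex.choose_spec.unique h hR

end FormDomain
end RiemannianCone

namespace RiemannianCone

open MeasureTheory Set Filter

/-! ### Dilations and multiplication operators on `L²` -/

section Operators
set_option linter.unusedSectionVars false

variable {d : ℕ} {H : Type*} [TopologicalSpace H] {I : ModelWithCorners ℝ (Coord d) H}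
  {Y : Type*} [TopologicalSpace Y] [ChartedSpace H Y] [IsManifold I ∞ Y]

/-- The normalization `ρ^{n/2}` of the unitary dilations. -/
def dilFactor (d : ℕ) (ρ : ℝ) : ℝ := Real.sqrt ρ ^ (d + 1)

theorem dilFactor_pos {ρ : ℝ} (hρ : 0 < ρ) : 0 < dilFactor d ρ := pow_pos (Real.sqrt_pos.2 hρ) _

theorem dilFactor_sq {ρ : ℝ} (hρ : 0 < ρ) : dilFactor d ρ * dilFactor d ρ = ρ ^ (d + 1) := by
  rw [dilFactor, ← mul_pow, Real.mul_self_sqrt hρ.le]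

theorem dilFactor_mul_inv {ρ : ℝ} (hρ : 0 < ρ) : dilFactor d ρ * dilFactor d ρ⁻¹ = 1 := by
  rw [dilFactor, dilFactor, ← mul_pow, ← Real.sqrt_mul hρ.le, mul_inv_cancel₀ hρ.ne',
    Real.sqrt_one, one_pow]

theorem dilate_dilate_inv {ρ : ℝ} (hρ : 0 < ρ) (p : ℝ × Y) :
    dilate Y ρ (dilate Y ρ⁻¹ p) = p := by
  simp [dilate, mul_inv_cancel_left₀ hρ.ne']

theorem dilate_inv_dilate {ρ : ℝ} (hρ : 0 < ρ) (p : ℝ × Y) :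
    dilate Y ρ⁻¹ (dilate Y ρ p) = p := by
  simp [dilate, inv_mul_cancel_left₀ hρ.ne']

/-- The unitary dilation of a function. -/
def dil (d : ℕ) (ρ : ℝ) (u : ℝ × Y → ℂ) (p : ℝ × Y) : ℂ := (dilFactor d ρ : ℂ) * u (dilate Y ρ p)

theorem IsTest.dil {S : Set Y} {u : ℝ × Y → ℂ} (hu : IsTest I S u) {ρ : ℝ} (hρ : 0 < ρ) :
    IsTest I S (dil d ρ u) :=
  (hu.comp_dilate hρ).const_smul (dilFactor d ρ : ℂ)

/-- The Gaussian `e^{-a r²}`. -/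
def gaussian (a : ℝ) (r : ℝ) : ℂ := (Real.exp (-(a * r ^ 2)) : ℝ)

theorem contDiff_gaussian (a : ℝ) : ContDiff ℝ ∞ (gaussian a) := by
  have h1 : ContDiff ℝ ∞ fun r : ℝ => Real.exp (-(a * r ^ 2)) := by fun_prop
  exact Complex.ofRealCLM.contDiff.comp h1

theorem norm_gaussian_le {a : ℝ} (ha : 0 ≤ a) (r : ℝ) : ‖gaussian a r‖ ≤ 1 := by
  rw [gaussian, Complex.norm_real, Real.norm_eq_abs, Real.abs_exp, Real.exp_le_one_iff]
  have := mul_nonneg ha (sq_nonneg r)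
  linarith

variable [MeasurableSpace Y] [BorelSpace Y] [CompactSpace Y] (h : Metric I Y)

open Classical in
/-- Multiplication by a bounded function `g` on `L²` (zero if `g` is not bounded). -/
def mulL2 (g : ℝ × Y → ℂ) : ConeL2 h →L[ℂ] ConeL2 h :=
  if hg : MemLp g ⊤ (coneMeasure h) then
    (ContinuousLinearMap.mul ℂ ℂ).holderL (coneMeasure h) ⊤ 2 2 (hg.toLp g) else 0

theorem mulOp_eq_mulL2 {χ : ℝ × Y → ℂ} (hχ : IsCutoff I χ) : mulOp h hχ = mulL2 h χ := by
  rw [mulL2, dif_pos (hχ.memLp_top h)]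
  rfl

variable {h}

theorem coeFn_mulL2 {g : ℝ × Y → ℂ} (hg : MemLp g ⊤ (coneMeasure h)) (f : ConeL2 h) :
    mulL2 h g f =ᵐ[coneMeasure h] fun p => g p * f p := by
  rw [mulL2, dif_pos hg]
  refine ((ContinuousLinearMap.mul ℂ ℂ).coeFn_holder (r := 2) (hg.toLp g) f).trans ?_
  filter_upwards [hg.coeFn_toLp] with p hp
  rw [hp]
  rfl

theorem norm_mulL2_le {g : ℝ × Y → ℂ} {c : ℝ} (hc0 : 0 ≤ c)
    (hc : ∀ p, ‖g p‖ ≤ c) : ‖mulL2 h g‖ ≤ c := by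
  by_cases hg : MemLp g ⊤ (coneMeasure h)
  · refine ContinuousLinearMap.opNorm_le_bound _ hc0 fun f => ?_
    refine Lp.norm_le_mul_norm_of_ae_le_mul ?_
    filter_upwards [coeFn_mulL2 hg f] with p hp
    rw [hp, norm_mul]
    gcongr
    exact hc p
  · rw [mulL2, dif_neg hg, norm_zero]
    exact hc0

theorem memLp_top_of_continuous_of_bound {g : ℝ × Y → ℂ} (hg : Continuous g) {c : ℝ}
    (hc : ∀ p, ‖g p‖ ≤ c) : MemLp g ⊤ (coneMeasure h) :=
  memLp_top_of_bound hg.aestronglyMeasurable c (Eventually.of_forall hc)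

theorem mulL2_comp {g g' : ℝ × Y → ℂ} (hg : MemLp g ⊤ (coneMeasure h))
    (hg' : MemLp g' ⊤ (coneMeasure h)) (hgg' : MemLp (fun p => g p * g' p) ⊤ (coneMeasure h)) :
    mulL2 h g ∘L mulL2 h g' = mulL2 h fun p => g p * g' p := by
  ext1 f
  refine Lp.ext ?_
  filter_upwards [coeFn_mulL2 hg (mulL2 h g' f), coeFn_mulL2 hg' f, coeFn_mulL2 hgg' f]
    with p h1 h2 h3
  rw [ContinuousLinearMap.comp_apply, h1, h2, h3, mul_assoc]

theorem adjoint_mulL2 {g : ℝ × Y → ℂ} (hg : MemLp g ⊤ (coneMeasure h))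
    (hg' : ∀ p, (starRingEnd ℂ) (g p) = g p) :
    ContinuousLinearMap.adjoint (mulL2 h g) = mulL2 h g := by
  symm
  rw [ContinuousLinearMap.eq_adjoint_iff]
  intro f f'
  rw [L2.inner_def, L2.inner_def]
  refine integral_congr_ae ?_
  filter_upwards [coeFn_mulL2 hg f, coeFn_mulL2 hg f'] with p h1 h2
  rw [h1, h2]
  simp only [RCLike.inner_apply, map_mul, hg']
  ring

theorem mulL2_testL2 {S S' : Set Y} {g u : ℝ × Y → ℂ} (hg : MemLp g ⊤ (coneMeasure h))
    (hu : IsTest I S u) (hgu : IsTest I S' fun p => g p * u p) :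
    mulL2 h g (testL2 h hu) = testL2 h hgu := by
  refine Lp.ext ?_
  filter_upwards [coeFn_mulL2 hg (testL2 h hu), coeFn_testL2 h hu, coeFn_testL2 h hgu] with p h1 h2 h3
  rw [h1, h2, h3]

theorem measurable_dilate (ρ : ℝ) : Measurable (dilate Y ρ) :=
  (measurable_fst.const_mul ρ).prodMk measurable_snd

theorem measurableEmbedding_dilate {ρ : ℝ} (hρ : 0 < ρ) : MeasurableEmbedding (dilate Y ρ) :=
  (MeasurableEquiv.mk ⟨dilate Y ρ, dilate Y ρ⁻¹, dilate_inv_dilate hρ, dilate_dilate_inv hρ⟩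
    (measurable_dilate ρ) (measurable_dilate ρ⁻¹)).measurableEmbedding

-- Elements of `L²` are classes of functions, so identities valid almost everywhere must remain so
-- after composition with a dilation.
variable (h) in
theorem quasiMeasurePreserving_dilate {ρ : ℝ} (hρ : 0 < ρ) :
    Measure.QuasiMeasurePreserving (dilate Y ρ) (coneMeasure h) (coneMeasure h) where
  measurable := measurable_dilate ρ
  absolutelyContinuous := by
    rw [map_dilate_coneMeasure h hρ]
    exact Measure.smul_absolutelyContinuous

variable (h) in
theorem integral_comp_dilate {ρ : ℝ} (hρ : 0 < ρ) (f : ℝ × Y → ℂ) :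
    ((ρ ^ (d + 1) : ℝ) : ℂ) * ∫ p, f (dilate Y ρ p) ∂(coneMeasure h)
      = ∫ p, f p ∂(coneMeasure h) := by
  rw [← (measurableEmbedding_dilate hρ).integral_map, map_dilate_coneMeasure h hρ,
    integral_smul_measure, ENNReal.toReal_ofReal (by positivity), Complex.real_smul, ← mul_assoc,
    ← Complex.ofReal_mul, ← mul_pow, mul_inv_cancel₀ hρ.ne']
  simp

theorem memLp_comp_dilate {ρ : ℝ} (hρ : 0 < ρ) {f : ℝ × Y → ℂ} (hf : MemLp f 2 (coneMeasure h)) :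
    MemLp (fun p => (dilFactor d ρ : ℂ) * f (dilate Y ρ p)) 2 (coneMeasure h) := by
  have h1 : MemLp f 2 (Measure.map (dilate Y ρ) (coneMeasure h)) := by
    rw [map_dilate_coneMeasure h hρ]
    exact hf.smul_measure ENNReal.ofReal_ne_top
  exact (h1.comp_of_map (measurable_dilate ρ).aemeasurable).const_mul _

variable (h) in
/-- The dilation of a class of functions. -/
def dilFun {ρ : ℝ} (hρ : 0 < ρ) (f : ConeL2 h) : ConeL2 h :=
  (memLp_comp_dilate hρ (Lp.memLp f)).toLp _

theorem coeFn_dilFun {ρ : ℝ} (hρ : 0 < ρ) (f : ConeL2 h) :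
    dilFun h hρ f =ᵐ[coneMeasure h] fun p => (dilFactor d ρ : ℂ) * f (dilate Y ρ p) :=
  MemLp.coeFn_toLp _

theorem inner_dilFun {ρ : ℝ} (hρ : 0 < ρ) (f g : ConeL2 h) :
    inner ℂ (dilFun h hρ f) (dilFun h hρ g) = inner ℂ f g := by
  rw [L2.inner_def, L2.inner_def, ← integral_comp_dilate h hρ fun p => inner ℂ (f p) (g p),
    ← integral_const_mul]
  refine integral_congr_ae ?_
  filter_upwards [coeFn_dilFun hρ f, coeFn_dilFun hρ g] with p h1 h2
  rw [h1, h2, ← dilFactor_sq hρ]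
  simp only [RCLike.inner_apply, map_mul, Complex.conj_ofReal, Complex.ofReal_mul]
  ring

variable (h) in
open Classical in
/-- The unitary dilation `(D f)(r, y) = ρ^{n/2} f(ρ r, y)` (zero if `ρ ≤ 0`). -/
def dilL2 (ρ : ℝ) : ConeL2 h →L[ℂ] ConeL2 h :=
  if hρ : 0 < ρ then
    LinearMap.mkContinuous
      { toFun := dilFun h hρ
        map_add' := fun f g => by
          refine Lp.ext ?_
          filter_upwards [coeFn_dilFun hρ (f + g), coeFn_dilFun hρ f, coeFn_dilFun hρ g,
            Lp.coeFn_add (dilFun h hρ f) (dilFun h hρ g),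
            (quasiMeasurePreserving_dilate h hρ).ae (Lp.coeFn_add f g)] with p h1 h2 h3 h4 h5
          rw [h1, h5, h4, Pi.add_apply, Pi.add_apply, h2, h3, mul_add]
        map_smul' := fun c f => by
          refine Lp.ext ?_
          filter_upwards [coeFn_dilFun hρ (c • f), coeFn_dilFun hρ f,
            Lp.coeFn_smul c (dilFun h hρ f),
            (quasiMeasurePreserving_dilate h hρ).ae (Lp.coeFn_smul c f)] with p h1 h2 h3 h4
          rw [h1, h4, RingHom.id_apply, h3, Pi.smul_apply, Pi.smul_apply, h2, smul_eq_mul,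
            smul_eq_mul]
          ring } 1
      fun f => by
        refine le_of_eq ?_
        rw [one_mul, @norm_eq_sqrt_re_inner ℂ, @norm_eq_sqrt_re_inner ℂ _ _ _ _ f]
        exact congrArg (fun z => √(RCLike.re z)) (inner_dilFun hρ f f)
  else 0

theorem dilL2_apply {ρ : ℝ} (hρ : 0 < ρ) (f : ConeL2 h) : dilL2 h ρ f = dilFun h hρ f := by
  rw [dilL2, dif_pos hρ]
  rfl

theorem inner_dilL2 {ρ : ℝ} (hρ : 0 < ρ) (f g : ConeL2 h) :
    inner ℂ (dilL2 h ρ f) (dilL2 h ρ g) = inner ℂ f g := by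
  rw [dilL2_apply hρ, dilL2_apply hρ, inner_dilFun]

theorem norm_dilL2_le (ρ : ℝ) : ‖dilL2 h ρ‖ ≤ 1 := by
  by_cases hρ : 0 < ρ
  · rw [dilL2, dif_pos hρ]
    exact LinearMap.mkContinuous_norm_le _ zero_le_one _
  · rw [dilL2, dif_neg hρ, norm_zero]
    exact zero_le_one

theorem dilL2_comp_inv {ρ : ℝ} (hρ : 0 < ρ) : dilL2 h ρ ∘L dilL2 h ρ⁻¹ = 1 := by
  ext1 f
  refine Lp.ext ?_
  rw [ContinuousLinearMap.comp_apply, dilL2_apply hρ, dilL2_apply (inv_pos.2 hρ)]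
  filter_upwards [coeFn_dilFun hρ (dilFun h (inv_pos.2 hρ) f),
    (quasiMeasurePreserving_dilate h hρ).ae (coeFn_dilFun (inv_pos.2 hρ) f)] with p h1 h2
  rw [h1, h2, ← mul_assoc, ← Complex.ofReal_mul, dilFactor_mul_inv hρ, dilate_inv_dilate hρ]
  simp

theorem adjoint_dilL2 {ρ : ℝ} (hρ : 0 < ρ) :
    ContinuousLinearMap.adjoint (dilL2 h ρ) = dilL2 h ρ⁻¹ := by
  symm
  rw [ContinuousLinearMap.eq_adjoint_iff]
  intro f g
  rw [← inner_dilL2 hρ, ← ContinuousLinearMap.comp_apply, dilL2_comp_inv hρ]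
  rfl

theorem dilL2_testL2 {S : Set Y} {u : ℝ × Y → ℂ} (hu : IsTest I S u) {ρ : ℝ} (hρ : 0 < ρ) :
    dilL2 h ρ (testL2 h hu) = testL2 h (hu.dil hρ) := by
  refine Lp.ext ?_
  rw [dilL2_apply hρ]
  filter_upwards [coeFn_dilFun hρ (testL2 h hu), coeFn_testL2 h (hu.dil hρ),
    (quasiMeasurePreserving_dilate h hρ).ae (coeFn_testL2 h hu)] with p h1 h2 h3
  rw [h1, h2, h3]
  rfl

theorem memLp_gaussian {a : ℝ} (ha : 0 ≤ a) :
    MemLp (fun p : ℝ × Y => gaussian a p.1) ⊤ (coneMeasure h) :=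
  memLp_top_of_continuous_of_bound ((contDiff_gaussian a).continuous.comp continuous_fst)
    fun p => norm_gaussian_le ha p.1

variable (h) in
/-- Multiplication by the Gaussian `e^{-a r²}`. -/
def gaussL2 (a : ℝ) : ConeL2 h →L[ℂ] ConeL2 h := mulL2 h fun p => gaussian a p.1

theorem adjoint_gaussL2 {a : ℝ} (ha : 0 ≤ a) :
    ContinuousLinearMap.adjoint (gaussL2 h a) = gaussL2 h a :=
  adjoint_mulL2 (memLp_gaussian ha) fun _ => Complex.conj_ofReal _

theorem norm_gaussL2_le {a : ℝ} (ha : 0 ≤ a) : ‖gaussL2 h a‖ ≤ 1 :=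
  norm_mulL2_le zero_le_one fun p => norm_gaussian_le ha p.1

theorem gaussL2_zero : gaussL2 h 0 = 1 := by
  ext1 f
  refine Lp.ext ?_
  filter_upwards [coeFn_mulL2 (memLp_gaussian (h := h) le_rfl) f] with p hp
  refine hp.trans ?_
  simp [gaussian]

end Operators
end RiemannianCone

namespace RiemannianCone

open MeasureTheory Set Filter

/-! ### The lens transform and its effect on the forms -/

section Lens
set_option linter.unusedSectionVars false

variable {d : ℕ} {H : Type*} [TopologicalSpace H] {I : ModelWithCorners ℝ (Coord d) H}
  {Y : Type*} [TopologicalSpace Y] [ChartedSpace H Y] [IsManifold I ∞ Y]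

theorem hasDerivAt_gaussian (a r : ℝ) :
    HasDerivAt (gaussian a) ((-(2 * a * r) : ℝ) * gaussian a r) r := by
  have h1 : HasDerivAt (fun r : ℝ => -(a * r ^ 2)) (-(2 * a * r)) r :=
    (((hasDerivAt_pow 2 r).const_mul a).neg).congr_deriv (by push_cast; ring)
  refine (h1.exp.ofReal_comp).congr_deriv ?_
  rw [gaussian]
  push_cast
  ring

theorem conj_gaussian (a r : ℝ) : (starRingEnd ℂ) (gaussian a r) = gaussian a r :=
  Complex.conj_ofReal _

/-- The lens transform `e^{-a r²} ρ^{n/2} u(ρ r, y)`. -/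
def lens (d : ℕ) (a ρ : ℝ) (u : ℝ × Y → ℂ) (p : ℝ × Y) : ℂ := gaussian a p.1 * dil d ρ u p

/-- The formal adjoint of the lens transform. -/
def lensAdjoint (d : ℕ) (a ρ : ℝ) (u : ℝ × Y → ℂ) : ℝ × Y → ℂ :=
  dil d ρ⁻¹ fun p => gaussian a p.1 * u p

/-- The derivative of `lensAdjoint` along a solution of `a' = ν - 4 a²`, `ρ' = -4 a ρ`. -/
def lensAdjointDeriv (d : ℕ) (ν a ρ : ℝ) (u : ℝ × Y → ℂ) : ℝ × Y → ℂ :=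
  dil d ρ⁻¹ fun p => ((2 * a * (d + 1) - (ν + 4 * a ^ 2) * p.1 ^ 2 : ℝ) : ℂ)
    * (gaussian a p.1 * u p) + ((4 * a * p.1 : ℝ) : ℂ) * (gaussian a p.1 * radialDeriv u p)

theorem dil_inv_dil {ρ : ℝ} (hρ : 0 < ρ) (u : ℝ × Y → ℂ) : dil d ρ⁻¹ (dil d ρ u) = u := by
  funext p
  rw [dil, dil, dilate_dilate_inv hρ, ← mul_assoc, ← Complex.ofReal_mul, mul_comm,
    mul_comm (dilFactor d ρ⁻¹), dilFactor_mul_inv hρ]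
  simp

theorem IsTest.lens {S : Set Y} {u : ℝ × Y → ℂ} (hu : IsTest I S u) (a : ℝ) {ρ : ℝ}
    (hρ : 0 < ρ) : IsTest I S (lens d a ρ u) :=
  (hu.dil hρ).radial_mul (contDiff_gaussian a)

theorem IsTest.lensAdjoint {S : Set Y} {u : ℝ × Y → ℂ} (hu : IsTest I S u) (a : ℝ) {ρ : ℝ}
    (hρ : 0 < ρ) : IsTest I S (lensAdjoint d a ρ u) :=
  (hu.radial_mul (contDiff_gaussian a)).dil (inv_pos.2 hρ)

theorem radialDeriv_dil {u : ℝ × Y → ℂ} (hu : ContMDiff (𝓘(ℝ, ℝ).prod I) 𝓘(ℝ, ℂ) ∞ u) (ρ : ℝ)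
    (p : ℝ × Y) :
    radialDeriv (dil d ρ u) p = dilFactor d ρ * (ρ * radialDeriv u (dilate Y ρ p)) := by
  rw [← radialDeriv_comp_dilate hu]
  exact radialDeriv_smul (dilFactor d ρ : ℂ) (fun p => u (dilate Y ρ p)) p

variable (h : Metric I Y)

theorem covectorInner_linkDeriv_dil {S : Set Y} {u v : ℝ × Y → ℂ} (hu : IsTest I S u)
    (hv : IsTest I S v) {ρ : ℝ} (hρ : 0 < ρ) (p : ℝ × Y) :
    covectorInner h p.2 (linkDeriv I (dil d ρ u) p) (linkDeriv I (dil d ρ v) p)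
      = dilFactor d ρ * dilFactor d ρ * covectorInner h (dilate Y ρ p).2
          (linkDeriv I u (dilate Y ρ p)) (linkDeriv I v (dilate Y ρ p)) := by
  have e1 := linkDeriv_const_smul (hu.comp_dilate hρ).contMDiff (dilFactor d ρ : ℂ) p
  have e2 := linkDeriv_const_smul (hv.comp_dilate hρ).contMDiff (dilFactor d ρ : ℂ) p
  change covectorInner h p.2 (linkDeriv I ((dilFactor d ρ : ℂ) • fun p => u (dilate Y ρ p)) p)
    (linkDeriv I ((dilFactor d ρ : ℂ) • fun p => v (dilate Y ρ p)) p) = _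
  rw [e1, e2, covectorInner_smul_left, covectorInner_smul_right, Complex.conj_ofReal, ← mul_assoc]
  rfl

theorem covectorInner_linkDeriv_gaussian {u v : ℝ × Y → ℂ}
    (hu : ContMDiff (𝓘(ℝ, ℝ).prod I) 𝓘(ℝ, ℂ) ∞ u) (hv : ContMDiff (𝓘(ℝ, ℝ).prod I) 𝓘(ℝ, ℂ) ∞ v)
    (a : ℝ) (p : ℝ × Y) :
    covectorInner h p.2 (linkDeriv I (fun p => gaussian a p.1 * u p) p)
        (linkDeriv I (fun p => gaussian a p.1 * v p) p)
      = gaussian a p.1 * gaussian a p.1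
        * covectorInner h p.2 (linkDeriv I u p) (linkDeriv I v p) := by
  rw [linkDeriv_radial_mul hu, linkDeriv_radial_mul hv, covectorInner_smul_left,
    covectorInner_smul_right, conj_gaussian, ← mul_assoc]

/-- The form density without its `L²` part. -/
theorem formDensity_sub (κ : ℝ) (u v : ℝ × Y → ℂ) (p : ℝ × Y) :
    formDensity h κ u v p - u p * (starRingEnd ℂ) (v p)
      = radialDeriv u p * (starRingEnd ℂ) (radialDeriv v p)
        + (((p.1 ^ 2)⁻¹ : ℝ) : ℂ) * covectorInner h p.2 (linkDeriv I u p) (linkDeriv I v p)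
        + ((κ * p.1 ^ 2 : ℝ) : ℂ) * (u p * (starRingEnd ℂ) (v p)) := by
  rw [formDensity]
  push_cast
  ring

/-- Both `∂_r` and `r⁻¹ d_Y` scale by `ρ`, so the Dirichlet form is homogeneous of degree two. The
factor `ρ^{d+1}` is the Jacobian and disappears on integration. -/
theorem formDensity_dil_sub {S : Set Y} {u v : ℝ × Y → ℂ} (hu : IsTest I S u) (hv : IsTest I S v)
    {ρ : ℝ} (hρ : 0 < ρ) (p : ℝ × Y) :
    formDensity h 0 (dil d ρ u) (dil d ρ v) p - dil d ρ u p * (starRingEnd ℂ) (dil d ρ v p)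
      = ((ρ ^ (d + 1) : ℝ) : ℂ) * (ρ ^ 2 * (formDensity h 0 u v (dilate Y ρ p)
        - u (dilate Y ρ p) * (starRingEnd ℂ) (v (dilate Y ρ p)))) := by
  rw [formDensity_sub, formDensity_sub, radialDeriv_dil hu.contMDiff, radialDeriv_dil hv.contMDiff,
    covectorInner_linkDeriv_dil h hu hv hρ, ← dilFactor_sq hρ]
  have h1 : (((dilate Y ρ p).1 ^ 2)⁻¹ : ℝ) = (ρ ^ 2)⁻¹ * (p.1 ^ 2)⁻¹ := by
    rw [dilate, mul_pow, mul_inv]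
  have h2 : (ρ : ℂ) ^ 2 ≠ 0 := pow_ne_zero 2 (Complex.ofReal_ne_zero.2 hρ.ne')
  rw [h1]
  generalize covectorInner h (dilate Y ρ p).2 (linkDeriv I u (dilate Y ρ p))
    (linkDeriv I v (dilate Y ρ p)) = c
  simp only [map_mul, Complex.conj_ofReal]
  push_cast
  have h3 : (ρ : ℂ) ^ 2 * ((ρ : ℂ) ^ 2)⁻¹ = 1 := mul_inv_cancel₀ h2
  linear_combination (-(dilFactor d ρ : ℂ) * dilFactor d ρ * ((p.1 : ℂ) ^ 2)⁻¹ * c) * h3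

theorem radialDeriv_gaussian_mul {u : ℝ × Y → ℂ}
    (hu : ContMDiff (𝓘(ℝ, ℝ).prod I) 𝓘(ℝ, ℂ) ∞ u) (a : ℝ) (p : ℝ × Y) :
    radialDeriv (fun p => gaussian a p.1 * u p) p
      = gaussian a p.1 * (((-(2 * a * p.1) : ℝ) : ℂ) * u p + radialDeriv u p) := by
  rw [radialDeriv_radial_mul hu (hasDerivAt_gaussian a p.1)]
  ring

/-- `y e^{-y} ≤ 1`. -/
theorem mul_sq_mul_exp_le (a r : ℝ) :
    2 * a * r ^ 2 * (Real.exp (-(a * r ^ 2)) * Real.exp (-(a * r ^ 2))) ≤ 1 := by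
  rw [← Real.exp_add, show -(a * r ^ 2) + -(a * r ^ 2) = -(2 * a * r ^ 2) by ring, Real.exp_neg,
    ← div_eq_mul_inv, div_le_one (Real.exp_pos _)]
  linarith [Real.add_one_le_exp (2 * a * r ^ 2)]

/-- The pointwise estimate behind boundedness of the lens transform between form domains. Here `G`
is the Gaussian, `K` the dilation factor, `x` and `x'` stand for `|u|` and `|∂_r u|` at the dilated
point, `R` for `r⁻²`, `c` for the link term and `D` for the radial derivative of the transform. The
Gaussian pays for the factors `r²` from its own derivative and from the potential, since `2 a r² G²
≤ 1`; the auxiliary `b` turns `ν r² G²` into a bound through `ν ≤ 2ab`. -/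
theorem lens_density_bound {G K a b ν ρ r R c x x' D : ℝ} (hG0 : 0 < G) (hGG : G * G ≤ 1)
    (hK0 : 0 < K) (hρ : 0 < ρ) (ha : 0 ≤ a) (hb : 0 ≤ b) (hab : ν ≤ 2 * a * b)
    (hy : 2 * a * r ^ 2 * (G * G) ≤ 1) (hc0 : 0 ≤ c) (hR0 : 0 ≤ R) (hD : 0 ≤ D)
    (e1 : D ≤ G * K * (2 * a * |r| * x + ρ * x')) :
    D ^ 2 + R * (G * K * (G * K) * c) + (ν * r ^ 2 + 1) * (G * K * x) ^ 2
      ≤ (2 * ρ ^ 2 + 4 * a + b + 1) * (K * K * (x' ^ 2 + (ρ ^ 2)⁻¹ * R * c + x ^ 2)) := by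
  have hKK : 0 ≤ K * K := by positivity
  have f1 : D ^ 2 ≤ K * K * (4 * a * x ^ 2 + 2 * ρ ^ 2 * x' ^ 2) := by
    have g1 : D ^ 2 ≤ (G * K * (2 * a * |r| * x + ρ * x')) ^ 2 := pow_le_pow_left₀ hD e1 2
    have g2 : (2 * a * |r| * x + ρ * x') ^ 2
        ≤ 8 * a ^ 2 * r ^ 2 * x ^ 2 + 2 * ρ ^ 2 * x' ^ 2 := by
      have h1 := sq_nonneg (2 * a * |r| * x - ρ * x')
      have h3 : (2 * a * |r| * x) ^ 2 = 4 * a ^ 2 * r ^ 2 * x ^ 2 := by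
        rw [← sq_abs r]; ring
      nlinarith
    have g3 : G * G * (8 * a ^ 2 * r ^ 2 * x ^ 2) ≤ 4 * a * x ^ 2 := by
      have := mul_le_mul_of_nonneg_left hy (show 0 ≤ 4 * a * x ^ 2 by positivity)
      linarith
    have g4 : G * G * (2 * ρ ^ 2 * x' ^ 2) ≤ 2 * ρ ^ 2 * x' ^ 2 :=
      mul_le_of_le_one_left (by positivity) hGG
    calc _ ≤ _ := g1
      _ = K * K * (G * G * (2 * a * |r| * x + ρ * x') ^ 2) := by ring
      _ ≤ K * K * (G * G * (8 * a ^ 2 * r ^ 2 * x ^ 2 + 2 * ρ ^ 2 * x' ^ 2)) := by gcongr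
      _ ≤ _ := by
        refine mul_le_mul_of_nonneg_left ?_ hKK
        rw [mul_add]
        exact add_le_add g3 g4
  have f2 : R * (G * K * (G * K) * c) ≤ K * K * (R * c) := by
    have := mul_le_mul_of_nonneg_left hGG (mul_nonneg hKK (mul_nonneg hR0 hc0))
    linarith
  have f3 : (ν * r ^ 2 + 1) * (G * K * x) ^ 2 ≤ K * K * ((b + 1) * x ^ 2) := by
    have g1 : ν * r ^ 2 * (G * G) ≤ b := by
      have h1 := mul_le_mul_of_nonneg_right hab (mul_nonneg (sq_nonneg r) (mul_self_nonneg G))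
      have h2 := mul_le_mul_of_nonneg_left hy hb
      linarith
    have g2 : (ν * r ^ 2 + 1) * (G * G) ≤ b + 1 := by linarith
    calc _ = K * K * ((ν * r ^ 2 + 1) * (G * G) * x ^ 2) := by ring
      _ ≤ _ := by gcongr
  have hρ2 : ρ ^ 2 * (ρ ^ 2)⁻¹ = 1 := mul_inv_cancel₀ (by positivity)
  have hab0 : 0 ≤ 4 * a + b + 1 := by positivity
  have final : 4 * a * x ^ 2 + 2 * ρ ^ 2 * x' ^ 2 + R * c + (b + 1) * x ^ 2
      ≤ (2 * ρ ^ 2 + 4 * a + b + 1) * (x' ^ 2 + (ρ ^ 2)⁻¹ * R * c + x ^ 2) := by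
    have g1 : R * c = ρ ^ 2 * ((ρ ^ 2)⁻¹ * R * c) := by
      rw [← mul_assoc, ← mul_assoc, hρ2, one_mul]
    have hz0 : 0 ≤ (ρ ^ 2)⁻¹ * R * c := by positivity
    generalize (ρ ^ 2)⁻¹ * R * c = z at g1 hz0
    rw [g1]
    have i1 := mul_nonneg hab0 (sq_nonneg x')
    have i2 := mul_nonneg hab0 hz0
    have i3 := mul_nonneg (sq_nonneg ρ) (sq_nonneg x)
    have i4 := mul_nonneg (sq_nonneg ρ) hz0
    linarith
  calc _ ≤ K * K * (4 * a * x ^ 2 + 2 * ρ ^ 2 * x' ^ 2) + K * K * (R * c)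
        + K * K * ((b + 1) * x ^ 2) := add_le_add (add_le_add f1 f2) f3
    _ = K * K * (4 * a * x ^ 2 + 2 * ρ ^ 2 * x' ^ 2 + R * c + (b + 1) * x ^ 2) := by ring
    _ ≤ K * K * _ := mul_le_mul_of_nonneg_left final hKK
    _ = _ := by ring

theorem formDensity_lens_le {S : Set Y} {u : ℝ × Y → ℂ} (hu : IsTest I S u) {ν a b ρ : ℝ}
    (hρ : 0 < ρ) (ha : 0 ≤ a) (hb : 0 ≤ b) (hab : ν ≤ 2 * a * b) (p : ℝ × Y) :
    (formDensity h ν (lens d a ρ u) (lens d a ρ u) p).re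
      ≤ (2 * ρ ^ 2 + 4 * a + b + 1)
        * (ρ ^ (d + 1) * (formDensity h 0 u u (dilate Y ρ p)).re) := by
  have hlens : lens d a ρ u = fun p => gaussian a p.1 * dil d ρ u p := rfl
  set q := dilate Y ρ p with hq
  set K := dilFactor d ρ with hK
  have hK0 : 0 < K := dilFactor_pos hρ
  set G := Real.exp (-(a * p.1 ^ 2)) with hG
  have hG0 : 0 < G := Real.exp_pos _
  have hGg : gaussian a p.1 = (G : ℂ) := rfl
  have e1 : ‖radialDeriv (lens d a ρ u) p‖
      ≤ G * K * (2 * a * |p.1| * ‖u q‖ + ρ * ‖radialDeriv u q‖) := by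
    rw [hlens, radialDeriv_gaussian_mul (hu.dil hρ).contMDiff, radialDeriv_dil hu.contMDiff, hGg,
      norm_mul, Complex.norm_real, Real.norm_of_nonneg hG0.le, mul_assoc G K]
    refine mul_le_mul_of_nonneg_left ?_ hG0.le
    refine (norm_add_le _ _).trans (le_of_eq ?_)
    rw [dil, norm_mul, norm_mul, norm_mul, norm_mul, Complex.norm_real, Complex.norm_real,
      Complex.norm_real, Real.norm_of_nonneg hK0.le, Real.norm_of_nonneg hρ.le, norm_neg,
      Real.norm_eq_abs, abs_mul, abs_of_nonneg (by positivity : 0 ≤ 2 * a)]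
    ring
  have e2 : covectorInner h p.2 (linkDeriv I (lens d a ρ u) p) (linkDeriv I (lens d a ρ u) p)
      = ((G * K * (G * K) : ℝ) : ℂ) * covectorInner h q.2 (linkDeriv I u q) (linkDeriv I u q) := by
    rw [hlens, covectorInner_linkDeriv_gaussian h (hu.dil hρ).contMDiff (hu.dil hρ).contMDiff,
      covectorInner_linkDeriv_dil h hu hu hρ, hGg]
    push_cast
    ring
  have e3 : ‖lens d a ρ u p‖ = G * K * ‖u q‖ := by
    rw [lens, dil, hGg, norm_mul, norm_mul, Complex.norm_real, Complex.norm_real,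
      Real.norm_of_nonneg hG0.le, Real.norm_of_nonneg hK0.le]
    ring
  have hGG : G * G ≤ 1 := by
    have : G ≤ 1 := Real.exp_le_one_iff.2 (by
      have := mul_nonneg ha (sq_nonneg p.1); linarith)
    nlinarith
  have hy := mul_sq_mul_exp_le a p.1
  rw [← hG] at hy
  rw [formDensity_self_re, formDensity_self_re, e2, e3, ← dilFactor_sq (d := d) hρ, ← hK,
    Complex.re_ofReal_mul]
  have hq1 : (q.1 ^ 2)⁻¹ = (ρ ^ 2)⁻¹ * (p.1 ^ 2)⁻¹ := by
    rw [hq, dilate, mul_pow, mul_inv]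
  rw [hq1, zero_mul, zero_add, one_mul]
  exact lens_density_bound hG0 hGG hK0 hρ ha hb hab hy (covectorInner_self_nonneg h q.2 _)
    (inv_nonneg.2 (sq_nonneg _)) (norm_nonneg _) e1

variable [MeasurableSpace Y] [BorelSpace Y] [CompactSpace Y]

theorem integrable_comp_dilate {ρ : ℝ} (hρ : 0 < ρ) {f : ℝ × Y → ℂ}
    (hf : Integrable f (coneMeasure h)) :
    Integrable (fun p => f (dilate Y ρ p)) (coneMeasure h) := by
  have h1 : Integrable f (Measure.map (dilate Y ρ) (coneMeasure h)) := by
    rw [map_dilate_coneMeasure h hρ]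
    exact hf.smul_measure ENNReal.ofReal_ne_top
  exact (measurableEmbedding_dilate hρ).integrable_map_iff.1 h1

theorem CoreSpace.norm_sq_eq {S : Set Y} {ν : NNReal} (u : CoreSpace h S ν) :
    ‖u‖ ^ 2 = (∫ p, formDensity h ν u.toFun u.toFun p ∂(coneMeasure h)).re :=
  @norm_sq_eq_re_inner ℂ _ _ _ _ u

theorem norm_lens_le {S : Set Y} {ν : NNReal} {a b ρ : ℝ} (hρ : 0 < ρ) (ha : 0 ≤ a) (hb : 0 ≤ b)
    (hab : ν ≤ 2 * a * b) (u : CoreSpace h S 0) :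
    ‖CoreSpace.mk h ν (u.isTest.lens a hρ)‖ ≤ √(2 * ρ ^ 2 + 4 * a + b + 1) * ‖u‖ := by
  refine le_of_sq_le_sq ?_ (by positivity)
  rw [mul_pow, Real.sq_sqrt (by positivity), CoreSpace.norm_sq_eq, CoreSpace.norm_sq_eq]
  change (∫ p, formDensity h ν (lens d a ρ u.toFun) (lens d a ρ u.toFun) p ∂(coneMeasure h)).re
    ≤ _ * (∫ p, formDensity h (0 : ℝ) u.toFun u.toFun p ∂(coneMeasure h)).re
  have hi := u.isTest.integrable_formDensity h 0 u.isTest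
  have hi' := integrable_comp_dilate h hρ hi
  have hl := (u.isTest.lens a hρ).integrable_formDensity h ν (u.isTest.lens a hρ)
  rw [← integral_comp_dilate h hρ (formDensity h 0 u.toFun u.toFun), Complex.re_ofReal_mul]
  have r1 := integral_re (𝕜 := ℂ) hl
  have r2 := integral_re (𝕜 := ℂ) hi'
  simp only [RCLike.re_to_complex] at r1 r2
  rw [← r1, ← r2, ← integral_const_mul, ← integral_const_mul]
  exact integral_mono hl.re ((hi'.re.const_mul _).const_mul _) fun p =>
    formDensity_lens_le h u.isTest hρ ha hb hab p

/-- The lens transform on the form domains. -/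
theorem exists_lensForm (S : Set Y) {ν : NNReal} {a b ρ : ℝ} (hρ : 0 < ρ) (ha : 0 ≤ a)
    (hb : 0 ≤ b) (hab : ν ≤ 2 * a * b) :
    ∃ L : FormDomain h S 0 →L[ℂ] FormDomain h S ν,
      (∀ u : CoreSpace h S 0, L u = (CoreSpace.mk h ν (u.isTest.lens a hρ) : FormDomain h S ν)) ∧
      ‖L‖ ≤ √(2 * ρ ^ 2 + 4 * a + b + 1) := by
  set L₀ : CoreSpace h S 0 →L[ℂ] CoreSpace h S ν := LinearMap.mkContinuous
    { toFun := fun u => CoreSpace.mk h ν (u.isTest.lens a hρ)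
      map_add' := fun u v => Subtype.ext <| funext fun p => by
        change gaussian a p.1 * (_ * (u.toFun _ + v.toFun _))
          = gaussian a p.1 * (_ * u.toFun _) + gaussian a p.1 * (_ * v.toFun _)
        ring
      map_smul' := fun c u => Subtype.ext <| funext fun p => by
        change gaussian a p.1 * (_ * (c * u.toFun _)) = c * (gaussian a p.1 * (_ * u.toFun _))
        ring } _ fun u => norm_lens_le h hρ ha hb hab u with hL₀
  set L : FormDomain h S 0 →L[ℂ] FormDomain h S ν :=
    (UniformSpace.Completion.toComplL ∘L L₀).extend UniformSpace.Completion.toComplL with hL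
  have hLc : ∀ u : CoreSpace h S 0,
      L u = (CoreSpace.mk h ν (u.isTest.lens a hρ) : FormDomain h S ν) := fun u =>
    ContinuousLinearMap.extend_eq _ UniformSpace.Completion.denseRange_coe
      (UniformSpace.Completion.isUniformInducing_coe _) u
  refine ⟨L, hLc, ContinuousLinearMap.opNorm_le_bound _ (Real.sqrt_nonneg _) fun v => ?_⟩
  induction v using UniformSpace.Completion.induction_on with
  | hp => exact isClosed_le (by fun_prop) (by fun_prop)
  | ih u =>
    rw [hLc, UniformSpace.Completion.norm_coe, UniformSpace.Completion.norm_coe]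
    exact norm_lens_le h hρ ha hb hab u

theorem integral_formDensity_dil_sub {S : Set Y} {u v : ℝ × Y → ℂ} (hu : IsTest I S u)
    (hv : IsTest I S v) {ρ : ℝ} (hρ : 0 < ρ) :
    ∫ p, (formDensity h 0 (dil d ρ u) (dil d ρ v) p
        - dil d ρ u p * (starRingEnd ℂ) (dil d ρ v p)) ∂(coneMeasure h)
      = ρ ^ 2 * ∫ p, (formDensity h 0 u v p - u p * (starRingEnd ℂ) (v p)) ∂(coneMeasure h) := by
  simp only [formDensity_dil_sub h hu hv hρ]
  rw [integral_const_mul, integral_const_mul, mul_left_comm,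
    integral_comp_dilate h hρ fun p => formDensity h 0 u v p - u p * (starRingEnd ℂ) (v p)]

theorem IsTest.integrable_mul_conj {S : Set Y} {u v : ℝ × Y → ℂ} (hu : IsTest I S u)
    (hv : Continuous v) : Integrable (fun p => u p * (starRingEnd ℂ) (v p)) (coneMeasure h) := by
  obtain ⟨a, b, ha, hs⟩ := hu.exists_strip
  exact integrable_of_strip h ha (fun p hp => by rw [hs p hp, zero_mul])
    (hu.contMDiff.continuous.mul (Complex.continuous_conj.comp hv)).continuousOn

/-- The infinitesimal form of the lens transform. -/
theorem integral_lens {S : Set Y} {ψ φ : ℝ × Y → ℂ} (hψ : IsTest I S ψ)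
    (hφ : IsTest I S φ) (ν a : ℝ) :
    ∫ p, (((2 * a * (d + 1) - (ν + 4 * a ^ 2) * p.1 ^ 2 : ℝ) : ℂ) * (gaussian a p.1 * ψ p)
        + ((4 * a * p.1 : ℝ) : ℂ) * (gaussian a p.1 * radialDeriv ψ p)) * (starRingEnd ℂ) (φ p)
        ∂(coneMeasure h)
      = ∫ p, (formDensity h 0 (fun p => gaussian a p.1 * ψ p) φ p
          - (gaussian a p.1 * ψ p) * (starRingEnd ℂ) (φ p)) ∂(coneMeasure h)
        - ∫ p, (formDensity h ν ψ (fun p => gaussian a p.1 * φ p) p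
          - ψ p * (starRingEnd ℂ) (gaussian a p.1 * φ p)) ∂(coneMeasure h) := by
  obtain ⟨A, B, hA, hs⟩ := hψ.exists_strip
  have hψg := hψ.radial_mul (contDiff_gaussian a)
  have hφg := hφ.radial_mul (contDiff_gaussian a)
  have cg : Continuous fun p : ℝ × Y => gaussian a p.1 :=
    (contDiff_gaussian a).continuous.comp continuous_fst
  have cψ := hψ.contMDiff.continuous
  have cφ : Continuous fun p => (starRingEnd ℂ) (φ p) :=
    Complex.continuous_conj.comp hφ.contMDiff.continuous
  have cψ' := continuous_radialDeriv hψ.contMDiff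
  have cφ' : Continuous fun p => (starRingEnd ℂ) (radialDeriv φ p) :=
    Complex.continuous_conj.comp (continuous_radialDeriv hφ.contMDiff)
  -- The two sides differ pointwise by `r k' + (d + 1) k` with `k = 2a e^{-a r²} ψ φ̄`, a radial
  -- divergence. The link terms cancel because the Gaussian is radial, and the potential `ν r²`
  -- cancels on its own.
  set k : ℝ × Y → ℂ := fun p => ((2 * a : ℝ) : ℂ)
    * ((gaussian a p.1 * ψ p) * (starRingEnd ℂ) (φ p)) with hk
  set k' : ℝ × Y → ℂ := fun p => ((2 * a : ℝ) : ℂ)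
    * ((gaussian a p.1 * (((-(2 * a * p.1) : ℝ) : ℂ) * ψ p + radialDeriv ψ p))
        * (starRingEnd ℂ) (φ p)
      + (gaussian a p.1 * ψ p) * (starRingEnd ℂ) (radialDeriv φ p)) with hk'
  have hdiv := integral_radial_divergence h (k := k) (k' := k') (b := B) hA
    (fun p hp => by simp only [hk, hs p hp]; ring) (by fun_prop) (by fun_prop) (fun p => by
      have h1 := hasDerivAt_radial hψg.contMDiff p
      rw [radialDeriv_gaussian_mul hψ.contMDiff] at h1
      have h2 := (hasDerivAt_radial hφ.contMDiff p)
      have h3 : HasDerivAt (fun s => (starRingEnd ℂ) (φ (s, p.2)))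
          ((starRingEnd ℂ) (radialDeriv φ p)) p.1 :=
        (Complex.conjCLE : ℂ →L[ℝ] ℂ).hasFDerivAt.comp_hasDerivAt p.1 h2
      exact (h1.mul h3).const_mul _)
  have i1 : Integrable (fun p : ℝ × Y => (((2 * a * (d + 1) - (ν + 4 * a ^ 2) * p.1 ^ 2 : ℝ) : ℂ)
      * (gaussian a p.1 * ψ p) + ((4 * a * p.1 : ℝ) : ℂ) * (gaussian a p.1 * radialDeriv ψ p))
      * (starRingEnd ℂ) (φ p)) (coneMeasure h) :=
    integrable_of_strip h hA
      (fun p hp => by rw [hs p hp, hs.radialDeriv p hp]; ring) (by fun_prop)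
  have i2 : Integrable (fun p => formDensity h 0 (fun p => gaussian a p.1 * ψ p) φ p
      - (gaussian a p.1 * ψ p) * (starRingEnd ℂ) (φ p)) (coneMeasure h) :=
    (hψg.integrable_formDensity h 0 hφ).sub (hψg.integrable_mul_conj h hφ.contMDiff.continuous)
  have i3 : Integrable (fun p => formDensity h ν ψ (fun p => gaussian a p.1 * φ p) p
      - ψ p * (starRingEnd ℂ) (gaussian a p.1 * φ p)) (coneMeasure h) :=
    (hψ.integrable_formDensity h ν hφg).sub (hψ.integrable_mul_conj h hφg.contMDiff.continuous)
  rw [← sub_eq_zero, ← integral_sub i2 i3]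
  refine (integral_sub i1 (i2.sub i3)).symm.trans (Eq.trans ?_ hdiv)
  refine integral_congr_ae (Eventually.of_forall fun p => ?_)
  simp only [Pi.sub_apply]
  rw [formDensity_sub, formDensity_sub, radialDeriv_gaussian_mul hψ.contMDiff,
    radialDeriv_gaussian_mul hφ.contMDiff, linkDeriv_radial_mul hψ.contMDiff,
    linkDeriv_radial_mul hφ.contMDiff, covectorInner_smul_left, covectorInner_smul_right]
  simp only [map_mul, map_add, conj_gaussian, Complex.conj_ofReal, hk, hk']
  push_cast
  ring

/-- Undoing the dilation reduces this to `integral_lens` for the dilated `φ`, and scaling of the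
Dirichlet form produces `ρ²`. It is the identity `hid` of `comp_heat_eq_heat` on the core, with `τ =
ρ²`. -/
theorem integral_lensAdjointDeriv {S : Set Y} {ψ φ : ℝ × Y → ℂ} (hψ : IsTest I S ψ)
    (hφ : IsTest I S φ) (ν a : ℝ) {ρ : ℝ} (hρ : 0 < ρ) :
    ∫ p, lensAdjointDeriv d ν a ρ ψ p * (starRingEnd ℂ) (φ p) ∂(coneMeasure h)
      = ρ ^ 2 * ∫ p, (formDensity h 0 (lensAdjoint d a ρ ψ) φ p
          - lensAdjoint d a ρ ψ p * (starRingEnd ℂ) (φ p)) ∂(coneMeasure h)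
        - ∫ p, (formDensity h ν ψ (lens d a ρ φ) p
          - ψ p * (starRingEnd ℂ) (lens d a ρ φ p)) ∂(coneMeasure h) := by
  have hσ : 0 < ρ⁻¹ := inv_pos.2 hρ
  have hW := hφ.dil hρ
  have h1 := integral_lens h hψ hW ν a
  have h2 := integral_formDensity_dil_sub h (hψ.radial_mul (contDiff_gaussian a)) hW hσ
  rw [dil_inv_dil hρ] at h2
  have h3 : (ρ : ℂ) ^ 2 * ((ρ⁻¹ : ℝ) : ℂ) ^ 2 = 1 := by
    rw [← mul_pow, ← Complex.ofReal_mul, mul_inv_cancel₀ hρ.ne']; simp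
  rw [lensAdjoint, h2, ← mul_assoc, h3, one_mul]
  refine Eq.trans ?_ h1
  symm
  rw [← integral_comp_dilate h hσ, ← integral_const_mul]
  refine integral_congr_ae (Eventually.of_forall fun p => ?_)
  have hφp : φ p = dilFactor d ρ⁻¹ * dil d ρ φ (dilate Y ρ⁻¹ p) :=
    (congrFun (dil_inv_dil hρ φ) p).symm
  beta_reduce
  rw [hφp, lensAdjointDeriv, dil.eq_def d ρ⁻¹, ← dilFactor_sq hσ, map_mul, Complex.conj_ofReal]
  push_cast
  ring

end Lens
end RiemannianCone

namespace RiemannianCone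

open MeasureTheory Set Filter

/-! ### The heat semigroups of the cone and of the harmonic oscillator -/

section LensSemigroup
set_option linter.unusedSectionVars false

variable {d : ℕ} {H : Type*} [TopologicalSpace H] {I : ModelWithCorners ℝ (Coord d) H}
  {Y : Type*} [TopologicalSpace Y] [ChartedSpace H Y] [IsManifold I ∞ Y]
  [MeasurableSpace Y] [BorelSpace Y] [CompactSpace Y] (h : Metric I Y)

theorem memLp_of_strip {f : ℝ × Y → ℂ} {A B : ℝ} (hs : StripSupport A B f) (hf : Continuous f) :
    MemLp f 2 (coneMeasure h) := by
  have hK : IsCompact (Icc A B ×ˢ (univ : Set Y)) := isCompact_Icc.prod isCompact_univ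
  have hKm : MeasurableSet (Icc A B ×ˢ (univ : Set Y)) := measurableSet_Icc.prod MeasurableSet.univ
  obtain ⟨C, hC⟩ := hK.exists_bound_of_continuousOn hf.continuousOn
  have h1 : MemLp ((Icc A B ×ˢ (univ : Set Y)).indicator fun _ => C) 2 (coneMeasure h) :=
    memLp_indicator_const 2 hKm C (Or.inr (coneMeasure_strip_lt_top h A B).ne)
  refine h1.of_le hf.aestronglyMeasurable (Eventually.of_forall fun p => ?_)
  by_cases hp : p.1 ∈ Icc A B
  · have hp' : p ∈ Icc A B ×ˢ (univ : Set Y) := ⟨hp, mem_univ _⟩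
    rw [indicator_of_mem hp']
    exact (hC p hp').trans (le_abs_self C)
  · rw [hs p hp, norm_zero]
    exact norm_nonneg _

/-- Differentiation in `L²` of a family of functions supported in a fixed strip. -/
theorem hasDerivAt_toLp {F F' : ℝ → ℝ × Y → ℂ} {s₀ A B : ℝ}
    (hF : ∀ s p, HasDerivAt (fun s => F s p) (F' s p) s)
    (hc : Continuous fun q : ℝ × (ℝ × Y) => F' q.1 q.2)
    (hs : ∀ᶠ s in 𝓝 s₀, StripSupport A B (F s)) (hm : ∀ s, MemLp (F s) 2 (coneMeasure h))
    (hm' : MemLp (F' s₀) 2 (coneMeasure h)) :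
    HasDerivAt (fun s => (hm s).toLp (F s)) (hm'.toLp (F' s₀)) s₀ := by
  have hK : IsCompact (Icc A B ×ˢ (univ : Set Y)) := isCompact_Icc.prod isCompact_univ
  have hKm : MeasurableSet (Icc A B ×ˢ (univ : Set Y)) := measurableSet_Icc.prod MeasurableSet.univ
  have hKf : coneMeasure h (Icc A B ×ˢ univ) ≠ ⊤ := (coneMeasure_strip_lt_top h A B).ne
  -- The indicator of the strip has finite `L²` norm, so a remainder that is uniformly small on the
  -- compact strip is small in `L²`.
  set χ : ConeL2 h := indicatorConstLp 2 hKm hKf (1 : ℂ) with hχ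
  rw [hasDerivAt_iff_isLittleO, Asymptotics.isLittleO_iff]
  intro c hc0
  set ε := c / (‖χ‖ + 1) with hε
  have hε0 : 0 < ε := by positivity
  have hunif : ∀ᶠ s in 𝓝 s₀, ∀ p ∈ Icc A B ×ˢ (univ : Set Y), ‖F' s p - F' s₀ p‖ < ε := by
    refine hK.eventually_forall_of_forall_eventually fun p _ => ?_
    have h1 : Continuous fun q : ℝ × (ℝ × Y) => ‖F' q.1 q.2 - F' s₀ q.2‖ := by
      have h2 : Continuous fun q : ℝ × (ℝ × Y) => F' s₀ q.2 :=
        hc.comp (continuous_const.prodMk continuous_snd)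
      exact (hc.sub h2).norm
    refine h1.continuousAt.eventually (gt_mem_nhds ?_)
    simpa using hε0
  obtain ⟨δ, hδ, hball⟩ := Metric.eventually_nhds_iff_ball.1 (hunif.and hs)
  filter_upwards [Metric.ball_mem_nhds s₀ hδ] with s hsδ
  have hs₀ : s₀ ∈ Metric.ball s₀ δ := Metric.mem_ball_self hδ
  have hpt : ∀ p, ‖F s p - F s₀ p - (s - s₀) • F' s₀ p‖
      ≤ ε * |s - s₀| * ‖(Icc A B ×ˢ (univ : Set Y)).indicator (fun _ => (1 : ℂ)) p‖ := by
    intro p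
    by_cases hp : p.1 ∈ Icc A B
    · have hp' : p ∈ Icc A B ×ˢ (univ : Set Y) := ⟨hp, mem_univ _⟩
      rw [indicator_of_mem hp', norm_one, mul_one]
      have hmv := (convex_ball s₀ δ).norm_image_sub_le_of_norm_hasDerivWithin_le
        (f := fun s => F s p - s • F' s₀ p) (f' := fun s => F' s p - F' s₀ p) (C := ε)
        (fun x _ => by
          have h2 := ((hasDerivAt_id x).smul_const (F' s₀ p))
          rw [one_smul] at h2
          exact ((hF x p).sub h2).hasDerivWithinAt)
        (fun x hx => ((hball x hx).1 p hp').le) hs₀ hsδ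
      rw [Real.norm_eq_abs] at hmv
      refine le_trans (le_of_eq ?_) hmv
      congr 1
      rw [sub_smul]
      ring
    · have h1 : ∀ x ∈ Metric.ball s₀ δ, F x p = 0 := fun x hx => (hball x hx).2 p hp
      have h2 : F' s₀ p = 0 := by
        have h3 : (fun x => F x p) =ᶠ[𝓝 s₀] fun _ => 0 := by
          filter_upwards [Metric.ball_mem_nhds s₀ hδ] with x hx using h1 x hx
        rw [← (hF s₀ p).deriv, h3.deriv_eq, deriv_const]
      rw [h1 s hsδ, h1 s₀ hs₀, h2]
      simp only [sub_zero, smul_zero, norm_zero]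
      positivity
  have hLp : ‖(hm s).toLp (F s) - (hm s₀).toLp (F s₀) - (s - s₀) • hm'.toLp (F' s₀)‖
      ≤ ε * |s - s₀| * ‖χ‖ := by
    refine Lp.norm_le_mul_norm_of_ae_le_mul ?_
    filter_upwards [Lp.coeFn_sub ((hm s).toLp (F s) - (hm s₀).toLp (F s₀))
        ((s - s₀) • hm'.toLp (F' s₀)), Lp.coeFn_sub ((hm s).toLp (F s)) ((hm s₀).toLp (F s₀)),
      Lp.coeFn_smul (s - s₀) (hm'.toLp (F' s₀)), (hm s).coeFn_toLp, (hm s₀).coeFn_toLp,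
      hm'.coeFn_toLp, indicatorConstLp_coeFn (p := 2) (hs := hKm) (hμs := hKf) (c := (1 : ℂ))]
      with p h1 h2 h3 h4 h5 h6 h7
    rw [h1, Pi.sub_apply, h2, Pi.sub_apply, h3, Pi.smul_apply, h4, h5, h6, h7]
    exact hpt p
  refine hLp.trans ?_
  rw [Real.norm_eq_abs, mul_right_comm]
  refine mul_le_mul_of_nonneg_right ?_ (abs_nonneg _)
  rw [hε, div_mul_eq_mul_div, div_le_iff₀ (by positivity)]
  nlinarith [norm_nonneg χ]

theorem hasDerivAt_dilFactor_inv {a ρ : ℝ → ℝ} {s : ℝ}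
    (hρd : HasDerivAt ρ (-(4 * a s * ρ s)) s) (hρ : 0 < ρ s) :
    HasDerivAt (fun s => dilFactor d (ρ s)⁻¹) (2 * a s * (d + 1) * dilFactor d (ρ s)⁻¹) s := by
  have h1 := hρd.inv hρ.ne'
  have hσ : 0 < (ρ s)⁻¹ := inv_pos.2 hρ
  have h2 := ((h1.sqrt hσ.ne').pow (d + 1))
  refine h2.congr_deriv ?_
  have h3 : √(ρ s)⁻¹ ≠ 0 := (Real.sqrt_pos.2 hσ).ne'
  have h4 : √(ρ s)⁻¹ ^ 2 = (ρ s)⁻¹ := Real.sq_sqrt hσ.le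
  have h5 : (ρ s)⁻¹ * ρ s = 1 := inv_mul_cancel₀ hρ.ne'
  have h6 : -(-(4 * a s * ρ s)) / ρ s ^ 2 = 4 * a s * √(ρ s)⁻¹ ^ 2 := by
    rw [h4]; field_simp
  simp only [Pi.inv_apply, Nat.add_sub_cancel, dilFactor]
  rw [h6]
  push_cast
  field_simp
  ring

theorem hasDerivAt_lensAdjoint {S : Set Y} {ψ : ℝ × Y → ℂ} (hψ : IsTest I S ψ) {ν : ℝ}
    {a ρ : ℝ → ℝ} {s : ℝ} (had : HasDerivAt a (ν - 4 * a s ^ 2) s)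
    (hρd : HasDerivAt ρ (-(4 * a s * ρ s)) s) (hρ : 0 < ρ s) (p : ℝ × Y) :
    HasDerivAt (fun s => lensAdjoint d (a s) (ρ s) ψ p)
      (lensAdjointDeriv d ν (a s) (ρ s) ψ p) s := by
  have hσ : HasDerivAt (fun s => (ρ s)⁻¹) (4 * a s * (ρ s)⁻¹) s := by
    refine (hρd.inv hρ.ne').congr_deriv ?_
    field_simp
  have h1 : HasDerivAt (fun s => (dilFactor d (ρ s)⁻¹ : ℂ))
      ((2 * a s * (d + 1) * dilFactor d (ρ s)⁻¹ : ℝ) : ℂ) s :=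
    (hasDerivAt_dilFactor_inv hρd hρ).ofReal_comp
  have hr : HasDerivAt (fun s => (ρ s)⁻¹ * p.1) (4 * a s * (ρ s)⁻¹ * p.1) s := hσ.mul_const p.1
  have h2 : HasDerivAt (fun s => gaussian (a s) ((ρ s)⁻¹ * p.1))
      ((-((ν + 4 * a s ^ 2) * ((ρ s)⁻¹ * p.1) ^ 2) : ℝ)
        * gaussian (a s) ((ρ s)⁻¹ * p.1)) s := by
    have h3 : HasDerivAt (fun s => -(a s * ((ρ s)⁻¹ * p.1) ^ 2))
        (-((ν + 4 * a s ^ 2) * ((ρ s)⁻¹ * p.1) ^ 2)) s := by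
      refine ((had.mul (hr.pow 2)).neg).congr_deriv ?_
      push_cast
      simp only [pow_one, Pi.pow_apply]
      ring
    refine (h3.exp.ofReal_comp).congr_deriv ?_
    rw [gaussian]
    push_cast
    ring
  have h4 : HasDerivAt (fun s => ψ ((ρ s)⁻¹ * p.1, p.2))
      (((4 * a s * (ρ s)⁻¹ * p.1 : ℝ) : ℂ) * radialDeriv ψ (dilate Y (ρ s)⁻¹ p)) s := by
    have := (hasDerivAt_radial hψ.contMDiff (dilate Y (ρ s)⁻¹ p)).scomp s hr
    exact this.congr_deriv (Complex.real_smul)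
  refine (h1.mul (h2.mul h4)).congr_deriv ?_
  simp only [lensAdjointDeriv, dil, dilate, Pi.mul_apply]
  push_cast
  ring

theorem continuous_dilFactor (d : ℕ) : Continuous (dilFactor d) := by
  unfold dilFactor
  fun_prop

theorem continuous_gaussian_uncurry : Continuous fun q : ℝ × ℝ => gaussian q.1 q.2 := by
  unfold gaussian
  fun_prop

theorem continuous_lensAdjointDeriv {S : Set Y} {ψ : ℝ × Y → ℂ} (hψ : IsTest I S ψ) (ν : ℝ)
    {a ρ : ℝ → ℝ} (ha : Continuous a) (hρ : Continuous ρ) (hρ0 : ∀ s, 0 < ρ s) :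
    Continuous fun q : ℝ × (ℝ × Y) => lensAdjointDeriv d ν (a q.1) (ρ q.1) ψ q.2 := by
  have hσ : Continuous fun s => (ρ s)⁻¹ := hρ.inv₀ fun s => (hρ0 s).ne'
  have hσ' : Continuous fun q : ℝ × (ℝ × Y) => (ρ q.1)⁻¹ := hσ.comp continuous_fst
  have ha' : Continuous fun q : ℝ × (ℝ × Y) => a q.1 := ha.comp continuous_fst
  have h1 : Continuous fun q : ℝ × (ℝ × Y) => dilate Y (ρ q.1)⁻¹ q.2 := by
    unfold dilate
    fun_prop
  have h2 : Continuous fun q : ℝ × (ℝ × Y) => (dilate Y (ρ q.1)⁻¹ q.2).1 := h1.fst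
  have h3 : Continuous fun q : ℝ × (ℝ × Y) => (dilFactor d (ρ q.1)⁻¹ : ℂ) :=
    Complex.continuous_ofReal.comp ((continuous_dilFactor d).comp hσ')
  have h4 : Continuous fun q : ℝ × (ℝ × Y) => ψ (dilate Y (ρ q.1)⁻¹ q.2) :=
    hψ.contMDiff.continuous.comp h1
  have h5 : Continuous fun q : ℝ × (ℝ × Y) => radialDeriv ψ (dilate Y (ρ q.1)⁻¹ q.2) :=
    (continuous_radialDeriv hψ.contMDiff).comp h1
  have h6 : Continuous fun q : ℝ × (ℝ × Y) => gaussian (a q.1) (dilate Y (ρ q.1)⁻¹ q.2).1 :=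
    continuous_gaussian_uncurry.comp (ha'.prodMk h2)
  have h7 : Continuous fun q : ℝ × (ℝ × Y) => ((2 * a q.1 * (d + 1)
      - (ν + 4 * a q.1 ^ 2) * (dilate Y (ρ q.1)⁻¹ q.2).1 ^ 2 : ℝ) : ℂ) :=
    Complex.continuous_ofReal.comp (((continuous_const.mul ha').mul continuous_const).sub
      ((continuous_const.add (continuous_const.mul (ha'.pow 2))).mul (h2.pow 2)))
  have h8 : Continuous fun q : ℝ × (ℝ × Y) =>
      ((4 * a q.1 * (dilate Y (ρ q.1)⁻¹ q.2).1 : ℝ) : ℂ) :=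
    Complex.continuous_ofReal.comp ((continuous_const.mul ha').mul h2)
  exact h3.mul ((h7.mul (h6.mul h4)).add (h8.mul (h6.mul h5)))

/-- Differentiation in `L²` needs one strip for all nearby parameters. The lower end may be `0`, as
only finite measure and continuity are used. -/
theorem StripSupport.lensAdjoint {A B : ℝ} (hA : 0 < A) {ψ : ℝ × Y → ℂ} (hs : StripSupport A B ψ)
    (a : ℝ) {ρ R : ℝ} (hρ : 0 < ρ) (hR : ρ ≤ R) : StripSupport 0 (R * |B|) (lensAdjoint d a ρ ψ) := by
  intro p hp
  have hz : ψ (dilate Y ρ⁻¹ p) = 0 := by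
    refine hs _ fun hq => hp ?_
    have h1 : p.1 = ρ * (ρ⁻¹ * p.1) := (mul_inv_cancel_left₀ hρ.ne' _).symm
    have h2 : A ≤ ρ⁻¹ * p.1 := hq.1
    have h3 : ρ⁻¹ * p.1 ≤ B := hq.2
    rw [h1]
    refine ⟨mul_nonneg hρ.le (hA.le.trans h2), ?_⟩
    exact mul_le_mul hR (h3.trans (le_abs_self B)) (hA.le.trans h2) (hρ.le.trans hR)
  simp only [RiemannianCone.lensAdjoint, dil, hz, mul_zero]

/-- The lens transform intertwines the heat semigroups of `-Δ` and of `-Δ + ν r²`. -/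
theorem lens_comp_heat (S : Set Y) {ν : NNReal} {a ρ t b : ℝ → ℝ}
    (had : ∀ s, HasDerivAt a (ν - 4 * a s ^ 2) s)
    (hρd : ∀ s, HasDerivAt ρ (-(4 * a s * ρ s)) s) (htd : ∀ s, HasDerivAt t (ρ s ^ 2) s)
    (hρ : ∀ s, 0 < ρ s) (ha0 : a 0 = 0) (ht0 : t 0 = 0) (ha : ∀ s > 0, 0 ≤ a s)
    (ht : ∀ s > 0, 0 < t s) (hb : ContinuousOn b (Ioi 0)) (hb0 : ∀ s > 0, 0 ≤ b s)
    (hab : ∀ s > 0, (ν : ℝ) ≤ 2 * a s * b s) {s : ℝ} (hs : 0 < s) :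
    (gaussL2 h (a s) ∘L dilL2 h (ρ s)) ∘L heat (coneResolvent h S 0) 0 (t s)
      ∘L dilL2 h (ρ 0)⁻¹ = heat (coneResolvent h S ν) 0 s := by
  have hac : Continuous a := continuous_iff_continuousAt.2 fun s => (had s).continuousAt
  have hρc : Continuous ρ := continuous_iff_continuousAt.2 fun s => (hρd s).continuousAt
  -- The form-domain map is bounded only under the conditions imposed for positive `s`; elsewhere it
  -- is set to `0`.
  have hTV : ∀ s, ∃ L : FormDomain h S 0 →L[ℂ] FormDomain h S ν, 0 < s →
      (∀ u : CoreSpace h S 0,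
        L u = (CoreSpace.mk h ν (u.isTest.lens (a s) (hρ s)) : FormDomain h S ν)) ∧
      ‖L‖ ≤ √(2 * ρ s ^ 2 + 4 * a s + b s + 1) := by
    intro s
    by_cases hs : 0 < s
    · obtain ⟨L, hL⟩ := exists_lensForm h S (hρ s) (ha s hs) (hb0 s hs) (hab s hs)
      exact ⟨L, fun _ => hL⟩
    · exact ⟨0, fun h => absurd h hs⟩
  choose TV hTV using hTV
  have hadj : ∀ s > 0, ContinuousLinearMap.adjoint (gaussL2 h (a s) ∘L dilL2 h (ρ s))
      = dilL2 h (ρ s)⁻¹ ∘L gaussL2 h (a s) := fun s hs => by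
    rw [ContinuousLinearMap.adjoint_comp, adjoint_gaussL2 (ha s hs), adjoint_dilL2 (hρ s)]
  have hlens : ∀ s > 0, ∀ {u : ℝ × Y → ℂ} (hu : IsTest I S u),
      (gaussL2 h (a s) ∘L dilL2 h (ρ s)) (testL2 h hu) = testL2 h (hu.lens (a s) (hρ s)) :=
    fun s hs u hu => by
      rw [ContinuousLinearMap.comp_apply, dilL2_testL2 hu (hρ s)]
      exact mulL2_testL2 (memLp_gaussian (ha s hs)) (hu.dil (hρ s)) (hu.lens (a s) (hρ s))
  have hderiv : ∀ (ψ : CoreSpace h S ν) (s : ℝ), ∃ g : ConeL2 h,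
      HasDerivAt (fun s => testL2 h (ψ.isTest.lensAdjoint (a s) (hρ s))) g s ∧
      g =ᵐ[coneMeasure h] lensAdjointDeriv d ν (a s) (ρ s) ψ.toFun := by
    intro ψ s
    obtain ⟨A, B, hA, hstrip⟩ := ψ.isTest.exists_strip
    have hc := continuous_lensAdjointDeriv ψ.isTest (ν : ℝ) hac hρc hρ
    have hF : ∀ s p, HasDerivAt (fun s => lensAdjoint d (a s) (ρ s) ψ.toFun p)
        (lensAdjointDeriv d ν (a s) (ρ s) ψ.toFun p) s := fun s p =>
      hasDerivAt_lensAdjoint ψ.isTest (had s) (hρd s) (hρ s) p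
    have hev : ∀ᶠ s' in 𝓝 s, StripSupport 0 ((ρ s + 1) * |B|)
        (lensAdjoint d (a s') (ρ s') ψ.toFun) := by
      filter_upwards [hρc.continuousAt.eventually (gt_mem_nhds (lt_add_one (ρ s)))] with s' hs'
        using hstrip.lensAdjoint hA _ (hρ s') hs'.le
    have hstrip' : StripSupport 0 ((ρ s + 1) * |B|)
        (lensAdjointDeriv d ν (a s) (ρ s) ψ.toFun) := by
      intro p hp
      have h3 : (fun s' => lensAdjoint d (a s') (ρ s') ψ.toFun p) =ᶠ[𝓝 s] fun _ => 0 := by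
        filter_upwards [hev] with s' hs' using hs' p hp
      rw [← (hF s p).deriv, h3.deriv_eq, deriv_const]
    have hm' := memLp_of_strip h hstrip' (hc.comp (continuous_const.prodMk continuous_id))
    exact ⟨hm'.toLp _, hasDerivAt_toLp h hF hc hev
      (fun s => (ψ.isTest.lensAdjoint (a s) (hρ s)).memLp h) hm', hm'.coeFn_toLp⟩
  choose Ψ' hΨ' hΨae using hderiv
  have hj := norm_formInclusion_le h S
  have hB : ContinuousOn (fun s => √(2 * ρ s ^ 2 + 4 * a s + b s + 1)) (Ioi 0) := by
    refine Real.continuous_sqrt.comp_continuousOn ?_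
    exact ((Continuous.continuousOn (by fun_prop)).add hb).add continuousOn_const
  have hTVj : ∀ s > 0, ∀ v, formInclusion h S ν (TV s v)
      = (gaussL2 h (a s) ∘L dilL2 h (ρ s)) (formInclusion h S 0 v) := by
    intro s hs v
    induction v using UniformSpace.Completion.induction_on with
    | hp => exact isClosed_eq (by fun_prop) (by fun_prop)
    | ih u =>
      rw [(hTV s hs).1, formInclusion_coe, formInclusion_coe, hlens s hs]
      rfl
  -- At `s = 0` the Gaussian is trivial because `a 0 = 0`, so the limiting transform is the dilation
  -- by `ρ 0` and `U` is its inverse.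
  refine comp_heat_eq_heat (hj 0) (hj ν) (e := fun ψ : CoreSpace h S ν => (ψ : FormDomain h S ν))
    UniformSpace.Completion.denseRange_coe
    (T := fun s => gaussL2 h (a s) ∘L dilL2 h (ρ s)) (TV := TV) (t := t) (τ := fun s => ρ s ^ 2)
    (B := fun s => √(2 * ρ s ^ 2 + 4 * a s + b s + 1))
    (Ψ := fun ψ s => (CoreSpace.mk h 0 (ψ.isTest.lensAdjoint (a s) (hρ s)) : FormDomain h S 0))
    (Ψ' := Ψ') ht (fun s _ => htd s) ?_ ?_ hTVj hB (fun s hs => (hTV s hs).2)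
    (inner_dilL2 (inv_pos.2 (hρ 0))) ?_ ?_ ?_ ?_ ?_ hs
  · have := (htd 0).continuousAt.tendsto
    rw [ht0] at this
    exact this.mono_left nhdsWithin_le_nhds
  · intro s hs
    refine (ContinuousLinearMap.opNorm_comp_le _ _).trans ?_
    exact mul_le_one₀ (norm_gaussL2_le (ha s hs)) (norm_nonneg _) (norm_dilL2_le _)
  · intro ψ
    refine ⟨(CoreSpace.mk h 0 (ψ.isTest.dil (inv_pos.2 (hρ 0))) : FormDomain h S 0), ?_⟩
    rw [formInclusion_coe, formInclusion_coe, dilL2_testL2 _ (inv_pos.2 (hρ 0))]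
    rfl
  · intro ψ s hs
    rw [hadj s hs, formInclusion_coe, formInclusion_coe, ContinuousLinearMap.comp_apply]
    have e1 : gaussL2 h (a s) (testL2 h ψ.isTest)
        = testL2 h (ψ.isTest.radial_mul (contDiff_gaussian (a s))) :=
      mulL2_testL2 (memLp_gaussian (ha s hs)) ψ.isTest _
    rw [e1, dilL2_testL2 _ (inv_pos.2 (hρ s))]
    rfl
  · intro ψ s _
    simp only [formInclusion_coe]
    exact hΨ' ψ s
  · intro ψ
    have h1 := (hΨ' ψ 0).continuousAt.tendsto.mono_left (nhdsWithin_le_nhds (s := Ioi 0))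
    have h2 : testL2 h (ψ.isTest.lensAdjoint (a 0) (hρ 0))
        = dilL2 h (ρ 0)⁻¹ (formInclusion h S ν ψ) := by
      rw [formInclusion_coe, dilL2_testL2 _ (inv_pos.2 (hρ 0))]
      refine Lp.ext ?_
      filter_upwards [coeFn_testL2 h (ψ.isTest.lensAdjoint (a 0) (hρ 0)),
        coeFn_testL2 h (ψ.isTest.dil (inv_pos.2 (hρ 0)))] with p h3 h4
      rw [h3, h4, ha0]
      simp [lensAdjoint, dil, gaussian]
    simp only [formInclusion_coe] at h2 ⊢
    rw [← h2]
    exact h1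
  · intro ψ s hs v
    induction v using UniformSpace.Completion.induction_on with
    | hp => exact isClosed_eq (by fun_prop) (by fun_prop)
    | ih φ =>
      rw [(hTV s hs).1, formInclusion_coe, formInclusion_coe, formInclusion_coe, formInclusion_coe,
        UniformSpace.Completion.inner_coe, UniformSpace.Completion.inner_coe, inner_testL2,
        inner_testL2, CoreSpace.inner_def, CoreSpace.inner_def, inner_testL2_left]
      have hAd := ψ.isTest.lensAdjoint (a s) (hρ s)
      have hL := φ.isTest.lens (a s) (hρ s)
      have i1 := integral_sub (hAd.integrable_formDensity h ((0 : NNReal) : ℝ) φ.isTest)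
        (hAd.integrable_mul_conj h φ.isTest.contMDiff.continuous)
      have i2 := integral_sub (ψ.isTest.integrable_formDensity h ν hL)
        (ψ.isTest.integrable_mul_conj h hL.contMDiff.continuous)
      have key := integral_lensAdjointDeriv h ψ.isTest φ.isTest (ν : ℝ) (a s) (hρ s)
      rw [NNReal.coe_zero] at i1
      rw [i1, i2] at key
      refine Eq.trans ?_ (key.trans ?_)
      · refine integral_congr_ae ?_
        filter_upwards [hΨae ψ s] with p hp
        rw [hp]
      · push_cast
        rfl

/-- Scaling of the heat semigroup. -/
theorem dilL2_comp_heat (S : Set Y) {ρ : ℝ} (hρ : 0 < ρ) {s : ℝ} (hs : 0 < s) :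
    dilL2 h ρ ∘L heat (coneResolvent h S 0) 0 ((ρ ^ 2 * s : ℝ) : ℂ) ∘L dilL2 h ρ⁻¹
      = heat (coneResolvent h S 0) 0 s := by
  -- With no Gaussian and constant `ρ` the lens transform is the scaling symmetry itself.
  have := lens_comp_heat h S (ν := 0) (a := fun _ => 0) (ρ := fun _ => ρ)
    (t := fun s => ρ ^ 2 * s) (b := fun _ => 0)
    (fun s => (hasDerivAt_const s 0).congr_deriv (by simp))
    (fun s => (hasDerivAt_const s ρ).congr_deriv (by simp))
    (fun s => ((hasDerivAt_id s).const_mul (ρ ^ 2)).congr_deriv (mul_one _)) (fun _ => hρ) rfl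
    (mul_zero _) (fun _ _ => le_rfl) (fun s hs => by positivity) continuousOn_const
    (fun _ _ => le_rfl) (fun _ _ => by simp) hs
  rw [gaussL2_zero] at this
  exact this

/-- The heat semigroup of the cone between Gaussians is that of the harmonic oscillator. -/
theorem gaussL2_comp_heat_comp_gaussL2 (S : Set Y) {s : ℝ} (hs : 0 < s) :
    gaussL2 h (Real.tanh (s / 2) / 4) ∘L heat (coneResolvent h S 0) 0 (Real.sinh s : ℂ)
      ∘L gaussL2 h (Real.tanh (s / 2) / 4) = heat (coneResolvent h S (1 / 4)) 0 s := by
  have hcosh : ∀ x : ℝ, Real.cosh x ≠ 0 := fun x => (Real.cosh_pos x).ne'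
  have htanh : ∀ x : ℝ, HasDerivAt Real.tanh ((Real.cosh x)⁻¹ ^ 2) x := fun x => by
    have h1 := (Real.hasDerivAt_sinh x).div (Real.hasDerivAt_cosh x) (hcosh x)
    have h2 : Real.tanh = fun x => Real.sinh x / Real.cosh x :=
      funext fun x => Real.tanh_eq_sinh_div_cosh x
    rw [h2]
    refine h1.congr_deriv ?_
    have h3 := Real.cosh_sq x
    rw [inv_pow, div_eq_iff (pow_ne_zero 2 (hcosh x)), inv_mul_cancel₀ (pow_ne_zero 2 (hcosh x))]
    linarith
  have hpos : ∀ x : ℝ, 0 < x → 0 < Real.tanh x := fun x hx => by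
    rw [Real.tanh_eq_sinh_div_cosh]
    exact div_pos (Real.sinh_pos_iff.2 hx) (Real.cosh_pos x)
  have hsq : ∀ x : ℝ, (Real.cosh x)⁻¹ ^ 2 = 1 - Real.tanh x ^ 2 := fun x => by
    rw [Real.tanh_eq_sinh_div_cosh, div_pow, Real.sinh_sq]
    have := hcosh x
    field_simp
    ring
  set x := s / 2 with hx
  have hx0 : 0 < x := by positivity
  -- `tanh s / 4`, `1 / cosh s` and `tanh s` solve `a' = 1/4 - 4a²`, `ρ' = -4aρ`, `t' = ρ²` with `a
  -- 0 = t 0 = 0` and `ρ 0 = 1`; the choice of `b` makes `2ab = 1/4` exactly. It is applied at half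
  -- the time, `x = s / 2`.
  have key := lens_comp_heat h S (ν := 1 / 4) (a := fun s => Real.tanh s / 4)
    (ρ := fun s => (Real.cosh s)⁻¹) (t := Real.tanh) (b := fun s => (2 * Real.tanh s)⁻¹)
    (fun s => ((htanh s).div_const 4).congr_deriv (by rw [hsq]; push_cast; ring))
    (fun s => ((Real.hasDerivAt_cosh s).inv (hcosh s)).congr_deriv (by
      rw [Real.tanh_eq_sinh_div_cosh]
      have := hcosh s
      field_simp))
    htanh (fun s => inv_pos.2 (Real.cosh_pos s)) (by simp) (by simp)
    (fun s hs => (div_pos (hpos s hs) (by norm_num)).le) hpos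
    (ContinuousOn.inv₀ (continuous_iff_continuousAt.2
      fun s => ((htanh s).continuousAt.const_mul 2)).continuousOn
        fun s hs => (mul_pos two_pos (hpos s hs)).ne')
    (fun s hs => (inv_pos.2 (mul_pos two_pos (hpos s hs))).le)
    (fun s hs => by
      have := (hpos s hs).ne'
      push_cast
      field_simp
      norm_num) hx0
  simp only [Real.cosh_zero, inv_one] at key
  have hdil1 : dilL2 h 1 = 1 := by
    ext1 f
    refine Lp.ext ?_
    rw [dilL2_apply one_pos]
    filter_upwards [coeFn_dilFun (h := h) one_pos f] with p hp
    rw [hp]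
    simp [dilFactor, dilate]
  rw [hdil1] at key
  set C₀ := coneResolvent h S 0
  set C := coneResolvent h S (1 / 4)
  set ρ := (Real.cosh x)⁻¹ with hρdef
  have hρ : 0 < ρ := inv_pos.2 (Real.cosh_pos x)
  set g := gaussL2 h (Real.tanh x / 4) with hg
  have hC := isUnitOperator_coneResolvent h S (1 / 4)
  have hC₀ := isUnitOperator_coneResolvent h S 0
  have ht := hpos x hx0
  have hre : ∀ y : ℝ, 0 < y → 0 < ((y : ℝ) : ℂ).re := fun y hy => by simpa using hy
  have key' : g * dilL2 h ρ * heat C₀ 0 (Real.tanh x) = heat C 0 x := by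
    rw [← key]; rfl
  -- The one-sided identity has a Gaussian on the left only. Its adjoint has one on the right, and
  -- the product of the two gives the symmetric formula at time `2x = s`.
  have hadj : heat C 0 x = heat C₀ 0 (Real.tanh x) * (dilL2 h ρ⁻¹ * g) := by
    have e1 := congrArg star key'
    rw [star_mul, star_mul] at e1
    simp only [ContinuousLinearMap.star_eq_adjoint, IsUnitOperator.adjoint_heat, adjoint_dilL2 hρ, hg,
      adjoint_gaussL2 (h := h) (div_pos ht (by norm_num : (0 : ℝ) < 4)).le] at e1
    have hst : ∀ y : ℝ, star (y : ℂ) = y := fun y => Complex.conj_ofReal y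
    rw [hst, hst] at e1
    rw [← e1]
  have hsc := dilL2_comp_heat h S hρ (s := Real.sinh s) (Real.sinh_pos_iff.2 hs)
  -- The middle factor runs for the time `2 tanh x`. Removing the dilations multiplies the time by
  -- `cosh² x`, and `2 sinh x cosh x = sinh s`.
  have hts : ρ ^ 2 * Real.sinh s = Real.tanh x + Real.tanh x := by
    have e1 : s = 2 * x := by rw [hx]; ring
    rw [e1, Real.sinh_two_mul, Real.tanh_eq_sinh_div_cosh, hρdef]
    have := hcosh x
    field_simp
    ring
  have e2 : heat C 0 s = heat C 0 x * heat C 0 x := by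
    rw [hC.heat_mul_heat (hre x hx0) (hre x hx0), ← Complex.ofReal_add, hx, add_halves]
  rw [e2, ← hsc, hts]
  nth_rewrite 1 [← key']
  rw [hadj]
  have e3 := hC₀.heat_mul_heat (hre _ ht) (hre _ ht)
  rw [Complex.ofReal_add, ← e3]
  rfl

end LensSemigroup
end RiemannianCone

namespace RiemannianCone

open MeasureTheory Set Filter

/-! ### Continuation of Laplace transforms by rotation of the contour -/

section Contour
set_option linter.unusedSectionVars false

variable {B : Type*} [NormedAddCommGroup B] [NormedSpace ℂ B]

/-- Holomorphic dependence on `w` of an integral of `e^{w σ}`. -/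
theorem differentiableAt_integral_exp {μ : Measure ℝ} {σ : ℝ → ℂ} {k : ℝ → B} {w₀ : ℂ} {ε : ℝ}
    (hε : 0 < ε) (hσ : AEStronglyMeasurable σ μ) (hk : AEStronglyMeasurable k μ)
    (hb : Integrable (fun x => (1 + ‖σ x‖) * (Real.exp ((w₀ * σ x).re + ε * ‖σ x‖) * ‖k x‖)) μ) :
    DifferentiableAt ℂ (fun w => ∫ x, Complex.exp (w * σ x) • k x ∂μ) w₀ := by
  have hmeas : ∀ w : ℂ, AEStronglyMeasurable (fun x => Complex.exp (w * σ x) • k x) μ := fun w =>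
    (Complex.continuous_exp.comp_aestronglyMeasurable (hσ.const_mul w)).smul hk
  have hexp : ∀ w ∈ Metric.ball w₀ ε, ∀ x,
      ‖Complex.exp (w * σ x)‖ ≤ Real.exp ((w₀ * σ x).re + ε * ‖σ x‖) := fun w hw x => by
    rw [Complex.norm_exp, Real.exp_le_exp, show w * σ x = w₀ * σ x + (w - w₀) * σ x by ring,
      Complex.add_re]
    refine add_le_add le_rfl ((Complex.re_le_norm _).trans ?_)
    rw [norm_mul]
    exact mul_le_mul_of_nonneg_right (mem_ball_iff_norm.1 hw).le (norm_nonneg _)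
  refine (hasDerivAt_integral_of_dominated_loc_of_deriv_le
    (F' := fun w x => (Complex.exp (w * σ x) * σ x) • k x) (Metric.ball_mem_nhds w₀ hε)
    (Eventually.of_forall hmeas) ?_ ?_ (Eventually.of_forall fun x w hw => ?_) hb
    (Eventually.of_forall fun x w _ => ?_)).2.differentiableAt
  · refine hb.mono' (hmeas w₀) (Eventually.of_forall fun x => ?_)
    rw [norm_smul]
    have h1 := hexp w₀ (Metric.mem_ball_self hε) x
    have h2 : ‖Complex.exp (w₀ * σ x)‖ * ‖k x‖
        ≤ Real.exp ((w₀ * σ x).re + ε * ‖σ x‖) * ‖k x‖ := by gcongr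
    refine h2.trans (le_mul_of_one_le_left (by positivity) ?_)
    linarith [norm_nonneg (σ x)]
  · exact ((Complex.continuous_exp.comp_aestronglyMeasurable (hσ.const_mul w₀)).mul hσ).smul hk
  · rw [norm_smul, norm_mul]
    have h1 := hexp w hw x
    calc _ ≤ Real.exp ((w₀ * σ x).re + ε * ‖σ x‖) * ‖σ x‖ * ‖k x‖ := by gcongr
      _ = ‖σ x‖ * (Real.exp ((w₀ * σ x).re + ε * ‖σ x‖) * ‖k x‖) := by ring
      _ ≤ _ := by
        refine mul_le_mul_of_nonneg_right ?_ (by positivity)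
        linarith
  · have h1 : HasDerivAt (fun w => w * σ x) (σ x) w := by
      simpa using (hasDerivAt_id w).mul_const (σ x)
    exact h1.cexp.smul_const (k x)

theorem differentiable_integral_exp_of_bounded {μ : Measure ℝ} [IsFiniteMeasure μ] {σ : ℝ → ℂ}
    {k : ℝ → B} {c M : ℝ} (hσ : AEStronglyMeasurable σ μ) (hk : AEStronglyMeasurable k μ)
    (hσc : ∀ᵐ x ∂μ, ‖σ x‖ ≤ c) (hkM : ∀ᵐ x ∂μ, ‖k x‖ ≤ M) :
    Differentiable ℂ fun w => ∫ x, Complex.exp (w * σ x) • k x ∂μ := by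
  intro w₀
  refine differentiableAt_integral_exp one_pos hσ hk ?_
  refine Integrable.of_bound (C := (1 + c) * (Real.exp (‖w₀‖ * c + 1 * c) * M)) ?_ ?_
  · have h1 : AEStronglyMeasurable (fun x => Real.exp ((w₀ * σ x).re + 1 * ‖σ x‖)) μ :=
      Real.continuous_exp.comp_aestronglyMeasurable
        ((Complex.continuous_re.comp_aestronglyMeasurable (hσ.const_mul w₀)).add
          (hσ.norm.const_mul 1))
    exact (hσ.norm.const_add 1).mul (h1.mul hk.norm)
  · filter_upwards [hσc, hkM] with x h1 h2
    rw [Real.norm_of_nonneg (by positivity)]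
    have hc : 0 ≤ c := (norm_nonneg _).trans h1
    have h3 : (w₀ * σ x).re ≤ ‖w₀‖ * c :=
      (Complex.re_le_norm _).trans (by rw [norm_mul]; gcongr)
    gcongr

/-- The kernel of the Laplace transform in the variable `s`, with `t = sinh s`. -/
def laplaceKernel (w s : ℂ) : ℂ := Complex.exp (w * Complex.sinh s) * Complex.cosh s

theorem differentiable_laplaceKernel (w : ℂ) : Differentiable ℂ (laplaceKernel w) :=
  ((Complex.differentiable_sinh.const_mul w).cexp).mul Complex.differentiable_cosh

theorem norm_sinh_le {s : ℂ} (hs : 0 ≤ s.re) : ‖Complex.sinh s‖ ≤ Real.exp s.re := by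
  rw [Complex.sinh, norm_div, Complex.norm_two]
  have h := norm_sub_le (Complex.exp s) (Complex.exp (-s))
  rw [Complex.norm_exp, Complex.norm_exp, Complex.neg_re] at h
  have : Real.exp (-s.re) ≤ Real.exp s.re := Real.exp_le_exp.2 (by linarith)
  linarith

/-- The hypotheses on an operator-valued function which allow the continuation of its Laplace
transform. -/
structure IsContourBounded (K : ℂ → B) (M : ℝ) : Prop where
  differentiableOn : DifferentiableOn ℂ K {s | 0 < s.re}
  norm_le_of_one_le : ∀ s : ℂ, 1 ≤ s.re → ‖K s‖ ≤ M
  norm_ofReal_le : ∀ x : ℝ, 0 < x → ‖K x‖ ≤ M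

/-- The part of the contour integral over `(0, 1)`. -/
def initialPart (K : ℂ → B) (w : ℂ) : B := ∫ x in (0 : ℝ)..1, laplaceKernel w x • K x

/-- The part of the contour integral over the segment from `1` to `1 + i φ`. -/
def verticalPart (K : ℂ → B) (φ : ℝ) (w : ℂ) : B :=
  ∫ y in (0 : ℝ)..φ, laplaceKernel w (1 + y * Complex.I) • K (1 + y * Complex.I)

/-- The part of the contour integral over the half-line from `1 + i φ`. -/
def horizontalPart (K : ℂ → B) (φ : ℝ) (w : ℂ) : B :=
  ∫ x in Ioi (1 : ℝ), laplaceKernel w (x + φ * Complex.I) • K (x + φ * Complex.I)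

/-- The Laplace transform along the contour from `0` through `1` and `1 + i φ` to `∞ + i φ`. -/
def contourLaplace (K : ℂ → B) (φ : ℝ) (w : ℂ) : B :=
  initialPart K w + (Complex.I • verticalPart K φ w + horizontalPart K φ w)

namespace IsContourBounded

variable {K : ℂ → B} {M : ℝ}

theorem nonneg (hK : IsContourBounded K M) : 0 ≤ M := (norm_nonneg _).trans (hK.norm_le_of_one_le 1 le_rfl)

theorem continuousOn_comp (hK : IsContourBounded K M) {γ : ℝ → ℂ} (hγ : Continuous γ) {S : Set ℝ}
    (hS : ∀ x ∈ S, 0 < (γ x).re) : ContinuousOn (fun x => K (γ x)) S :=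
  hK.differentiableOn.continuousOn.comp hγ.continuousOn hS

theorem continuousOn_kernel (hK : IsContourBounded K M) {γ : ℝ → ℂ} (hγ : Continuous γ) {S : Set ℝ}
    (hS : ∀ x ∈ S, 0 < (γ x).re) (w : ℂ) :
    ContinuousOn (fun x => laplaceKernel w (γ x) • K (γ x)) S :=
  ((differentiable_laplaceKernel w).continuous.comp hγ).continuousOn.smul
    (hK.continuousOn_comp hγ hS)

/-- Bounded pieces of the contour never obstruct the continuation: their integrals are entire in
`w`. -/
theorem differentiable_uIoc (hK : IsContourBounded K M) {γ : ℝ → ℂ} (hγ : Continuous γ) {a b : ℝ}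
    (hpos : ∀ x ∈ uIoc a b, 0 < (γ x).re) (hM : ∀ x ∈ uIoc a b, ‖K (γ x)‖ ≤ M) :
    Differentiable ℂ fun w => ∫ x in a..b, laplaceKernel w (γ x) • K (γ x) := by
  simp only [intervalIntegral.intervalIntegral_eq_integral_uIoc]
  refine Differentiable.const_smul ?_ _
  have hσ : Continuous fun x => Complex.sinh (γ x) := Complex.continuous_sinh.comp hγ
  have hc : Continuous fun x => Complex.cosh (γ x) := Complex.continuous_cosh.comp hγ
  obtain ⟨c, hc1⟩ := (isCompact_uIcc (a := a) (b := b)).exists_bound_of_continuousOn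
    hσ.continuousOn
  obtain ⟨c', hc2⟩ := (isCompact_uIcc (a := a) (b := b)).exists_bound_of_continuousOn
    hc.continuousOn
  have e1 : (fun w => ∫ x in uIoc a b, laplaceKernel w (γ x) • K (γ x))
      = fun w => ∫ x in uIoc a b, Complex.exp (w * Complex.sinh (γ x)) •
        (Complex.cosh (γ x) • K (γ x)) := by
    simp only [laplaceKernel, mul_smul]
  rw [e1]
  have hm : MeasurableSet (uIoc a b) := measurableSet_uIoc
  have : IsFiniteMeasure (volume.restrict (uIoc a b)) :=
    ⟨by rw [Measure.restrict_apply_univ]; exact measure_Ioc_lt_top⟩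
  refine differentiable_integral_exp_of_bounded (c := c) (M := c' * M) hσ.aestronglyMeasurable
    ((hc.continuousOn.smul (hK.continuousOn_comp hγ hpos)).aestronglyMeasurable hm)
    ((ae_restrict_iff' hm).2 (Eventually.of_forall fun x hx => hc1 x (uIoc_subset_uIcc hx)))
    ((ae_restrict_iff' hm).2 (Eventually.of_forall fun x hx => ?_))
  rw [norm_smul]
  have h1 := hc2 x (uIoc_subset_uIcc hx)
  have h2 := hM x hx
  exact mul_le_mul h1 h2 (norm_nonneg _) ((norm_nonneg _).trans h1)

theorem differentiable_initialPart (hK : IsContourBounded K M) : Differentiable ℂ (initialPart K) := by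
  have h01 : ∀ x ∈ uIoc (0 : ℝ) 1, 0 < x := fun x hx => by
    rw [uIoc_of_le zero_le_one] at hx; exact hx.1
  exact hK.differentiable_uIoc Complex.continuous_ofReal (fun x hx => by simpa using h01 x hx)
    fun x hx => hK.norm_ofReal_le x (h01 x hx)

theorem differentiable_verticalPart (hK : IsContourBounded K M) (φ : ℝ) :
    Differentiable ℂ (verticalPart K φ) :=
  hK.differentiable_uIoc (γ := fun y : ℝ => 1 + y * Complex.I) (by fun_prop) (fun x _ => by simp)
    fun x _ => hK.norm_le_of_one_le _ (by simp)

theorem norm_kernel_smul_le (hK : IsContourBounded K M) {w s : ℂ} {δ : ℝ} (hs : 1 ≤ s.re)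
    (hδ : (w * Complex.exp (s.im * Complex.I)).re ≤ -δ) :
    ‖laplaceKernel w s • K s‖
      ≤ Real.exp (‖w‖ / 2) * (Real.exp s.re * Real.exp (-(δ / 2) * Real.exp s.re)) * M := by
  rw [norm_smul]
  exact mul_le_mul (norm_exp_mul_sinh_mul_cosh_le w (zero_le_one.trans hs) hδ)
    (hK.norm_le_of_one_le s hs) (norm_nonneg _) (by positivity)

theorem integrableOn_horizontal (hK : IsContourBounded K M) {w : ℂ} {φ : ℝ}
    (hw : (w * Complex.exp (φ * Complex.I)).re < 0) :
    IntegrableOn (fun x : ℝ => laplaceKernel w (x + φ * Complex.I) • K (x + φ * Complex.I))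
      (Ioi 1) := by
  set δ := -(w * Complex.exp (φ * Complex.I)).re with hδ
  have hδ0 : 0 < δ := neg_pos.2 hw
  have h1 := ((integrableOn_exp_mul_exp_neg_exp (half_pos hδ0) 1).const_mul
    (Real.exp (‖w‖ / 2))).mul_const M
  refine h1.mono' ((hK.continuousOn_kernel (γ := fun x : ℝ => x + φ * Complex.I) (by fun_prop)
    (fun x hx => ?_) w).aestronglyMeasurable measurableSet_Ioi)
    ((ae_restrict_iff' measurableSet_Ioi).2 (Eventually.of_forall fun x hx => ?_))
  · have : (1 : ℝ) < x := hx
    simp only [Complex.add_re, Complex.ofReal_re, Complex.mul_re, Complex.I_re, Complex.ofReal_im,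
      Complex.I_im]
    linarith
  · have hre : ((x : ℂ) + φ * Complex.I).re = x := by simp
    have him : ((x : ℂ) + φ * Complex.I).im = φ := by simp
    have := hK.norm_kernel_smul_le (w := w) (s := x + φ * Complex.I) (δ := δ)
      (by rw [hre]; exact le_of_lt hx) (by rw [him, hδ, neg_neg])
    rwa [hre] at this

/-- The decay rate `δ / 2` at `w₀` is divided up: `δ / 8` pays for moving `w` in a ball of radius `δ
/ 8`, another `δ / 8` absorbs the factor `1 + ‖sinh‖` from differentiation, and `δ / 4` is left for
integrability. -/
theorem differentiableAt_horizontalPart (hK : IsContourBounded K M) {w₀ : ℂ} {φ : ℝ}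
    (hw : (w₀ * Complex.exp (φ * Complex.I)).re < 0) :
    DifferentiableAt ℂ (horizontalPart K φ) w₀ := by
  set δ := -(w₀ * Complex.exp (φ * Complex.I)).re with hδ
  have hδ0 : 0 < δ := neg_pos.2 hw
  set γ : ℝ → ℂ := fun x => x + φ * Complex.I with hγ
  have hγc : Continuous γ := by fun_prop
  have hre : ∀ x, (γ x).re = x := fun x => by simp [hγ]
  have him : ∀ x, (γ x).im = φ := fun x => by simp [hγ]
  have hpos : ∀ x ∈ Ioi (1 : ℝ), 0 < (γ x).re := fun x hx => by
    rw [hre]; exact zero_lt_one.trans hx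
  have e1 : horizontalPart K φ = fun w => ∫ x in Ioi (1 : ℝ),
      Complex.exp (w * Complex.sinh (γ x)) • (Complex.cosh (γ x) • K (γ x)) := by
    funext w
    simp only [horizontalPart, laplaceKernel, mul_smul, hγ]
  rw [e1]
  have hσ : Continuous fun x => Complex.sinh (γ x) := Complex.continuous_sinh.comp hγc
  have hc : Continuous fun x => Complex.cosh (γ x) := Complex.continuous_cosh.comp hγc
  have hk : AEStronglyMeasurable (fun x => Complex.cosh (γ x) • K (γ x))
      (volume.restrict (Ioi 1)) :=
    (hc.continuousOn.smul (hK.continuousOn_comp hγc hpos)).aestronglyMeasurable measurableSet_Ioi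
  refine differentiableAt_integral_exp (ε := δ / 8) (by positivity) hσ.aestronglyMeasurable hk ?_
  have hM := hK.nonneg
  have hdom := ((integrableOn_exp_mul_exp_neg_exp (show 0 < δ / 4 by positivity) 1).const_mul
    (16 / δ * Real.exp (‖w₀‖ / 2) * M))
  refine hdom.mono' ?_ ((ae_restrict_iff' measurableSet_Ioi).2
    (Eventually.of_forall fun x hx => ?_))
  · have h1 : Continuous fun x => Real.exp ((w₀ * Complex.sinh (γ x)).re
        + δ / 8 * ‖Complex.sinh (γ x)‖) := by fun_prop
    have h2 : Continuous fun x => 1 + ‖Complex.sinh (γ x)‖ := by fun_prop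
    exact h2.aestronglyMeasurable.mul (h1.aestronglyMeasurable.mul hk.norm)
  · have hx1 : (1 : ℝ) < x := hx
    have hx0 : 0 ≤ (γ x).re := (hpos x hx).le
    have s1 := norm_sinh_le hx0
    have s2 := norm_cosh_le hx0
    have s3 := re_mul_sinh_le w₀ hx0
    have s4 := hK.norm_le_of_one_le (γ x) (by rw [hre]; exact hx1.le)
    rw [him] at s3
    rw [hre] at s1 s2 s3
    have hwδ : (w₀ * Complex.exp (φ * Complex.I)).re = -δ := by rw [hδ, neg_neg]
    rw [hwδ] at s3
    set X := Real.exp x with hX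
    have hX1 : 1 ≤ X := Real.one_le_exp (by linarith)
    rw [Real.norm_of_nonneg (by positivity), norm_smul]
    have t1 : (w₀ * Complex.sinh (γ x)).re + δ / 8 * ‖Complex.sinh (γ x)‖
        ≤ ‖w₀‖ / 2 + (-(δ / 4) * X + -(δ / 8 * X)) := by
      have := mul_le_mul_of_nonneg_left s1 (show 0 ≤ δ / 8 by positivity)
      linarith
    have t2 : X * Real.exp (-(δ / 8 * X)) ≤ 8 / δ := by
      rw [Real.exp_neg, ← div_eq_mul_inv, div_le_div_iff₀ (Real.exp_pos _) hδ0]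
      have := Real.add_one_le_exp (δ / 8 * X)
      linarith
    calc _ ≤ (2 * X) * (Real.exp (‖w₀‖ / 2 + (-(δ / 4) * X + -(δ / 8 * X))) * (X * M)) := by
          refine mul_le_mul (by linarith) (mul_le_mul (Real.exp_le_exp.2 t1)
            (mul_le_mul s2 s4 (norm_nonneg _) (by positivity)) (by positivity) (by positivity))
            (by positivity) (by positivity)
      _ = 2 * (X * Real.exp (-(δ / 8 * X))) * Real.exp (‖w₀‖ / 2) * M
          * (X * Real.exp (-(δ / 4) * X)) := by
        rw [Real.exp_add, Real.exp_add]; ring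
      _ ≤ 2 * (8 / δ) * Real.exp (‖w₀‖ / 2) * M * (X * Real.exp (-(δ / 4) * X)) := by gcongr
      _ = _ := by ring

theorem differentiableAt_contourLaplace (hK : IsContourBounded K M) {w₀ : ℂ} {φ : ℝ}
    (hw : (w₀ * Complex.exp (φ * Complex.I)).re < 0) :
    DifferentiableAt ℂ (contourLaplace K φ) w₀ :=
  (hK.differentiable_initialPart w₀).add
    (((hK.differentiable_verticalPart φ w₀).const_smul Complex.I).add
      (hK.differentiableAt_horizontalPart hw))

theorem tendsto_exp_mul_exp_neg_exp {δ : ℝ} (hδ : 0 < δ) :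
    Tendsto (fun R : ℝ => Real.exp R * Real.exp (-δ * Real.exp R)) atTop (𝓝 0) := by
  have h1 := (Real.tendsto_pow_mul_exp_neg_atTop_nhds_zero 1).comp
    (Real.tendsto_exp_atTop.const_mul_atTop hδ)
  have h2 := h1.const_mul δ⁻¹
  rw [mul_zero] at h2
  refine h2.congr fun R => ?_
  simp only [Function.comp_apply, pow_one]
  rw [← mul_assoc, inv_mul_cancel_left₀ hδ.ne', neg_mul]

/-- Cauchy's theorem on the rectangle `[1, R] × [φ₁, φ₂]`. Every intermediate direction is one of
decay, uniformly so by compactness, and therefore the side at `R` vanishes in the limit. -/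
theorem contourLaplace_eq [CompleteSpace B] (hK : IsContourBounded K M) {w : ℂ} {φ₁ φ₂ : ℝ}
    (hw : ∀ y ∈ uIcc φ₁ φ₂, (w * Complex.exp (y * Complex.I)).re < 0) :
    contourLaplace K φ₁ w = contourLaplace K φ₂ w := by
  set g : ℂ → B := fun s => laplaceKernel w s • K s with hg
  have hgd : DifferentiableOn ℂ g {s | 0 < s.re} :=
    (differentiable_laplaceKernel w).differentiableOn.smul hK.differentiableOn
  obtain ⟨y₀, hy₀, hmax⟩ := (isCompact_uIcc (a := φ₁) (b := φ₂)).exists_isMaxOn nonempty_uIcc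
    (f := fun y : ℝ => (w * Complex.exp (y * Complex.I)).re) (by fun_prop)
  set δ := -(w * Complex.exp (y₀ * Complex.I)).re with hδ
  have hδ0 : 0 < δ := neg_pos.2 (hw y₀ hy₀)
  have hδy : ∀ y ∈ uIcc φ₁ φ₂, (w * Complex.exp (y * Complex.I)).re ≤ -δ := fun y hy => by
    rw [hδ, neg_neg]; exact hmax hy
  have hrect : ∀ R : ℝ, 1 ≤ R →
      (∫ x : ℝ in (1 : ℝ)..R, g (x + φ₁ * Complex.I)) - (∫ x : ℝ in (1 : ℝ)..R, g (x + φ₂ * Complex.I))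
        + Complex.I • (∫ y : ℝ in φ₁..φ₂, g (R + y * Complex.I))
        - Complex.I • (∫ y : ℝ in φ₁..φ₂, g (1 + y * Complex.I)) = 0 := by
    intro R hR
    have := Complex.integral_boundary_rect_eq_zero_of_differentiableOn g (1 + φ₁ * Complex.I)
      (R + φ₂ * Complex.I) (hgd.mono ?_)
    · simpa using this
    · intro s hs
      have h1 := hs.1
      simp only [mem_preimage, Complex.add_re, Complex.one_re, Complex.mul_re, Complex.ofReal_re,
        Complex.I_re, Complex.ofReal_im, Complex.I_im, mul_zero, zero_mul, sub_zero,
        add_zero, uIcc_of_le hR] at h1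
      exact zero_lt_one.trans_le h1.1
  have l1 : Tendsto (fun R : ℝ => ∫ x : ℝ in (1 : ℝ)..R, g (x + φ₁ * Complex.I)) atTop
      (𝓝 (horizontalPart K φ₁ w)) :=
    intervalIntegral_tendsto_integral_Ioi 1
      (hK.integrableOn_horizontal (hw φ₁ left_mem_uIcc)) tendsto_id
  have l2 : Tendsto (fun R : ℝ => ∫ x : ℝ in (1 : ℝ)..R, g (x + φ₂ * Complex.I)) atTop
      (𝓝 (horizontalPart K φ₂ w)) :=
    intervalIntegral_tendsto_integral_Ioi 1
      (hK.integrableOn_horizontal (hw φ₂ right_mem_uIcc)) tendsto_id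
  have l3 : Tendsto (fun R : ℝ => ∫ y : ℝ in φ₁..φ₂, g (R + y * Complex.I)) atTop (𝓝 0) := by
    refine squeeze_zero_norm' (a := fun R => Real.exp (‖w‖ / 2)
      * (Real.exp R * Real.exp (-(δ / 2) * Real.exp R)) * M * |φ₂ - φ₁|) ?_ ?_
    · filter_upwards [eventually_ge_atTop 1] with R hR
      refine intervalIntegral.norm_integral_le_of_norm_le_const fun y hy => ?_
      have hre : ((R : ℂ) + y * Complex.I).re = R := by simp
      have him : ((R : ℂ) + y * Complex.I).im = y := by simp
      have := hK.norm_kernel_smul_le (w := w) (s := R + y * Complex.I) (δ := δ)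
        (by rw [hre]; exact hR) (by rw [him]; exact hδy y (uIoc_subset_uIcc hy))
      rwa [hre] at this
    · simpa using (((tendsto_exp_mul_exp_neg_exp (half_pos hδ0)).const_mul
        (Real.exp (‖w‖ / 2))).mul_const M).mul_const |φ₂ - φ₁|
  have hvert : (∫ y : ℝ in φ₁..φ₂, g (1 + y * Complex.I))
      = verticalPart K φ₂ w - verticalPart K φ₁ w := by
    have hi : ∀ a b : ℝ, IntervalIntegrable (fun y : ℝ => g (1 + y * Complex.I)) volume a b :=
      fun a b => (hK.continuousOn_kernel (γ := fun y : ℝ => 1 + y * Complex.I) (by fun_prop)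
        (fun x _ => by simp) w).intervalIntegrable
    exact (intervalIntegral.integral_interval_sub_left (hi 0 φ₂) (hi 0 φ₁)).symm
  have lim := ((l1.sub l2).add (l3.const_smul Complex.I)).sub_const
    (Complex.I • ∫ y : ℝ in φ₁..φ₂, g (1 + y * Complex.I))
  have hz := tendsto_nhds_unique (tendsto_const_nhds.congr' (by
    filter_upwards [eventually_ge_atTop 1] with R hR using (hrect R hR).symm)) lim
  rw [hvert, smul_zero, add_zero, smul_sub] at hz
  have hz' : horizontalPart K φ₁ w + Complex.I • verticalPart K φ₁ w
      = horizontalPart K φ₂ w + Complex.I • verticalPart K φ₂ w := by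
    rw [← sub_eq_zero, hz]; abel
  rw [contourLaplace, contourLaplace, add_comm (Complex.I • _), hz', add_comm (horizontalPart K φ₂ w)]

theorem contourLaplace_zero (hK : IsContourBounded K M) {w : ℂ} (hw : w.re < 0) :
    contourLaplace K 0 w = ∫ x in Ioi (0 : ℝ), laplaceKernel w x • K x := by
  have hw' : (w * Complex.exp ((0 : ℝ) * Complex.I)).re < 0 := by simpa using hw
  have h1 := hK.integrableOn_horizontal hw'
  simp only [Complex.ofReal_zero, zero_mul, add_zero] at h1
  have h2 : IntegrableOn (fun x : ℝ => laplaceKernel w x • K x) (Ioc 0 1) := by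
    obtain ⟨c, hc⟩ := (isCompact_Icc (a := (0 : ℝ)) (b := 1)).exists_bound_of_continuousOn
      ((differentiable_laplaceKernel w).continuous.comp Complex.continuous_ofReal).continuousOn
    refine ⟨(hK.continuousOn_kernel Complex.continuous_ofReal
        (fun x hx => by simpa using hx.1) w).aestronglyMeasurable measurableSet_Ioc,
      HasFiniteIntegral.restrict_of_bounded (c * M) measure_Ioc_lt_top
      ((ae_restrict_iff' measurableSet_Ioc).2 (Eventually.of_forall fun x hx => ?_))⟩
    rw [norm_smul]
    have h3 := hc x (Ioc_subset_Icc_self hx)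
    exact mul_le_mul h3 (hK.norm_ofReal_le x hx.1) (norm_nonneg _) ((norm_nonneg _).trans h3)
  rw [← Ioc_union_Ioi_eq_Ioi zero_le_one, setIntegral_union (Ioc_disjoint_Ioi le_rfl)
    measurableSet_Ioi h2 h1, contourLaplace, initialPart, verticalPart, horizontalPart,
    intervalIntegral.integral_same, smul_zero, zero_add,
    intervalIntegral.integral_of_le zero_le_one]
  simp

/-- The Laplace transform of `K` in the logarithmic variable `ζ`, `w = e^{2ζ}`, is entire. -/
theorem exists_entire [CompleteSpace B] (hK : IsContourBounded K M) :
    ∃ F : ℂ → B, Differentiable ℂ F ∧ ∀ ζ : ℂ, ζ.im ∈ Ioo (Real.pi / 4) (3 * Real.pi / 4) →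
      F ζ = ∫ x in Ioi (0 : ℝ), laplaceKernel (Complex.exp (2 * ζ)) x • K x := by
  have hneg : ∀ (ζ : ℂ) (y : ℝ), Real.pi / 2 < 2 * ζ.im + y → 2 * ζ.im + y < Real.pi + Real.pi / 2 →
      (Complex.exp (2 * ζ) * Complex.exp (y * Complex.I)).re < 0 := by
    intro ζ y h1 h2
    rw [← Complex.exp_add, Complex.exp_re]
    have him : (2 * ζ + y * Complex.I).im = 2 * ζ.im + y := by simp
    rw [him]
    exact mul_neg_of_pos_of_neg (Real.exp_pos _) (Real.cos_neg_of_pi_div_two_lt_of_lt h1 h2)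
  have hpi := Real.pi_pos
  -- For `w = e^{2ζ}` the angle `π - 2 Im ζ` places `w e^{iφ}` on the negative real axis, the
  -- direction of fastest decay.
  set F : ℂ → B := fun ζ => contourLaplace K (Real.pi - 2 * ζ.im) (Complex.exp (2 * ζ)) with hF
  have heq : ∀ (ζ : ℂ) (φ : ℝ), Real.pi / 2 < 2 * ζ.im + φ → 2 * ζ.im + φ < Real.pi + Real.pi / 2 →
      F ζ = contourLaplace K φ (Complex.exp (2 * ζ)) := by
    intro ζ φ h1 h2
    refine hK.contourLaplace_eq fun y hy => hneg ζ y ?_ ?_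
    · have h3 := (convex_Ioi (Real.pi / 2 - 2 * ζ.im)).ordConnected.uIcc_subset
        (x := Real.pi - 2 * ζ.im) (y := φ) (by simp only [mem_Ioi]; linarith)
        (by simp only [mem_Ioi]; linarith) hy
      simp only [mem_Ioi] at h3
      linarith
    · have h3 := (convex_Iio (Real.pi + Real.pi / 2 - 2 * ζ.im)).ordConnected.uIcc_subset
        (x := Real.pi - 2 * ζ.im) (y := φ) (by simp only [mem_Iio]; linarith)
        (by simp only [mem_Iio]; linarith) hy
      simp only [mem_Iio] at h3
      linarith
  refine ⟨F, fun ζ₀ => ?_, fun ζ hζ => ?_⟩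
  · set φ₀ := Real.pi - 2 * ζ₀.im with hφ₀
    -- The angle in `F` varies with `ζ` and not holomorphically. Near `ζ₀` it can be frozen, since
    -- angles within `π / 2` of the optimal one give the same value.
    have hev : F =ᶠ[𝓝 ζ₀] fun ζ => contourLaplace K φ₀ (Complex.exp (2 * ζ)) := by
      have hU : {ζ : ℂ | ζ.im ∈ Ioo (ζ₀.im - Real.pi / 4) (ζ₀.im + Real.pi / 4)} ∈ 𝓝 ζ₀ :=
        Complex.continuous_im.continuousAt.preimage_mem_nhds
          (Ioo_mem_nhds (by linarith) (by linarith))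
      filter_upwards [hU] with ζ hζ
      obtain ⟨h1, h2⟩ := hζ
      exact heq ζ φ₀ (by rw [hφ₀]; linarith) (by rw [hφ₀]; linarith)
    refine DifferentiableAt.congr_of_eventuallyEq ?_ hev
    refine DifferentiableAt.comp ζ₀ (g := contourLaplace K φ₀) (f := fun ζ => Complex.exp (2 * ζ))
      (hK.differentiableAt_contourLaplace (hneg ζ₀ φ₀ ?_ ?_))
      ((differentiableAt_id.const_mul 2).cexp)
    · rw [hφ₀]; linarith
    · rw [hφ₀]; linarith
  · obtain ⟨h1, h2⟩ := hζ
    rw [heq ζ 0 (by linarith) (by linarith)]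
    refine hK.contourLaplace_zero ?_
    simpa using hneg ζ 0 (by linarith) (by linarith)

end IsContourBounded

end Contour
end RiemannianCone

namespace RiemannianCone

open MeasureTheory Set Filter

/-! ### Bounds for the Gaussian exponent -/

section HyperbolicTangent

theorem norm_sinh_le_cosh_re (z : ℂ) : ‖Complex.sinh z‖ ≤ Real.cosh z.re := by
  rw [Complex.sinh, norm_div, Complex.norm_two, Real.cosh_eq]
  have h := norm_sub_le (Complex.exp z) (Complex.exp (-z))
  rw [Complex.norm_exp, Complex.norm_exp, Complex.neg_re] at h
  linarith

theorem sinh_re_le_norm_cosh (z : ℂ) : Real.sinh z.re ≤ ‖Complex.cosh z‖ := by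
  rw [Complex.cosh, norm_div, Complex.norm_two, Real.sinh_eq]
  have h := norm_sub_norm_le (Complex.exp z) (-Complex.exp (-z))
  rw [norm_neg, Complex.norm_exp, Complex.norm_exp, Complex.neg_re, sub_neg_eq_add] at h
  linarith

theorem cosh_ne_zero_of_re_pos {z : ℂ} (hz : 0 < z.re) : Complex.cosh z ≠ 0 :=
  norm_pos_iff.1 ((Real.sinh_pos_iff.2 hz).trans_le (sinh_re_le_norm_cosh z))

/-- The quotient is at most `coth (Re z)`, and `cosh x ≤ 3 sinh x` once `e^{2x} ≥ 2`. The poles of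
`tanh` lie on the imaginary axis; turning the contour off the real line only at `Re s = 1` keeps `s
/ 2` away from them. -/
theorem norm_tanh_le {z : ℂ} (hz : 1 / 2 ≤ z.re) : ‖Complex.tanh z‖ ≤ 3 := by
  have hs : 0 < Real.sinh z.re := Real.sinh_pos_iff.2 (by linarith)
  rw [Complex.tanh, norm_div, div_le_iff₀ (hs.trans_le (sinh_re_le_norm_cosh z))]
  refine (norm_sinh_le_cosh_re z).trans
    (le_trans ?_ (mul_le_mul_of_nonneg_left (sinh_re_le_norm_cosh z) zero_le_three))
  rw [Real.cosh_eq, Real.sinh_eq]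
  have h1 : 2 ≤ Real.exp (z.re + z.re) := by
    have := Real.add_one_le_exp (z.re + z.re); linarith
  have h2 : Real.exp (-z.re) * Real.exp (z.re + z.re) = Real.exp z.re := by
    rw [← Real.exp_add]; congr 1; ring
  nlinarith [Real.exp_pos (-z.re)]

/-- The exponent `tanh (s / 2) / 4` of the Gaussians in the lens transform. -/
def lensExponent (s : ℂ) : ℂ := Complex.tanh (s / 2) / 4

theorem differentiableAt_lensExponent {s : ℂ} (hs : 0 < s.re) :
    DifferentiableAt ℂ lensExponent s := by
  have hc : Complex.cosh (s / 2) ≠ 0 := cosh_ne_zero_of_re_pos (by simpa using hs)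
  have h2 : DifferentiableAt ℂ (fun s : ℂ => s / 2) s := differentiableAt_id.div_const 2
  have : lensExponent = fun s => Complex.sinh (s / 2) / Complex.cosh (s / 2) / 4 := by
    funext s; rw [lensExponent, Complex.tanh]
  rw [this]
  exact (h2.csinh.div h2.ccosh hc).div_const 4

theorem lensExponent_ofReal (x : ℝ) : lensExponent x = ((Real.tanh (x / 2) / 4 : ℝ) : ℂ) := by
  simp [lensExponent]

theorem norm_lensExponent_le_one {s : ℂ} (hs : 1 ≤ s.re) : ‖lensExponent s‖ ≤ 1 := by
  have h := norm_tanh_le (z := s / 2) (by simp; linarith)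
  rw [lensExponent, norm_div]
  norm_num
  linarith

theorem norm_lensExponent_ofReal_le_one (x : ℝ) : ‖lensExponent x‖ ≤ 1 := by
  rw [lensExponent_ofReal, Complex.norm_real, norm_div]
  have := (Real.abs_tanh_lt_one (x / 2)).le
  norm_num
  linarith

end HyperbolicTangent

/-! ### The holomorphic extension of the cut off heat semigroup -/

section CutoffGaussian
set_option linter.unusedSectionVars false

variable {d : ℕ} {H : Type*} [TopologicalSpace H] {I : ModelWithCorners ℝ (Coord d) H}
  {Y : Type*} [TopologicalSpace Y] [ChartedSpace H Y] [IsManifold I ∞ Y]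
  [MeasurableSpace Y] [BorelSpace Y] [CompactSpace Y] {h : Metric I Y}

theorem mulL2_sub {g g' : ℝ × Y → ℂ} (hg : MemLp g ⊤ (coneMeasure h))
    (hg' : MemLp g' ⊤ (coneMeasure h)) :
    mulL2 h (fun p => g p - g' p) = mulL2 h g - mulL2 h g' := by
  ext1 f
  refine Lp.ext ?_
  rw [sub_apply]
  filter_upwards [coeFn_mulL2 hg f, coeFn_mulL2 hg' f, coeFn_mulL2 (hg.sub hg') f,
    Lp.coeFn_sub (mulL2 h g f) (mulL2 h g' f)] with p h1 h2 h3 h4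
  rw [h4, Pi.sub_apply, h1, h2, ← sub_mul]
  exact h3

theorem mulL2_const_mul {g : ℝ × Y → ℂ} (hg : MemLp g ⊤ (coneMeasure h)) (c : ℂ) :
    mulL2 h (fun p => c * g p) = c • mulL2 h g := by
  ext1 f
  refine Lp.ext ?_
  rw [smul_apply]
  filter_upwards [coeFn_mulL2 hg f, coeFn_mulL2 (hg.const_mul c) f,
    Lp.coeFn_smul c (mulL2 h g f)] with p h1 h2 h3
  rw [h3, Pi.smul_apply, h1, h2, smul_eq_mul, mul_assoc]

variable (h) in
/-- Multiplication by `e^{m r²} χ`. -/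
def cutoffGauss (χ : ℝ × Y → ℂ) (m : ℂ) : ConeL2 h →L[ℂ] ConeL2 h :=
  mulL2 h fun p => Complex.exp (m * (p.1 : ℂ) ^ 2) * χ p

variable {χ : ℝ × Y → ℂ}

theorem contDiff_exp_mul_sq (m : ℂ) :
    ContDiff ℝ ∞ fun r : ℝ => Complex.exp (m * (r : ℂ) ^ 2) := by
  have h1 : ContDiff ℝ ∞ fun r : ℝ => (r : ℂ) := Complex.ofRealCLM.contDiff
  exact (contDiff_const.mul (h1.pow 2)).cexp

theorem IsTest.memLp_exp_mul {S : Set Y} (hχ : IsTest I S χ) (m : ℂ) :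
    MemLp (fun p : ℝ × Y => Complex.exp (m * (p.1 : ℂ) ^ 2) * χ p) ⊤ (coneMeasure h) :=
  (hχ.radial_mul (contDiff_exp_mul_sq m)).memLp_top h

theorem IsTest.memLp_sq_mul_exp_mul {S : Set Y} (hχ : IsTest I S χ) (m : ℂ) :
    MemLp (fun p : ℝ × Y => (p.1 : ℂ) ^ 2 * (Complex.exp (m * (p.1 : ℂ) ^ 2) * χ p)) ⊤
      (coneMeasure h) := by
  have h1 : ContDiff ℝ ∞ fun r : ℝ => (r : ℂ) := Complex.ofRealCLM.contDiff
  exact ((hχ.radial_mul (contDiff_exp_mul_sq m)).radial_mul (h1.pow 2)).memLp_top h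

theorem IsTest.exists_bound {S : Set Y} (hχ : IsTest I S χ) :
    ∃ b c : ℝ, 0 ≤ b ∧ 0 ≤ c ∧ ∀ p, ‖χ p‖ ≤ c ∧ (χ p ≠ 0 → p.1 ^ 2 ≤ b) := by
  obtain ⟨a, b, ha, hs⟩ := hχ.exists_strip
  obtain ⟨c, hc⟩ := hχ.hasCompactSupport.exists_bound_of_continuous hχ.contMDiff.continuous
  refine ⟨b ^ 2, max c 0, sq_nonneg _, le_max_right _ _, fun p => ⟨(hc p).trans (le_max_left _ _),
    fun hp => ?_⟩⟩
  have hm : p.1 ∈ Icc a b := by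
    by_contra hn
    exact hp (hs p hn)
  exact pow_le_pow_left₀ (ha.le.trans hm.1) hm.2 2

theorem norm_exp_mul_sq_le {b r : ℝ} (hr : r ^ 2 ≤ b) (m : ℂ) :
    ‖Complex.exp (m * (r : ℂ) ^ 2)‖ ≤ Real.exp (‖m‖ * b) := by
  rw [Complex.norm_exp]
  refine Real.exp_le_exp.2 ((Complex.re_le_norm _).trans ?_)
  rw [norm_mul, norm_pow, Complex.norm_real, Real.norm_eq_abs, sq_abs]
  gcongr

/-- The factor `e^{m r²}` may grow for complex or positive `m`, but `χ` confines `r²` to `[0, b]`.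
This is where the cutoffs are indispensable. -/
theorem norm_cutoffGauss_le {b c : ℝ} (hc0 : 0 ≤ c)
    (hb : ∀ p, ‖χ p‖ ≤ c ∧ (χ p ≠ 0 → p.1 ^ 2 ≤ b)) (m : ℂ) :
    ‖cutoffGauss h χ m‖ ≤ Real.exp (‖m‖ * b) * c := by
  refine norm_mulL2_le (by positivity) fun p => ?_
  rw [norm_mul]
  by_cases hp : χ p = 0
  · rw [hp, norm_zero, mul_zero]; positivity
  · gcongr
    · exact norm_exp_mul_sq_le ((hb p).2 hp) m
    · exact (hb p).1

/-- Multiplication by `e^{m r²} χ` depends holomorphically on `m`. -/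
theorem differentiableAt_cutoffGauss {S : Set Y} (hχ : IsTest I S χ) (m : ℂ) :
    DifferentiableAt ℂ (cutoffGauss h χ) m := by
  obtain ⟨b, c, hb0, hc0, hb⟩ := hχ.exists_bound
  have key : HasDerivAt (cutoffGauss h χ)
      (mulL2 h fun p => (p.1 : ℂ) ^ 2 * (Complex.exp (m * (p.1 : ℂ) ^ 2) * χ p)) m := by
    rw [hasDerivAt_iff_isLittleO_nhds_zero]
    refine Asymptotics.IsBigO.trans_isLittleO (g := fun z : ℂ => ‖z‖ ^ 2) ?_ ?_
    -- Pointwise, the remainder is `e^{z r²} - 1 - z r²` times the old multiplier. Below, `‖z‖ < (b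
    -- + 1)⁻¹` keeps `‖z‖ r² ≤ 1` on the support, where the quadratic estimate of the exponential
    -- applies.
    · refine Asymptotics.IsBigO.of_bound (b ^ 2 * (Real.exp (‖m‖ * b) * c)) ?_
      have hball : ∀ᶠ z : ℂ in 𝓝 0, ‖z‖ < (b + 1)⁻¹ :=
        (continuous_norm.tendsto' (0 : ℂ) 0 norm_zero).eventually (gt_mem_nhds (by positivity))
      filter_upwards [hball] with z hz
      rw [cutoffGauss, cutoffGauss, ← mulL2_const_mul (hχ.memLp_sq_mul_exp_mul m) z,
        ← mulL2_sub (hχ.memLp_exp_mul (m + z)) (hχ.memLp_exp_mul m),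
        ← mulL2_sub (g := fun p => Complex.exp ((m + z) * (p.1 : ℂ) ^ 2) * χ p
            - Complex.exp (m * (p.1 : ℂ) ^ 2) * χ p) ((hχ.memLp_exp_mul (m + z)).sub (hχ.memLp_exp_mul m))
          ((hχ.memLp_sq_mul_exp_mul m).const_mul z), norm_pow, norm_norm]
      refine norm_mulL2_le (by positivity) fun p => ?_
      have e1 : Complex.exp ((m + z) * (p.1 : ℂ) ^ 2) * χ p - Complex.exp (m * (p.1 : ℂ) ^ 2) * χ p
          - z * ((p.1 : ℂ) ^ 2 * (Complex.exp (m * (p.1 : ℂ) ^ 2) * χ p))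
          = (Complex.exp (z * (p.1 : ℂ) ^ 2) - 1 - z * (p.1 : ℂ) ^ 2)
            * (Complex.exp (m * (p.1 : ℂ) ^ 2) * χ p) := by
        rw [add_mul, Complex.exp_add]; ring
      rw [e1, norm_mul, norm_mul]
      by_cases hp : χ p = 0
      · rw [hp, norm_zero, mul_zero, mul_zero]; positivity
      · have hr := (hb p).2 hp
        have hn : ‖z * (p.1 : ℂ) ^ 2‖ ≤ ‖z‖ * b := by
          rw [norm_mul, norm_pow, Complex.norm_real, Real.norm_eq_abs, sq_abs]
          gcongr
        have hz1 : ‖z‖ * b ≤ 1 := by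
          have h1 : ‖z‖ * (b + 1) ≤ 1 := by
            refine (mul_le_mul_of_nonneg_right hz.le (by positivity)).trans_eq ?_
            exact inv_mul_cancel₀ (by positivity)
          nlinarith [norm_nonneg z]
        calc _ ≤ (‖z‖ * b) ^ 2 * (Real.exp (‖m‖ * b) * c) := by
              gcongr
              · exact (Complex.norm_exp_sub_one_sub_id_le (hn.trans hz1)).trans (by gcongr)
              · exact norm_exp_mul_sq_le hr m
              · exact (hb p).1
          _ = _ := by ring
    · exact Asymptotics.isLittleO_norm_pow_id one_lt_two
  exact key.differentiableAt

theorem cutoffGauss_comp_gaussL2 {S : Set Y} (hχ : IsTest I S χ) {a : ℝ} (ha : 0 ≤ a) :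
    cutoffGauss h χ a ∘L gaussL2 h a = mulL2 h χ := by
  have e : (fun p : ℝ × Y => Complex.exp ((a : ℂ) * (p.1 : ℂ) ^ 2) * χ p * gaussian a p.1) = χ := by
    funext p
    rw [mul_right_comm, gaussian, Complex.ofReal_exp, ← Complex.exp_add]
    simp
  rw [cutoffGauss, gaussL2, mulL2_comp (hχ.memLp_exp_mul _) (memLp_gaussian ha)
    (by rw [e]; exact hχ.memLp_top h), e]

theorem gaussL2_comp_cutoffGauss {S : Set Y} (hχ : IsTest I S χ) {a : ℝ} (ha : 0 ≤ a) :
    gaussL2 h a ∘L cutoffGauss h χ a = mulL2 h χ := by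
  have e : (fun p : ℝ × Y => gaussian a p.1 * (Complex.exp ((a : ℂ) * (p.1 : ℂ) ^ 2) * χ p)) = χ := by
    funext p
    rw [← mul_assoc, gaussian, Complex.ofReal_exp, ← Complex.exp_add]
    simp
  rw [cutoffGauss, gaussL2, mulL2_comp (memLp_gaussian ha) (hχ.memLp_exp_mul _)
    (by rw [e]; exact hχ.memLp_top h), e]

variable (h) in
/-- The holomorphic extension to `Re s > 0` of the cut off heat semigroup
`χ e^{(sinh s) Δ} χ`. -/
def cutoffHeat (S : Set Y) (χ : ℝ × Y → ℂ) (s : ℂ) : ConeL2 h →L[ℂ] ConeL2 h :=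
  cutoffGauss h χ (lensExponent s) * heat (coneResolvent h S (1 / 4)) 0 s
    * cutoffGauss h χ (lensExponent s)

/-- On the positive real axis the growing Gaussians in the definition undo the decaying ones of the
lens formula. -/
theorem cutoffHeat_ofReal (S : Set Y) {S' : Set Y} (hχ : IsTest I S' χ) {x : ℝ} (hx : 0 < x) :
    cutoffHeat h S χ x
      = mulL2 h χ * heat (coneResolvent h S 0) 0 (Complex.sinh x) * mulL2 h χ := by
  have ha : 0 ≤ Real.tanh (x / 2) / 4 := by
    rw [Real.tanh_eq_sinh_div_cosh]
    have := Real.sinh_pos_iff.2 (half_pos hx)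
    have := Real.cosh_pos (x / 2)
    positivity
  rw [cutoffHeat, lensExponent_ofReal, ← gaussL2_comp_heat_comp_gaussL2 h S hx,
    ← Complex.ofReal_sinh]
  nth_rewrite 1 [← cutoffGauss_comp_gaussL2 (h := h) hχ ha]
  rw [← gaussL2_comp_cutoffGauss (h := h) hχ ha]
  rfl

/-- The oscillator semigroup is a contraction for every `Im s`, and the Gaussian exponent has
modulus at most `1` on the real axis and for `Re s ≥ 1`. -/
theorem exists_isContourBounded_cutoffHeat (S : Set Y) {S' : Set Y} (hχ : IsTest I S' χ) :
    ∃ M, IsContourBounded (cutoffHeat h S χ) M := by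
  obtain ⟨b, c, hb0, hc0, hb⟩ := hχ.exists_bound
  have hC := isUnitOperator_coneResolvent h S (1 / 4)
  have hbound : ∀ s : ℂ, 0 < s.re → ‖lensExponent s‖ ≤ 1 →
      ‖cutoffHeat h S χ s‖ ≤ Real.exp b * c * (Real.exp b * c) := by
    intro s hs hm
    have h1 : ‖cutoffGauss h χ (lensExponent s)‖ ≤ Real.exp b * c :=
      (norm_cutoffGauss_le hc0 hb _).trans (by
        gcongr
        exact mul_le_of_le_one_left hb0 hm)
    have h2 := hC.norm_heat_zero_le hs.le
    refine (norm_mul_le _ _).trans (mul_le_mul ((norm_mul_le _ _).trans ?_) h1 (norm_nonneg _)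
      (by positivity))
    exact (mul_le_of_le_one_right (norm_nonneg _) h2).trans h1
  refine ⟨_, ⟨fun s hs => ?_, fun s hs => hbound s (by linarith) (norm_lensExponent_le_one hs),
    fun x hx => hbound x (by simpa using hx) (norm_lensExponent_ofReal_le_one x)⟩⟩
  have hQ : DifferentiableAt ℂ (fun s => cutoffGauss h χ (lensExponent s)) s :=
    (differentiableAt_cutoffGauss hχ _).comp s (differentiableAt_lensExponent hs)
  exact ((hQ.mul (hC.hasDerivAt_heat 0 hs).differentiableAt).mul hQ).differentiableWithinAt

end CutoffGaussian
end RiemannianCone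

namespace RiemannianCone

open MeasureTheory Set Filter

/-! ### The identity theorem for meromorphic functions -/

section MeromorphicIdentity

variable {B : Type*} [NormedAddCommGroup B] [NormedSpace ℂ B] [CompleteSpace B]

/-- A meromorphic function which agrees with an entire function on a nonempty open set has no
poles. -/
theorem meromorphicOrderAt_nonneg_of_eqOn {f F : ℂ → B} (hf : ∀ z, MeromorphicAt f z)
    (hF : Differentiable ℂ F) {U : Set ℂ} (hU : IsOpen U) (hne : U.Nonempty) (hfF : EqOn f F U)
    (z : ℂ) : 0 ≤ meromorphicOrderAt f z := by
  obtain ⟨u, hu⟩ := hne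
  have hFa : ∀ z, AnalyticAt ℂ F z := hF.analyticAt
  have hm : MeromorphicOn (f - F) univ := fun z _ => (hf z).sub (hFa z).meromorphicAt
  have htop : meromorphicOrderAt (f - F) u = ⊤ := by
    rw [meromorphicOrderAt_eq_top_iff]
    filter_upwards [mem_nhdsWithin_of_mem_nhds (hU.mem_nhds hu)] with y hy
    rw [Pi.sub_apply, hfF hy, sub_self]
  -- Infinite order propagates from `u` to `z` because the plane is connected.
  have hz : meromorphicOrderAt (f - F) z = ⊤ := by
    by_contra hz
    exact hm.meromorphicOrderAt_ne_top_of_isPreconnected isPreconnected_univ (mem_univ z)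
      (mem_univ u) hz htop
  rw [meromorphicOrderAt_eq_top_iff] at hz
  rw [meromorphicOrderAt_congr (f₂ := F) (hz.mono fun y hy => sub_eq_zero.1 hy)]
  exact (hFa z).meromorphicOrderAt_nonneg

end MeromorphicIdentity

/-! ### Continuation of the cutoff resolvent and absence of resonances -/

section Continuation
set_option linter.unusedSectionVars false

variable {d : ℕ} {H : Type*} [TopologicalSpace H] {I : ModelWithCorners ℝ (Coord d) H}
  {Y : Type*} [TopologicalSpace Y] [ChartedSpace H Y] [IsManifold I ∞ Y]
  [T2Space Y] [CompactSpace Y] [MeasurableSpace Y] [BorelSpace Y]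

theorem sq_ne_ofReal_of_im_pos {lam : ℂ} (hlam : 0 < lam.im) (y : ℝ) (hy : 0 ≤ y) :
    lam ^ 2 ≠ y := by
  intro he
  have h1 := congrArg Complex.re he
  have h2 := congrArg Complex.im he
  rw [sq, Complex.mul_re, Complex.ofReal_re] at h1
  rw [sq, Complex.mul_im, Complex.ofReal_im] at h2
  have h3 : lam.re = 0 := by
    have : lam.re * lam.im = 0 := by linarith
    exact (mul_eq_zero.1 this).resolve_right hlam.ne'
  rw [h3] at h1
  nlinarith

variable (h : Metric I Y) (bc : BoundaryCondition)

/-- The formula `((w + 1) C - 1)⁻¹ C` for the resolvent `(Δ + w)⁻¹`, where `C = (1 - Δ)⁻¹`. -/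
def shiftedResolvent (w : ℂ) : ConeL2 h →L[ℂ] ConeL2 h :=
  Ring.inverse ((w + 1) • coneResolvent h (bc.region I Y) 0 - 1)
    * coneResolvent h (bc.region I Y) 0

theorem isUnit_shift {lam : ℂ} (hlam : 0 < lam.im) :
    IsUnit ((lam ^ 2 + 1) • coneResolvent h (bc.region I Y) 0 - 1) :=
  (isUnitOperator_coneResolvent h (bc.region I Y) 0).isUnit_sub_one (sq_ne_ofReal_of_im_pos hlam)

theorem isResolventAt_shiftedResolvent {lam : ℂ} (hlam : 0 < lam.im) :
    IsResolventAt h bc (lam ^ 2) (shiftedResolvent h bc (lam ^ 2)) := by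
  obtain ⟨N, hN⟩ := isUnit_shift h bc hlam
  rw [shiftedResolvent, ← hN, Ring.inverse_unit]
  exact isResolventAt_of_isUnit h bc (lam ^ 2) N hN

theorem resolvent_eq_shiftedResolvent {lam : ℂ} (hlam : 0 < lam.im) :
    resolvent h bc lam = shiftedResolvent h bc (lam ^ 2) :=
  resolvent_eq h (isResolventAt_shiftedResolvent h bc hlam)

/-- The resolvent of the Friedrichs Laplacian exists in the upper half-plane. -/
theorem isResolventAt_resolvent {lam : ℂ} (hlam : 0 < lam.im) :
    IsResolventAt h bc (lam ^ 2) (resolvent h bc lam) := by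
  rw [resolvent_eq_shiftedResolvent h bc hlam]
  exact isResolventAt_shiftedResolvent h bc hlam

/-- `integral_heat_mul` gives the integral times `(w + 1) C - 1`. Inverting that factor leaves it to
the right of `C`, with which it commutes. -/
theorem shiftedResolvent_eq_integral {lam : ℂ} (hlam : 0 < lam.im) (hw : (lam ^ 2).re < 0) :
    shiftedResolvent h bc (lam ^ 2) = -∫ x in Ioi (0 : ℝ), laplaceKernel (lam ^ 2) x •
      heat (coneResolvent h (bc.region I Y) 0) 0 (Complex.sinh x) := by
  have hint := (isUnitOperator_coneResolvent h (bc.region I Y) 0).integral_heat_mul hw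
  obtain ⟨N, hN⟩ := isUnit_shift h bc hlam
  rw [shiftedResolvent]
  set C := coneResolvent h (bc.region I Y) 0
  rw [← hN] at hint ⊢
  have hcomm : Commute (N : ConeL2 h →L[ℂ] ConeL2 h) C := by
    rw [hN]
    exact ((Commute.refl C).smul_left _).sub_left (Commute.one_left C)
  rw [← Units.eq_mul_inv_iff_mul_eq] at hint
  rw [Ring.inverse_unit, hcomm.units_inv_left.eq]
  exact (by rw [neg_mul, neg_neg] : C * ↑N⁻¹ = -(-C * ↑N⁻¹)).trans (congrArg Neg.neg hint).symm

variable {χ : ℝ × Y → ℂ} (hχ : IsCutoff I χ)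

theorem cutoffResolvent_eq_integral {lam : ℂ} (hlam : 0 < lam.im) (hw : (lam ^ 2).re < 0) :
    cutoffResolvent h bc hχ lam = -∫ x in Ioi (0 : ℝ), laplaceKernel (lam ^ 2) x •
      cutoffHeat h (bc.region I Y) χ x := by
  have hi := (isUnitOperator_coneResolvent h (bc.region I Y) 0).integrableOn_exp_mul_cosh_smul_heat
    hw
  rw [cutoffResolvent, resolvent_eq_shiftedResolvent h bc hlam,
    shiftedResolvent_eq_integral h bc hlam hw, mulOp_eq_mulL2]
  set Q := mulL2 h χ
  have h1 := ((ContinuousLinearMap.mul ℂ (ConeL2 h →L[ℂ] ConeL2 h) Q).comp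
    ((ContinuousLinearMap.mul ℂ (ConeL2 h →L[ℂ] ConeL2 h)).flip Q)).integral_comp_comm hi
  simp only [ContinuousLinearMap.comp_apply, ContinuousLinearMap.flip_apply,
    ContinuousLinearMap.mul_apply'] at h1
  change Q * (-_ * Q) = _
  rw [neg_mul, mul_neg]
  refine congrArg Neg.neg (h1.symm.trans (setIntegral_congr_fun measurableSet_Ioi fun x hx => ?_))
  rw [cutoffHeat_ofReal _ hχ hx, laplaceKernel, smul_mul_assoc, mul_smul_comm, mul_assoc]

/-- The Laplace representation holds only for `π / 4 < arg λ < 3π / 4`. Analyticity on the whole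
physical half-plane comes from inversion in the algebra of bounded operators. -/
theorem differentiableAt_cutoffResolvent_exp {ζ : ℂ} (hζ : 0 < (Complex.exp ζ).im) :
    DifferentiableAt ℂ (fun ζ => cutoffResolvent h bc hχ (Complex.exp ζ)) ζ := by
  have hev : (fun ζ => cutoffResolvent h bc hχ (Complex.exp ζ))
      =ᶠ[𝓝 ζ] fun ζ => mulOp h hχ * (shiftedResolvent h bc (Complex.exp ζ ^ 2) * mulOp h hχ) := by
    have hopen : IsOpen {ζ : ℂ | 0 < (Complex.exp ζ).im} :=
      isOpen_lt continuous_const (Complex.continuous_im.comp Complex.continuous_exp)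
    filter_upwards [hopen.mem_nhds hζ] with z hz
    rw [cutoffResolvent, resolvent_eq_shiftedResolvent h bc hz]
    rfl
  refine DifferentiableAt.congr_of_eventuallyEq ?_ hev
  obtain ⟨N, hN⟩ := isUnit_shift h bc hζ
  have hsh : DifferentiableAt ℂ (fun ζ : ℂ => (Complex.exp ζ ^ 2 + 1) •
      coneResolvent h (bc.region I Y) 0 - 1) ζ :=
    (((Complex.differentiableAt_exp.pow 2).add_const 1).smul_const _).sub_const 1
  have hinv : DifferentiableAt ℂ (fun ζ : ℂ => Ring.inverse ((Complex.exp ζ ^ 2 + 1) •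
      coneResolvent h (bc.region I Y) 0 - 1)) ζ :=
    DifferentiableAt.comp ζ (g := Ring.inverse) (by rw [← hN]; exact differentiableAt_inverse N.isUnit) hsh
  exact ((hinv.mul_const _).mul_const _).const_mul _

/-- The cutoff resolvent extends to an entire function of `log lam`. -/
theorem exists_differentiable_eq_cutoffResolvent_exp :
    ∃ F : ℂ → ConeL2 h →L[ℂ] ConeL2 h, Differentiable ℂ F ∧
      ∀ ζ : ℂ, 0 < ζ.im → ζ.im < Real.pi → F ζ = cutoffResolvent h bc hχ (Complex.exp ζ) := by
  obtain ⟨M, hM⟩ := exists_isContourBounded_cutoffHeat (h := h) (bc.region I Y) hχ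
  obtain ⟨F, hF, hFeq⟩ := hM.exists_entire
  have hpi := Real.pi_pos
  have him : ∀ ζ : ℂ, 0 < ζ.im → ζ.im < Real.pi → 0 < (Complex.exp ζ).im := fun ζ h1 h2 => by
    rw [Complex.exp_im]
    exact mul_pos (Real.exp_pos _) (Real.sin_pos_of_pos_of_lt_pi h1 h2)
  refine ⟨-F, hF.neg, fun ζ h1 h2 => ?_⟩
  set U : Set ℂ := {ζ | 0 < ζ.im} ∩ {ζ | ζ.im < Real.pi} with hU
  have hUo : IsOpen U := (isOpen_lt continuous_const Complex.continuous_im).inter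
    (isOpen_lt Complex.continuous_im continuous_const)
  have hUc : IsPreconnected U :=
    ((convex_halfSpace_im_gt 0).inter (convex_halfSpace_im_lt Real.pi)).isPreconnected
  have hR : AnalyticOnNhd ℂ (fun ζ => cutoffResolvent h bc hχ (Complex.exp ζ)) U :=
    DifferentiableOn.analyticOnNhd (fun z hz =>
      (differentiableAt_cutoffResolvent_exp h bc hχ (him z hz.1 hz.2)).differentiableWithinAt) hUo
  have hFa : AnalyticOnNhd ℂ (-F) U := fun z _ => hF.neg.analyticAt z
  -- The point `λ = i`, in the middle of the sector of the Laplace representation; agreement near it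
  -- spreads over the strip `0 < Im ζ < π`.
  set ζ₀ : ℂ := ((Real.pi / 2 : ℝ) : ℂ) * Complex.I with hζ₀
  have hζ₀im : ζ₀.im = Real.pi / 2 := by simp [hζ₀]
  refine hFa.eqOn_of_preconnected_of_eventuallyEq hR hUc (z₀ := ζ₀)
    ⟨by rw [mem_ofPred_eq, hζ₀im]; positivity, by rw [mem_ofPred_eq, hζ₀im]; linarith⟩ ?_ ⟨h1, h2⟩
  have hV : {ζ : ℂ | ζ.im ∈ Ioo (Real.pi / 4) (3 * Real.pi / 4)} ∈ 𝓝 ζ₀ :=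
    Complex.continuous_im.continuousAt.preimage_mem_nhds
      (Ioo_mem_nhds (by rw [hζ₀im]; linarith) (by rw [hζ₀im]; linarith))
  filter_upwards [hV] with z hz
  have hz2 : Complex.exp z ^ 2 = Complex.exp (2 * z) := by
    rw [← Complex.exp_nat_mul]; norm_num
  have hre : (Complex.exp z ^ 2).re < 0 := by
    rw [hz2, Complex.exp_re]
    refine mul_neg_of_pos_of_neg (Real.exp_pos _) (Real.cos_neg_of_pi_div_two_lt_of_lt ?_ ?_)
    · simp; linarith [hz.1]
    · simp; linarith [hz.2]
  rw [cutoffResolvent_eq_integral h bc hχ (him z (by linarith [hz.1]) (by linarith [hz.2])) hre,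
    Pi.neg_apply, hFeq z hz, hz2]
  rfl

namespace LogCover

theorem log_ofLog (ζ : ℂ) : (ofLog ζ).log = ζ := by
  simp [log, ofLog, Complex.re_add_im]

theorem exp_log (lam : LogCover) : Complex.exp lam.log = lam.proj := by
  rw [log, proj, Complex.exp_add, ← Complex.ofReal_exp, Real.exp_log lam.modulus_pos]

theorem log_im (lam : LogCover) : lam.log.im = lam.arg := by
  simp [log]

theorem proj_ofLog (ζ : ℂ) : (ofLog ζ).proj = Complex.exp ζ := by
  rw [← exp_log, log_ofLog]

end LogCover

/-- The cutoff resolvent continues to the logarithmic cover. -/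
theorem exists_isContinuation :
    ∃ F : LogCover → ConeL2 h →L[ℂ] ConeL2 h, IsContinuation h bc hχ F := by
  obtain ⟨F, hF, hFeq⟩ := exists_differentiable_eq_cutoffResolvent_exp h bc hχ
  refine ⟨fun lam => F lam.log, fun ζ => ?_, fun lam hlam => ?_⟩
  · have he : (fun lam : LogCover => F lam.log) ∘ LogCover.ofLog = F := by
      funext z
      simp [LogCover.log_ofLog]
    rw [he]
    exact (hF.analyticAt ζ).meromorphicAt
  · rw [← LogCover.exp_log]
    exact hFeq _ (by rw [LogCover.log_im]; exact hlam.1) (by rw [LogCover.log_im]; exact hlam.2)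

variable {h bc hχ} in
/-- A meromorphic continuation of the cutoff resolvent has no poles. -/
theorem IsContinuation.not_hasPole {F : LogCover → ConeL2 h →L[ℂ] ConeL2 h}
    (hF : IsContinuation h bc hχ F) (lam : LogCover) : ¬ LogCover.HasPole F lam := by
  obtain ⟨G, hG, hGeq⟩ := exists_differentiable_eq_cutoffResolvent_exp h bc hχ
  -- In the coordinate `log λ` the physical half-plane is a nonempty open strip on which the given
  -- continuation agrees with the entire one; that suffices to exclude poles everywhere.
  have hUo : IsOpen ({ζ | 0 < ζ.im} ∩ {ζ : ℂ | ζ.im < Real.pi}) :=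
    (isOpen_lt continuous_const Complex.continuous_im).inter
      (isOpen_lt Complex.continuous_im continuous_const)
  have hpi := Real.pi_gt_three
  have hI : Complex.I ∈ {ζ | 0 < ζ.im} ∩ {ζ : ℂ | ζ.im < Real.pi} := by
    constructor
    · simp
    · simp only [mem_ofPred_eq, Complex.I_im]; linarith
  have heq : EqOn (F ∘ LogCover.ofLog) G ({ζ | 0 < ζ.im} ∩ {ζ : ℂ | ζ.im < Real.pi}) := by
    intro ζ hζ
    rw [hGeq ζ hζ.1 hζ.2, ← LogCover.proj_ofLog]
    exact hF.2 _ ⟨hζ.1, hζ.2⟩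
  have h0 := meromorphicOrderAt_nonneg_of_eqOn hF.1 hG hUo ⟨Complex.I, hI⟩ heq lam.log
  rw [LogCover.HasPole]
  exact h0.not_gt

end Continuation
end RiemannianCone

theorem theorem2 {d : ℕ} {H : Type*} [TopologicalSpace H]
    (I : ModelWithCorners ℝ (EuclideanSpace ℝ (Fin d)) H)
    {Y : Type*} [TopologicalSpace Y] [ChartedSpace H Y] [IsManifold I ∞ Y]
    [T2Space Y] [CompactSpace Y] [MeasurableSpace Y] [BorelSpace Y]
    (h : RiemannianCone.Metric I Y) (bc : RiemannianCone.BoundaryCondition) :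
    (∀ lam : ℂ, 0 < lam.im →
      RiemannianCone.IsResolventAt h bc (lam ^ 2) (RiemannianCone.resolvent h bc lam)) ∧
    (∀ (χ : ℝ × Y → ℂ) (hχ : RiemannianCone.IsCutoff I χ),
      ∃ F : RiemannianCone.LogCover →
          RiemannianCone.ConeL2 h →L[ℂ] RiemannianCone.ConeL2 h,
        RiemannianCone.IsContinuation h bc hχ F) ∧
    ∀ lam : RiemannianCone.LogCover, ¬ RiemannianCone.IsResonance h bc lam := by
  exact ⟨fun _ => RiemannianCone.isResolventAt_resolvent h bc,
    fun _ => RiemannianCone.exists_isContinuation h bc,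
    fun lam ⟨_, _, _, _, hF, hp⟩ => hF.not_hasPole lam hp⟩
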